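/- Let $C$ be a compact connected Riemann surface of genus $g(C)=\dim H^0(C,K_C)\ge 2$, with canonical bundle $K_C$. Let a projective coordinate system with $SL_2(\mathbb C)$ transition matrices be given on $C$: an open covering $C=\bigcup_\alpha U_\alpha$ with holomorphic coordinates $z_\alpha:U_\alpha\to\mathbb C$ and constant matrices $$f_{\alpha\beta}=\begin{bmatrix}a_{\alpha\beta}&b_{\alpha\beta}\\ c_{\alpha\beta}&d_{\alpha\beta}\end{bmatrix}\in SL_2(\mathbb C),\qquad z_\alpha=\frac{a_{\alpha\beta}z_\beta+b_{\alpha\beta}}{c_{\alpha\beta}z_\beta+d_{\alpha\beta}}\ \text{ on } U_\alpha\cap U_\beta,$$ such that $f_{\alpha\beta}f_{\beta\gamma}=f_{\alpha\gamma}$ whenever $U_\alpha\cap U_\beta\cap U_\gamma\neq\emptyset$. An $SL_2(\mathbb C)$-connection is a connection on a rank $2$ holomorphic vector bundle $E$ together with a parallel holomorphic trivialization of $\det E$. An $SL_2(\mathbb C)$-oper is a holomorphic vector bundle $E$ of rank $2$ on $C$ with a holomorphic $SL_2(\mathbb C)$-connection $\nabla:E\to E\otimes K_C$ which is irreducible (the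 image of its holonomy representation is Zariski dense in $SL_2(\mathbb C)$), for which there is a line subbundle $F\subset E$ such that $\nabla$ induces an $\mathcal O_C$-linear isomorphism $\overline\nabla:F\to (E/F)\otimes K_C$. Theorem (Projective coordinate systems and opers). The projective coordinate system determines an $SL_2(\mathbb C)$-oper $(E,\nabla)$ with $F= K_C^{1/2}$. More precisely: (1) The functions $\xi_{\alpha\beta}=c_{\alpha\beta}z_\beta+d_{\alpha\beta}$ are a holomorphic $1$-cocycle and define a line bundle $K_C^{1/2}$; the local formula $(v_\alpha,w_\alpha)\mapsto v_\alpha w_\alpha\,dz_\alpha$ is an isomorphism $K_C^{1/2}\otimes K_C^{1/2}\cong K_C$. (2) The matrices $g_{\alpha\beta}=\begin{bmatrix}\xi_{\alpha\beta}&-c_{\alpha\beta}\\0&\xi_{\alpha\beta}^{-1}\end{bmatrix}$ are a holomorphic $1$-cocycle and define a rank $2$ holomorphic vector bundle $E$. The first coordinate inclusion and the second coordinate projection in the local frames give an exact sequence of holomorphic vector bundles $0\to K_C^{1/2}\to E\to K_C^{-1/2}\to 0$, where $K_C^{-1/2}$ is the dual of $K_C^{1/2}$. (3) The local operators $\nabla_\alpha=d-X_-\,dz_\alpha$,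 $X_-=\begin{bmatrix}0&0\\1&0\end{bmatrix}$, in the frames of $E$ over $U_\alpha$, define a global holomorphic connection $\nabla$ on $E$, and $(E,\nabla)$ is an $SL_2(\mathbb C)$-oper with $F\subset E$ the image of $K_C^{1/2}$. The isomorphism $\overline\nabla:F\cong (E/F)\otimes K_C$ is given in the frame over $U_\alpha$ by multiplication by the $(2,1)$ entry $-dz_\alpha$ of the connection matrix $-X_-\,dz_\alpha$. (4) The matrices $\begin{bmatrix}0&1\\-1&z_\alpha\end{bmatrix}$ define a holomorphic isomorphism onto $(E,\nabla)$ from the flat bundle with constant transition functions $f_{\alpha\beta}$ and connection $d$, compatible with the connections. -/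

import Mathlib

open Bundle Set Topology
open scoped Manifold ContDiff Matrix MatrixGroups

noncomputable section

namespace Oper

/-! ### Riemann surfaces, the canonical bundle and the genus -/

section Surface

variable (C : Type*) [TopologicalSpace C] [ChartedSpace ℂ C] [IsManifold 𝓘(ℂ) ω C]

/-- The fibres of the canonical bundle `K_C`, the holomorphic cotangent bundle. -/
abbrev Canonical (x : C) : Type _ :=
  TangentSpace 𝓘(ℂ) x →L[ℂ] Bundle.Trivial C ℂ x

/-- The genus `dim H⁰(C, K_C)`: the dimension of the space of global holomorphic `1`-forms. -/
def genus : ℕ :=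
  Module.finrank ℂ (ContMDiffSection 𝓘(ℂ) (ℂ →L[ℂ] ℂ) ω (Canonical C))

/-- A projective coordinate system on `C`, indexed by `ι`, with `SL₂(ℂ)` transition matrices:
a covering of `C` by holomorphic coordinate neighbourhoods `(U_α, z_α)` such that on `U_α ∩ U_β`
one has `z_α = (a z_β + b) / (c z_β + d)` where `f_{αβ} = !![a, b; c, d] ∈ SL₂(ℂ)` is constant,
and where the lifts `f_{αβ}` of the fractional linear transformations are chosen so that they
form an `SL₂(ℂ)`-valued `1`-cocycle. -/
structure ProjectiveCoordinateSystem (ι : Type*) where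
  /-- the local coordinate `z_α`, with domain `U_α` -/
  z : ι → OpenPartialHomeomorph C ℂ
  holomorphic : ∀ α, z α ∈ IsManifold.maximalAtlas 𝓘(ℂ) ω C
  cover : ∀ x, ∃ α, x ∈ (z α).source
  /-- the transition matrix `f_{αβ}` -/
  f : ι → ι → SL(2, ℂ)
  mobius : ∀ α β, ∀ x ∈ (z α).source ∩ (z β).source,
    f α β 1 0 * z β x + f α β 1 1 ≠ 0 ∧
    z α x = (f α β 0 0 * z β x + f α β 0 1) / (f α β 1 0 * z β x + f α β 1 1)
  cocycle : ∀ α β γ, ((z α).source ∩ (z β).source ∩ (z γ).source).Nonempty →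
    f α β * f β γ = f α γ

end Surface

/-! ### Holomorphic vector bundles and connections -/

section Bundles

variable {C : Type*} [TopologicalSpace C] [ChartedSpace ℂ C]
  {F : Type*} [NormedAddCommGroup F] [NormedSpace ℂ F]
  {E : C → Type*} [TopologicalSpace (TotalSpace F E)]
  [∀ x, AddCommGroup (E x)] [∀ x, Module ℂ (E x)] [∀ x, TopologicalSpace (E x)]
  [FiberBundle F E]
  {F' : Type*} [NormedAddCommGroup F'] [NormedSpace ℂ F']
  {E' : C → Type*} [TopologicalSpace (TotalSpace F' E')]
  [∀ x, AddCommGroup (E' x)] [∀ x, Module ℂ (E' x)] [∀ x, TopologicalSpace (E' x)]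
  [FiberBundle F' E']

variable (F) in
/-- `s` restricts to a holomorphic section of the bundle `E` (with model fibre `F`) over `U`. -/
def IsHolomorphicSection (U : Set C) (s : Π x, E x) : Prop :=
  ContMDiffOn 𝓘(ℂ) (𝓘(ℂ).prod 𝓘(ℂ, F)) ω (fun x ↦ TotalSpace.mk' F x (s x)) U

variable (F F') in
/-- A family of linear maps between the fibres is a homomorphism of holomorphic vector bundles:
it maps local holomorphic sections to local holomorphic sections. -/
def IsHolomorphicHom (φ : ∀ x, E x →ₗ[ℂ] E' x) : Prop :=
  ∀ (U : Set C) (s : Π x, E x), IsOpen U → IsHolomorphicSection F U s →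
    IsHolomorphicSection F' U (fun x ↦ φ x (s x))

variable (F) in
/-- A family of lines in the fibres of `E` is a holomorphic line subbundle: locally it is spanned
by a nowhere vanishing holomorphic section of `E`. -/
def IsLineSubbundle (L : ∀ x, Submodule ℂ (E x)) : Prop :=
  ∀ x₀ : C, ∃ (U : Set C) (s : Π x, E x), IsOpen U ∧ x₀ ∈ U ∧ IsHolomorphicSection F U s ∧
    ∀ x ∈ U, s x ≠ 0 ∧ L x = Submodule.span ℂ {s x}

variable (F) in
/-- The line bundle `E` is a theta characteristic through the family of bilinear maps `κ`:
`κ` is holomorphic and induces an isomorphism `E ⊗ E ≅ K_C`. -/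
def IsThetaCharacteristic [IsManifold 𝓘(ℂ) ω C]
    (κ : ∀ x, E x →ₗ[ℂ] E x →ₗ[ℂ] Canonical C x) : Prop :=
  (∀ (U : Set C) (s t : Π x, E x), IsOpen U →
      IsHolomorphicSection F U s → IsHolomorphicSection F U t →
      IsHolomorphicSection (E := Canonical C) (ℂ →L[ℂ] ℂ) U (fun x ↦ κ x (s x) (t x))) ∧
    ∀ x, Function.Bijective (TensorProduct.lift (κ x))

variable [∀ x, IsTopologicalAddGroup (E x)] [∀ x, ContinuousSMul ℂ (E x)]

/-- The connection is holomorphic: it maps holomorphic sections of `E` over any open set `U` to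
holomorphic sections of `Hom(TC, E) = E ⊗ K_C` over `U`. -/
def IsHolomorphicConnection [VectorBundle ℂ F E] [IsManifold 𝓘(ℂ) ω C]
    (D : CovariantDerivative 𝓘(ℂ) F E) : Prop :=
  ∀ U : Set C, IsOpen U → ContMDiffCovariantDerivativeOn (I := 𝓘(ℂ)) F ω D U

/-- An `SL₂(ℂ)`-connection: there is a holomorphic trivialization of `det E`, i.e. a nowhere
vanishing holomorphic family of alternating forms `vol` on the fibres of the rank `2` bundle `E`,
that is parallel for the connection. -/
def IsSL2Connection (D : CovariantDerivative 𝓘(ℂ) F E) : Prop :=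
  Module.finrank ℂ F = 2 ∧
  ∃ vol : ∀ x, E x [⋀^Fin 2]→ₗ[ℂ] ℂ, (∀ x, vol x ≠ 0) ∧
    ∀ (U : Set C) (s t : Π x, E x), IsOpen U →
      IsHolomorphicSection F U s → IsHolomorphicSection F U t →
      ContMDiffOn 𝓘(ℂ) 𝓘(ℂ) ω (fun x ↦ vol x ![s x, t x]) U ∧
      ∀ x ∈ U, ∀ v : TangentSpace 𝓘(ℂ) x,
        mvfderiv 𝓘(ℂ) (fun x ↦ vol x ![s x, t x]) x v =
          vol x ![D s x v, t x] + vol x ![s x, D t x v]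

/-- `w` is the parallel transport of `v` along the path `γ`: there is a lift of `γ` to the total
space of `E`, going from `v` to `w`, that is locally given by flat local sections of `E`. -/
def IsParallelTransport (D : CovariantDerivative 𝓘(ℂ) F E) {x y : C} (γ : Path x y)
    (v : E x) (w : E y) : Prop :=
  ∃ Γ : unitInterval → TotalSpace F E,
    Γ 0 = TotalSpace.mk' F x v ∧ Γ 1 = TotalSpace.mk' F y w ∧
    ∀ t, ∃ (U : Set C) (s : Π x, E x), IsOpen U ∧ γ t ∈ U ∧ IsHolomorphicSection F U s ∧
      (∀ u ∈ U, D s u = 0) ∧ ∀ᶠ t' in 𝓝 t, Γ t' = TotalSpace.mk' F (γ t') (s (γ t'))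

/-- The image of the holonomy representation of `π₁(C, x)` on the fibre `E x`. -/
def holonomy (D : CovariantDerivative 𝓘(ℂ) F E) (x : C) : Set (E x →ₗ[ℂ] E x) :=
  {T | ∃ γ : Path x x, ∀ v, IsParallelTransport D γ v (T v)}

/-- Zariski density of a subset of the algebraic group `SL₂(ℂ)`: every polynomial in the matrix
entries that vanishes on `S` vanishes on `SL₂(ℂ)`. -/
def IsZariskiDense (S : Set SL(2, ℂ)) : Prop :=
  ∀ p : MvPolynomial (Fin 2 × Fin 2) ℂ,
    (∀ A ∈ S, MvPolynomial.eval (fun i ↦ A i.1 i.2) p = 0) →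
    ∀ A : SL(2, ℂ), MvPolynomial.eval (fun i ↦ A i.1 i.2) p = 0

/-- Irreducibility of an `SL₂(ℂ)`-connection: the image of the holonomy representation, written in
any basis of any fibre, is Zariski dense in `SL₂(ℂ)`. -/
def IsIrreducible (D : CovariantDerivative 𝓘(ℂ) F E) : Prop :=
  ∀ (x : C) (b : Module.Basis (Fin 2) ℂ (E x)),
    IsZariskiDense {A | ∃ T ∈ holonomy D x, LinearMap.toMatrix b b T = (A : Matrix _ _ ℂ)}

/-- The linear maps `φ x : L x → Hom(T_x C, E x / L x) = (E / L)_x ⊗ (K_C)_x` are induced by the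
connection: for every local holomorphic section `s` of `L`, the class of `∇ s` modulo `L`
is `φ s`. -/
def IsInducedBy (D : CovariantDerivative 𝓘(ℂ) F E) (L : ∀ x, Submodule ℂ (E x))
    (φ : ∀ x, L x →ₗ[ℂ] TangentSpace 𝓘(ℂ) x →ₗ[ℂ] E x ⧸ L x) : Prop :=
  ∀ (U : Set C) (s : Π x, E x), IsOpen U → IsHolomorphicSection F U s →
    ∀ (hs : ∀ x ∈ U, s x ∈ L x) (x : C) (hx : x ∈ U) (v : TangentSpace 𝓘(ℂ) x),
      φ x ⟨s x, hs x hx⟩ v = (L x).mkQ (D s x v)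

/-- `(E, ∇)` is an `SL₂(ℂ)`-oper with respect to the line subbundle `L ⊂ E`, where `φ` is the
isomorphism `L ≅ (E / L) ⊗ K_C` induced by `∇`: the pair `(E, ∇)` is an irreducible holomorphic
`SL₂(ℂ)`-connection, and the connection induces an isomorphism of the line bundles `L` and
`(E / L) ⊗ K_C`. -/
structure IsSL2Oper [VectorBundle ℂ F E] [IsManifold 𝓘(ℂ) ω C]
    (D : CovariantDerivative 𝓘(ℂ) F E) (L : ∀ x, Submodule ℂ (E x))
    (φ : ∀ x, L x →ₗ[ℂ] TangentSpace 𝓘(ℂ) x →ₗ[ℂ] E x ⧸ L x) : Prop where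
  holomorphicBundle : ContMDiffVectorBundle ω F E 𝓘(ℂ)
  holomorphicConnection : IsHolomorphicConnection D
  sl2 : IsSL2Connection D
  irreducible : IsIrreducible D
  lineSubbundle : IsLineSubbundle F L
  induced : IsInducedBy D L φ
  bijective : ∀ x, Function.Bijective (φ x)

end Bundles

/-! ### Bundles given by cocycles subordinate to a projective coordinate system -/

section Cores

variable {C : Type*} [TopologicalSpace C] {ι : Type*}
  {F : Type*} [NormedAddCommGroup F] [NormedSpace ℂ F] (Z : VectorBundleCore ℂ C F ι)

instance (x : C) : IsTopologicalAddGroup (Z.Fiber x) :=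
  inferInstanceAs (IsTopologicalAddGroup F)

instance (x : C) : ContinuousSMul ℂ (Z.Fiber x) :=
  inferInstanceAs (ContinuousSMul ℂ F)

/-- The coordinates `v_α` of a vector `v` in the fibre of `Z` at `x`, where `x` lies in the
domain of the local frame with index `α`. -/
def coords (α : ι) {x : C} (v : Z.Fiber x) : F :=
  (Z.localTriv α (TotalSpace.mk' F x v)).2

end Cores

namespace ProjectiveCoordinateSystem

variable {C : Type*} [TopologicalSpace C] [ChartedSpace ℂ C] [IsManifold 𝓘(ℂ) ω C] {ι : Type*}
  {F : Type*} [NormedAddCommGroup F] [NormedSpace ℂ F]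
  (P : ProjectiveCoordinateSystem C ι)

/-- The domain `U_α` of the coordinate `z_α`. -/
def U (α : ι) : Set C := (P.z α).source

/-- The differential `dz_α` at `x`. -/
def dz (α : ι) (x : C) : Canonical C x := mvfderiv 𝓘(ℂ) (P.z α) x

/-- `ξ_{αβ} = c_{αβ} z_β + d_{αβ}`. -/
def xi (α β : ι) (x : C) : ℂ := P.f α β 1 0 * P.z β x + P.f α β 1 1

/-- `g_{αβ} = !![ξ_{αβ}, -dξ_{αβ}/dz_β; 0, ξ_{αβ}⁻¹]`. -/
def g (α β : ι) (x : C) : Matrix (Fin 2) (Fin 2) ℂ :=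
  !![P.xi α β x, -P.f α β 1 0; 0, (P.xi α β x)⁻¹]

/-- The vector bundle `Z` is the holomorphic vector bundle defined on the covering `{U_α}` by the
transition functions `h_{αβ}`: coordinates of a vector in the frames over `U_α` and `U_β` are
related by `v_α = h_{αβ} v_β`. -/
structure IsDefinedBy (Z : VectorBundleCore ℂ C F ι) (h : ι → ι → C → F → F) : Prop where
  baseSet_eq : Z.baseSet = P.U
  coordChange_eq : ∀ α β, ∀ x ∈ P.U α ∩ P.U β, ∀ v, Z.coordChange β α x v = h α β x v
  holomorphic : Z.IsContMDiff 𝓘(ℂ) ω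

/-- The connection `D` is `d + A_α` in the frame over each `U_α`. -/
def HasConnectionMatrix (Z : VectorBundleCore ℂ C (Fin 2 → ℂ) ι)
    (D : CovariantDerivative 𝓘(ℂ) (Fin 2 → ℂ) Z.Fiber)
    (A : ∀ (_ : ι) (x : C), TangentSpace 𝓘(ℂ) x → Matrix (Fin 2) (Fin 2) ℂ) : Prop :=
  ∀ α, ∀ x ∈ P.U α, ∀ s : Π x, Z.Fiber x,
    MDifferentiableAt 𝓘(ℂ) (𝓘(ℂ).prod 𝓘(ℂ, Fin 2 → ℂ))
      (fun y ↦ TotalSpace.mk' (Fin 2 → ℂ) y (s y)) x →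
    ∀ v : TangentSpace 𝓘(ℂ) x,
      coords Z α (D s x v) =
        mvfderiv 𝓘(ℂ) (fun y ↦ coords Z α (s y)) x v
          + A α x v *ᵥ coords Z α (s x)

end ProjectiveCoordinateSystem

/-- The matrix `X₋`. -/
def Xminus : Matrix (Fin 2) (Fin 2) ℂ := !![0, 0; 1, 0]

end Oper

end

/-! Everything except irreducibility comes from one gauge identity. With `M_α = !![0, 1; -1, z_α]`
one has `M_α f_{αβ} = g_{αβ} M_β` (`flatMatrix_mul_f`). Hence `g` is a cocycle because `f` is, `ξ`
is a cocycle as a diagonal entry of the triangular `g`, and `E` is isomorphic to the flat bundle of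
`f`. Carrying `d` across gives `d - dM_α M_α⁻¹ = d - X₋ dz_α`. The second fundamental form of
`K^{1/2}` is the entry `-dz_α`, which vanishes nowhere, and `det g = 1` gives the parallel volume
form. The relation `dz_β = ξ_{αβ}² dz_α`, the derivative of a Möbius map of determinant one, makes
`K^{1/2}` a square root of `K`.

Irreducibility has an algebraic and an analytic half. Algebra: a subgroup of `SL₂(ℂ)` that is not
Zariski dense has a semi-invariant product of linear forms
(`isZariskiDense_of_not_hasSemiInvariant`). If a polynomial of degree `d` vanishes on the group but
not on all of `SL₂(ℂ)`, the subgroup cut out by all vanishing functions of degree at most `d` is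
proper. A nontrivial unipotent, or a semisimple element with `2d + 1` distinct powers of its
eigenvalue, drags a whole one-parameter group into that subgroup, which then fixes a line, preserves
a pair of lines, or is everything. Otherwise all eigenvalues are roots of unity of bounded order, so
there are finitely many traces, and the subgroup fixes a line or is finite.

Analysis: since the genus is at least two, some nonzero holomorphic form `h_β dz_β` has a zero
(`exists_form_zero`). Suppose the holonomy had a semi-invariant form of degree `k`. Its value at
`(z_β, 1)` is a section of `K^{-k/2}` up to constants, so its square times `h_β^k` is a holomorphic
function up to constants (`semiForm`). The logarithmic derivative is then a global meromorphic form
whose residues are vanishing orders. By the residue theorem (`residue_eq_zero`), nonnegative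
residues all vanish, yet at the zero of `h` the residue is positive
(`IsFormCoeff.not_hasSemiInvariant`). The residue theorem follows from the Cauchy–Pompeiu formula
and a partition of unity. -/

noncomputable section

namespace Oper

/-! ### Subgroups of `SL₂(ℂ)` that are not Zariski dense -/

/-- A polynomial function of degree at most `d` on `2 × 2` matrices, seen through its restrictions
to the curves `t ↦ t X + Y + t⁻¹ Z`. -/
def PolyOfDegree (d : ℕ) (f : Matrix (Fin 2) (Fin 2) ℂ → ℂ) : Prop :=
  ∀ X Y Z : Matrix (Fin 2) (Fin 2) ℂ, ∃ r : Polynomial ℂ, r.natDegree ≤ 2 * d ∧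
    ∀ t : ℂ, t ≠ 0 → t ^ d * f (t • X + Y + t⁻¹ • Z) = r.eval t

/-- The test curves are stable under linear maps, so the degree bound survives left and right
multiplication and the adjugate. This makes `closureOfDegree` a group and `IsClosedOfDegree`
invariant under conjugation. -/
lemma PolyOfDegree.comp {d : ℕ} {f : Matrix (Fin 2) (Fin 2) ℂ → ℂ} (hf : PolyOfDegree d f)
    (L : Matrix (Fin 2) (Fin 2) ℂ →ₗ[ℂ] Matrix (Fin 2) (Fin 2) ℂ) :
    PolyOfDegree d (fun A ↦ f (L A)) := by
  intro X Y Z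
  obtain ⟨r, hr, h⟩ := hf (L X) (L Y) (L Z)
  exact ⟨r, hr, fun t ht ↦ by simpa using h t ht⟩

lemma PolyOfDegree.mono {d e : ℕ} (hde : d ≤ e) {f : Matrix (Fin 2) (Fin 2) ℂ → ℂ}
    (hf : PolyOfDegree d f) : PolyOfDegree e f := by
  intro X Y Z
  obtain ⟨r, hr, h⟩ := hf X Y Z
  refine ⟨Polynomial.X ^ (e - d) * r, ?_, fun t ht ↦ ?_⟩
  · refine Polynomial.natDegree_mul_le.trans ?_
    rw [Polynomial.natDegree_X_pow]
    omega
  · rw [Polynomial.eval_mul, Polynomial.eval_pow, Polynomial.eval_X, ← h t ht, ← mul_assoc,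
      ← pow_add, Nat.sub_add_cancel hde]

/-- Each variable costs one factor `t`, and `t (t x + y + t⁻¹ z)` is a quadratic polynomial in `t`;
hence the bound `2 * d`. -/
lemma exists_polyOfDegree (p : MvPolynomial (Fin 2 × Fin 2) ℂ) :
    ∃ d, PolyOfDegree d (fun A ↦ MvPolynomial.eval (fun i ↦ A i.1 i.2) p) := by
  induction p using MvPolynomial.induction_on with
  | C a => exact ⟨0, fun X Y Z ↦ ⟨Polynomial.C a, by simp, by simp⟩⟩
  | add p q hp hq =>
    obtain ⟨d, hd⟩ := hp
    obtain ⟨e, he⟩ := hq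
    refine ⟨max d e, fun X Y Z ↦ ?_⟩
    obtain ⟨r, hr, h⟩ := hd.mono (le_max_left d e) X Y Z
    obtain ⟨r', hr', h'⟩ := he.mono (le_max_right d e) X Y Z
    refine ⟨r + r', (Polynomial.natDegree_add_le _ _).trans (max_le hr hr'), fun t ht ↦ ?_⟩
    rw [Polynomial.eval_add, ← h t ht, ← h' t ht]
    simp only [map_add, mul_add]
  | mul_X p i hp =>
    obtain ⟨d, hd⟩ := hp
    refine ⟨d + 1, fun X Y Z ↦ ?_⟩
    obtain ⟨r, hr, h⟩ := hd X Y Z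
    refine ⟨r * (Polynomial.C (X i.1 i.2) * Polynomial.X ^ 2 + Polynomial.C (Y i.1 i.2) *
      Polynomial.X + Polynomial.C (Z i.1 i.2)), ?_, fun t ht ↦ ?_⟩
    · refine Polynomial.natDegree_mul_le.trans ?_
      have := Polynomial.natDegree_quadratic_le (a := X i.1 i.2) (b := Y i.1 i.2)
        (c := Z i.1 i.2)
      omega
    · rw [Polynomial.eval_mul, ← h t ht]
      simp only [map_mul, MvPolynomial.eval_X, Matrix.add_apply, Matrix.smul_apply, smul_eq_mul,
        Polynomial.eval_add, Polynomial.eval_mul, Polynomial.eval_C, Polynomial.eval_pow,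
        Polynomial.eval_X]
      field_simp
      ring

/-- `G` is cut out in `SL₂(ℂ)` by polynomials of degree at most `d`. -/
def IsClosedOfDegree (d : ℕ) (G : Subgroup SL(2, ℂ)) : Prop :=
  ∀ A : SL(2, ℂ), (∀ f, PolyOfDegree d f → (∀ B ∈ G, f (B : Matrix _ _ ℂ) = 0) →
    f (A : Matrix _ _ ℂ) = 0) → A ∈ G

/-- There is a nonzero binary form, a product of linear forms, that is semi-invariant
under `G`. -/
def HasSemiInvariant (G : Subgroup SL(2, ℂ)) : Prop :=
  ∃ (κ : Type) (_ : Fintype κ) (_ : Nonempty κ) (a : κ → Fin 2 → ℂ), (∀ i, a i ≠ 0) ∧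
    ∀ A ∈ G, ∃ χ : ℂ, ∀ v : Fin 2 → ℂ,
      ∏ i, a i ⬝ᵥ ((A : Matrix (Fin 2) (Fin 2) ℂ) *ᵥ v) = χ * ∏ i, a i ⬝ᵥ v

/-- The subgroup of `SL₂(ℂ)` cut out by the polynomials of degree at most `d` vanishing
on `H`. -/
def closureOfDegree (d : ℕ) (H : Subgroup SL(2, ℂ)) : Subgroup SL(2, ℂ) where
  carrier := {A | ∀ f, PolyOfDegree d f → (∀ B ∈ H, f (B : Matrix _ _ ℂ) = 0) →
    f (A : Matrix _ _ ℂ) = 0}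
  one_mem' f _ hH := hH 1 H.one_mem
  mul_mem' {A B} hA hB f hf hH := by
    -- The usual two-step argument for closures: the right factor moves into the closure while the
    -- left one stays in `H`, then the left factor moves with `B` fixed.
    have key : ∀ C ∈ H, f ((C : Matrix (Fin 2) (Fin 2) ℂ) * (B : Matrix (Fin 2) (Fin 2) ℂ)) = 0 := by
      intro C hC
      refine hB _ (hf.comp (LinearMap.mulLeft ℂ (C : Matrix (Fin 2) (Fin 2) ℂ))) fun D hD ↦ ?_
      simpa using hH (C * D) (H.mul_mem hC hD)
    simpa using hA _ (hf.comp (LinearMap.mulRight ℂ (B : Matrix (Fin 2) (Fin 2) ℂ))) key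
  inv_mem' {A} hA f hf hH := by
    -- The adjugate is linear in the entries and agrees with inversion on `SL₂(ℂ)`, so inversion is
    -- also a linear substitution.
    let L : Matrix (Fin 2) (Fin 2) ℂ →ₗ[ℂ] Matrix (Fin 2) (Fin 2) ℂ :=
      { toFun := fun M ↦ !![M 1 1, -M 0 1; -M 1 0, M 0 0]
        map_add' := fun M N ↦ by ext i j; fin_cases i <;> fin_cases j <;> simp <;> ring
        map_smul' := fun c M ↦ by ext i j; fin_cases i <;> fin_cases j <;> simp }
    have hL : ∀ B : SL(2, ℂ), L (B : Matrix _ _ ℂ) = ((B⁻¹ : SL(2, ℂ)) : Matrix _ _ ℂ) := by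
      intro B
      rw [Matrix.SpecialLinearGroup.SL2_inv_expl]
      rfl
    have := hA _ (hf.comp L) fun B hB ↦ by
      rw [hL]
      exact hH _ (H.inv_mem hB)
    rwa [hL] at this

lemma le_closureOfDegree (d : ℕ) (H : Subgroup SL(2, ℂ)) : H ≤ closureOfDegree d H :=
  fun _ hA _ _ hH ↦ hH _ hA

lemma isClosedOfDegree_closureOfDegree (d : ℕ) (H : Subgroup SL(2, ℂ)) :
    IsClosedOfDegree d (closureOfDegree d H) :=
  fun _ hA f hf hH ↦ hA f hf fun _ hB ↦ hB f hf hH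

lemma HasSemiInvariant.mono {G H : Subgroup SL(2, ℂ)} (hHG : H ≤ G) (h : HasSemiInvariant G) :
    HasSemiInvariant H := by
  obtain ⟨κ, i₁, i₂, a, ha, h⟩ := h
  exact ⟨κ, i₁, i₂, a, ha, fun A hA ↦ h A (hHG hA)⟩

/-- The conjugate `P⁻¹ G P`. -/
def conjSubgroup (P : SL(2, ℂ)) (G : Subgroup SL(2, ℂ)) : Subgroup SL(2, ℂ) :=
  G.comap (MulAut.conj P).toMonoidHom

lemma mem_conjSubgroup {P A : SL(2, ℂ)} {G : Subgroup SL(2, ℂ)} :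
    A ∈ conjSubgroup P G ↔ P * A * P⁻¹ ∈ G := Iff.rfl

lemma conj_mem_conjSubgroup {P A : SL(2, ℂ)} {G : Subgroup SL(2, ℂ)} (hA : A ∈ G) :
    P⁻¹ * A * P ∈ conjSubgroup P G := by
  rw [mem_conjSubgroup]
  simpa [mul_assoc] using hA

lemma IsClosedOfDegree.conj {d : ℕ} {G : Subgroup SL(2, ℂ)} (hG : IsClosedOfDegree d G)
    (P : SL(2, ℂ)) : IsClosedOfDegree d (conjSubgroup P G) := by
  intro A hA
  refine hG _ fun f hf hfG ↦ ?_
  have := hA _ (hf.comp ((LinearMap.mulLeft ℂ (P : Matrix (Fin 2) (Fin 2) ℂ)).comp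
    (LinearMap.mulRight ℂ ((P⁻¹ : SL(2, ℂ)) : Matrix (Fin 2) (Fin 2) ℂ)))) fun B hB ↦ by
      simpa [mul_assoc] using hfG _ (mem_conjSubgroup.1 hB)
  simpa [mul_assoc] using this

lemma HasSemiInvariant.of_conj {G : Subgroup SL(2, ℂ)} {P : SL(2, ℂ)}
    (h : HasSemiInvariant (conjSubgroup P G)) : HasSemiInvariant G := by
  obtain ⟨κ, i₁, i₂, a, ha, h⟩ := h
  refine ⟨κ, i₁, i₂, fun i ↦ a i ᵥ* ((P⁻¹ : SL(2, ℂ)) : Matrix (Fin 2) (Fin 2) ℂ), fun i hi ↦ ?_,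
    fun A hA ↦ ?_⟩
  · apply ha i
    have := congrArg (fun v ↦ v ᵥ* (P : Matrix (Fin 2) (Fin 2) ℂ)) hi
    simpa [Matrix.vecMul_vecMul, ← Matrix.SpecialLinearGroup.coe_mul,
      -Matrix.SpecialLinearGroup.coe_inv] using this
  · obtain ⟨χ, hχ⟩ := h _ (conj_mem_conjSubgroup (P := P) hA)
    refine ⟨χ, fun v ↦ ?_⟩
    have := hχ (((P⁻¹ : SL(2, ℂ)) : Matrix (Fin 2) (Fin 2) ℂ) *ᵥ v)
    simp only [← Matrix.dotProduct_mulVec]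
    rw [← this]
    refine Finset.prod_congr rfl fun i _ ↦ ?_
    rw [Matrix.mulVec_mulVec, Matrix.mulVec_mulVec, ← Matrix.SpecialLinearGroup.coe_mul,
      ← Matrix.SpecialLinearGroup.coe_mul]
    simp [mul_assoc, -Matrix.SpecialLinearGroup.coe_inv, -Matrix.SpecialLinearGroup.coe_mul]

lemma eq_top_of_conjSubgroup {G : Subgroup SL(2, ℂ)} {P : SL(2, ℂ)}
    (h : conjSubgroup P G = ⊤) : G = ⊤ := by
  rw [Subgroup.eq_top_iff'] at h ⊢
  intro A
  have := mem_conjSubgroup.1 (h (P⁻¹ * A * P))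
  simpa [mul_assoc] using this

lemma hasSemiInvariant_of_line {G : Subgroup SL(2, ℂ)} {a : Fin 2 → ℂ} (ha : a ≠ 0)
    (h : ∀ A ∈ G, ∃ c : ℂ, a ᵥ* (A : Matrix (Fin 2) (Fin 2) ℂ) = c • a) : HasSemiInvariant G := by
  refine ⟨Unit, inferInstance, inferInstance, fun _ ↦ a, fun _ ↦ ha, fun A hA ↦ ?_⟩
  obtain ⟨c, hc⟩ := h A hA
  exact ⟨c, fun v ↦ by simp only [Matrix.dotProduct_mulVec, hc, smul_dotProduct,
    smul_eq_mul, Finset.prod_const, Finset.card_univ, Fintype.card_unit, pow_one]⟩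

/-- The product over the group of the translates of the first coordinate form is permuted by right
translation, hence invariant. -/
lemma hasSemiInvariant_of_finite {G : Subgroup SL(2, ℂ)} (h : (G : Set SL(2, ℂ)).Finite) :
    HasSemiInvariant G := by
  classical
  have : Fintype G := h.fintype
  refine ⟨G, inferInstance, inferInstance,
    fun B ↦ ![1, 0] ᵥ* ((B : SL(2, ℂ)) : Matrix (Fin 2) (Fin 2) ℂ), fun B hB ↦ ?_, fun A hA ↦ ?_⟩
  · have := congrArg (fun v ↦ v ᵥ* (((B : SL(2, ℂ))⁻¹ : SL(2, ℂ)) : Matrix (Fin 2) (Fin 2) ℂ)) hB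
    simp only [Matrix.vecMul_vecMul, ← Matrix.SpecialLinearGroup.coe_mul] at this
    simpa using congrFun this 0
  · refine ⟨1, fun v ↦ ?_⟩
    rw [one_mul, ← Equiv.prod_comp (Equiv.mulRight (⟨A, hA⟩ : G)) (fun B : G ↦
      ![1, 0] ᵥ* ((B : SL(2, ℂ)) : Matrix (Fin 2) (Fin 2) ℂ) ⬝ᵥ v)]
    refine Finset.prod_congr rfl fun B _ ↦ ?_
    rw [Matrix.dotProduct_mulVec, Matrix.vecMul_vecMul, ← Matrix.SpecialLinearGroup.coe_mul]
    rfl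

end Oper
end

/-! ### Subgroups closed in bounded degree: the whole group or a semi-invariant -/

noncomputable section

namespace Oper

lemma sl2_det (A : SL(2, ℂ)) : A 0 0 * A 1 1 - A 0 1 * A 1 0 = 1 := by
  rw [← Matrix.det_fin_two]
  exact A.2

lemma sl2_ext {A B : SL(2, ℂ)} (h₀₀ : A 0 0 = B 0 0) (h₀₁ : A 0 1 = B 0 1) (h₁₀ : A 1 0 = B 1 0)
    (h₁₁ : A 1 1 = B 1 1) : A = B := by
  ext i j
  fin_cases i <;> fin_cases j <;> assumption

lemma sl2_mul_apply (A B : SL(2, ℂ)) (i j : Fin 2) :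
    (A * B) i j = A i 0 * B 0 j + A i 1 * B 1 j := by
  simp [Matrix.SpecialLinearGroup.coe_mul, Matrix.mul_apply]

/-- The matrix with entries `a b c d`. -/
def sl2 (a b c d : ℂ) (h : a * d - b * c = 1) : SL(2, ℂ) :=
  ⟨!![a, b; c, d], by rw [Matrix.det_fin_two_of]; exact h⟩

@[simp] lemma sl2_00 {a b c d : ℂ} (h : a * d - b * c = 1) : sl2 a b c d h 0 0 = a := rfl
@[simp] lemma sl2_01 {a b c d : ℂ} (h : a * d - b * c = 1) : sl2 a b c d h 0 1 = b := rfl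
@[simp] lemma sl2_10 {a b c d : ℂ} (h : a * d - b * c = 1) : sl2 a b c d h 1 0 = c := rfl
@[simp] lemma sl2_11 {a b c d : ℂ} (h : a * d - b * c = 1) : sl2 a b c d h 1 1 = d := rfl

lemma sl2_inv {a b c d : ℂ} (h : a * d - b * c = 1) :
    (sl2 a b c d h)⁻¹ = sl2 d (-b) (-c) a (by linear_combination h) := by
  rw [Matrix.SpecialLinearGroup.SL2_inv_expl]
  rfl

lemma vecMul_two (a : Fin 2 → ℂ) (A : Matrix (Fin 2) (Fin 2) ℂ) (j : Fin 2) :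
    (a ᵥ* A) j = a 0 * A 0 j + a 1 * A 1 j := by
  simp [Matrix.vecMul, dotProduct, Fin.sum_univ_two]

/-- Upper triangular unipotent matrices. -/
def upper (t : ℂ) : SL(2, ℂ) := sl2 1 t 0 1 (by ring)

/-- Lower triangular unipotent matrices. -/
def lower (t : ℂ) : SL(2, ℂ) := sl2 1 0 t 1 (by ring)

/-- Diagonal matrices. -/
def torus (t : ℂ) (ht : t ≠ 0) : SL(2, ℂ) := sl2 t 0 0 t⁻¹ (by field_simp; ring)

lemma upper_pow (s : ℂ) (k : ℕ) : upper s ^ k = upper (k * s) := by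
  induction k with
  | zero => apply sl2_ext <;> simp [upper]
  | succ k ih =>
    rw [pow_succ, ih]
    apply sl2_ext <;> simp [upper, sl2_mul_apply] <;> ring

lemma torus_pow (t : ℂ) (ht : t ≠ 0) (k : ℕ) : torus t ht ^ k = torus (t ^ k) (pow_ne_zero k ht) := by
  induction k with
  | zero => apply sl2_ext <;> simp [torus]
  | succ k ih =>
    rw [pow_succ, ih]
    apply sl2_ext <;> simp [torus, sl2_mul_apply]
    · ring
    · ring

/-- The powers of `upper s` are infinitely many points of an affine line, so a polynomial vanishing
at them vanishes on the line. -/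
lemma IsClosedOfDegree.upper_mem {d : ℕ} {G : Subgroup SL(2, ℂ)} (hG : IsClosedOfDegree d G)
    {s : ℂ} (hs : s ≠ 0) (h : upper s ∈ G) (t : ℂ) : upper t ∈ G := by
  have hcoe : ∀ t : ℂ, (upper t : Matrix (Fin 2) (Fin 2) ℂ) =
      t • !![0, 1; 0, 0] + 1 + t⁻¹ • (0 : Matrix (Fin 2) (Fin 2) ℂ) := by
    intro t
    ext i j
    fin_cases i <;> fin_cases j <;> simp [upper, sl2]
  refine hG _ fun f hf hfG ↦ ?_
  obtain ⟨r, -, hr⟩ := hf !![0, 1; 0, 0] 1 0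
  have hr0 : r = 0 := by
    apply Polynomial.eq_zero_of_infinite_isRoot
    -- The shift to `k + 1` avoids the parameter `0`, about which `PolyOfDegree` says nothing; `t =
    -- 0` is treated apart below.
    refine (Set.infinite_range_of_injective
      (f := fun k : ℕ ↦ ((k + 1 : ℕ) : ℂ) * s) fun k l hkl ↦ ?_).mono ?_
    · simpa [hs] using hkl
    · rintro _ ⟨k, rfl⟩
      have hk : ((k + 1 : ℕ) : ℂ) * s ≠ 0 := mul_ne_zero (by exact_mod_cast k.succ_ne_zero) hs
      rw [Set.mem_ofPred_eq, Polynomial.IsRoot.def, ← hr _ hk, ← hcoe, ← upper_pow,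
        hfG _ (G.pow_mem h _), mul_zero]
  rcases eq_or_ne t 0 with rfl | ht
  · have : upper 0 = 1 := by apply sl2_ext <;> simp [upper]
    rw [this]
    exact hfG 1 G.one_mem
  · have := hr t ht
    rw [hr0, Polynomial.eval_zero, ← hcoe] at this
    exact (mul_eq_zero.1 this).resolve_left (pow_ne_zero _ ht)

/-- On the diagonal torus `t ^ d * f` is a polynomial of degree at most `2 * d`, so `2 * d + 1`
distinct powers of `s` force it to vanish. The bound on the degree is what turns failure of this
hypothesis into a bound on the order of `s`. -/
lemma IsClosedOfDegree.torus_mem {d : ℕ} {G : Subgroup SL(2, ℂ)} (hG : IsClosedOfDegree d G)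
    {s : ℂ} (hs : s ≠ 0) (hinj : Set.InjOn (fun k : ℕ ↦ s ^ k) (Finset.range (2 * d + 1)))
    (h : torus s hs ∈ G) (t : ℂ) (ht : t ≠ 0) : torus t ht ∈ G := by
  have hcoe : ∀ (t : ℂ) (ht : t ≠ 0), (torus t ht : Matrix (Fin 2) (Fin 2) ℂ) =
      t • !![1, 0; 0, 0] + 0 + t⁻¹ • !![0, 0; 0, 1] := by
    intro t ht
    ext i j
    fin_cases i <;> fin_cases j <;> simp [torus, sl2]
  refine hG _ fun f hf hfG ↦ ?_
  obtain ⟨r, hd, hr⟩ := hf !![1, 0; 0, 0] 0 !![0, 0; 0, 1]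
  have hr0 : r = 0 := by
    refine Polynomial.eq_zero_of_natDegree_lt_card_of_eval_eq_zero' r
      ((Finset.range (2 * d + 1)).image fun k : ℕ ↦ s ^ k) ?_ ?_
    · intro x hx
      obtain ⟨k, -, rfl⟩ := Finset.mem_image.1 hx
      rw [← hr _ (pow_ne_zero k hs), ← hcoe _ (pow_ne_zero k hs), ← torus_pow,
        hfG _ (G.pow_mem h _), mul_zero]
      exact hs
    · rw [Finset.card_image_of_injOn hinj, Finset.card_range]
      omega
  have := hr t ht
  rw [hr0, Polynomial.eval_zero, ← hcoe _ ht] at this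
  exact (mul_eq_zero.1 this).resolve_left (pow_ne_zero _ ht)

/-- The elements with nonzero lower left entry factor as upper, lower, upper; any other element is
moved among them by `lower 1`. -/
lemma eq_top_of_upper_lower {G : Subgroup SL(2, ℂ)} (hu : ∀ t, upper t ∈ G)
    (hl : ∀ t, lower t ∈ G) : G = ⊤ := by
  have key : ∀ A : SL(2, ℂ), A 1 0 ≠ 0 → A ∈ G := by
    intro A hA
    have : A = upper ((A 0 0 - 1) / A 1 0) * lower (A 1 0) * upper ((A 1 1 - 1) / A 1 0) := by
      have := sl2_det A
      apply sl2_ext <;> simp [upper, lower, sl2_mul_apply] <;> field_simp <;>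
        first | ring1 | linear_combination this | linear_combination -this
    rw [this]
    exact G.mul_mem (G.mul_mem (hu _) (hl _)) (hu _)
  rw [Subgroup.eq_top_iff']
  intro A
  by_cases hA : A 1 0 = 0
  · have h00 : A 0 0 ≠ 0 := by
      intro h
      have := sl2_det A
      simp [h, hA] at this
    refine (G.mul_mem_cancel_left (hl 1)).1 (key _ ?_)
    simpa [lower, sl2_mul_apply, hA] using h00
  · exact key A hA

/-- All of the upper unipotent group lies in `G`. Either `G` is upper triangular and the second
coordinate form is semi-invariant, or unipotent factors on both sides clear the diagonal of some
element. The resulting Weyl element conjugates the upper group into the lower one. -/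
lemma IsClosedOfDegree.top_or_of_upper {d : ℕ} {G : Subgroup SL(2, ℂ)} (hG : IsClosedOfDegree d G)
    {s : ℂ} (hs : s ≠ 0) (h : upper s ∈ G) : G = ⊤ ∨ HasSemiInvariant G := by
  have hu := hG.upper_mem hs h
  by_cases hline : ∀ A ∈ G, A 1 0 = 0
  · right
    refine hasSemiInvariant_of_line (a := ![0, 1]) (by simp) fun A hA ↦ ⟨A 1 1, ?_⟩
    ext j
    fin_cases j <;> simp [vecMul_two, hline A hA]
  · left
    push Not at hline
    obtain ⟨A, hA, hr⟩ := hline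
    have hw : sl2 0 (-(A 1 0)⁻¹) (A 1 0) 0 (by field_simp; ring) ∈ G := by
      have : sl2 0 (-(A 1 0)⁻¹) (A 1 0) 0 (by field_simp; ring) =
          upper (-(A 0 0 / A 1 0)) * A * upper (-(A 1 1 / A 1 0)) := by
        have := sl2_det A
        apply sl2_ext <;> simp [upper, sl2_mul_apply] <;> field_simp <;>
          first | linear_combination this | linear_combination -this | ring
      rw [this]
      exact G.mul_mem (G.mul_mem (hu _) hA) (hu _)
    refine eq_top_of_upper_lower hu fun t ↦ ?_
    have := G.mul_mem (G.mul_mem hw (hu (-t / (A 1 0) ^ 2))) (G.inv_mem hw)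
    convert this using 1
    rw [sl2_inv]
    apply sl2_ext <;> simp only [lower, upper, sl2_mul_apply, sl2_00, sl2_01, sl2_10, sl2_11] <;>
      field_simp <;> ring

lemma exists_conj_upper (B : SL(2, ℂ)) : ∃ P : SL(2, ℂ), (P⁻¹ * B * P) 1 0 = 0 := by
  by_cases hr : B 1 0 = 0
  · exact ⟨1, by simpa using hr⟩
  · obtain ⟨δ, hδ⟩ := IsAlgClosed.exists_eq_mul_self ((B 0 0 + B 1 1) ^ 2 / 4 - 1)
    have hdet := sl2_det B
    -- The first column is an eigenvector of `B` for the eigenvalue `(B 0 0 + B 1 1) / 2 + δ`; the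
    -- second column only makes the determinant one.
    refine ⟨sl2 ((B 0 0 - B 1 1) / 2 + δ) (-(B 1 0)⁻¹) (B 1 0) 0 (by field_simp; ring), ?_⟩
    rw [sl2_inv]
    simp only [sl2_mul_apply, sl2_00, sl2_10, sl2_11]
    linear_combination -(B 1 0) * hδ + (B 1 0) * hdet

lemma exists_conj_torus (C : SL(2, ℂ)) (h10 : C 1 0 = 0) (h : C 0 0 ≠ C 1 1) (h0 : C 0 0 ≠ 0) :
    ∃ P : SL(2, ℂ), P⁻¹ * C * P = torus (C 0 0) h0 := by
  have hdet := sl2_det C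
  rw [h10, mul_zero, sub_zero] at hdet
  have h' : C 0 0 - C 1 1 ≠ 0 := sub_ne_zero.2 h
  refine ⟨upper (-(C 0 1) / (C 0 0 - C 1 1)), ?_⟩
  rw [upper, sl2_inv]
  apply sl2_ext <;> simp only [sl2_mul_apply, torus, sl2_00, sl2_01, sl2_10, sl2_11, h10]
  · ring
  · field_simp
    ring
  · ring
  · rw [eq_inv_of_mul_eq_one_right hdet]
    ring

lemma trace_conj (B P : SL(2, ℂ)) : (P⁻¹ * B * P) 0 0 + (P⁻¹ * B * P) 1 1 = B 0 0 + B 1 1 := by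
  have h := Matrix.trace_mul_comm ((P⁻¹ * B : SL(2, ℂ)) : Matrix (Fin 2) (Fin 2) ℂ)
    (P : Matrix (Fin 2) (Fin 2) ℂ)
  rw [← Matrix.SpecialLinearGroup.coe_mul, ← Matrix.SpecialLinearGroup.coe_mul, ← mul_assoc,
    mul_inv_cancel, one_mul] at h
  simpa [Matrix.trace_fin_two] using h

/-- A subgroup of `SL₂(ℂ)` that is everything or has a semi-invariant. -/
def TopOrSemi (G : Subgroup SL(2, ℂ)) : Prop := G = ⊤ ∨ HasSemiInvariant G

lemma TopOrSemi.of_conj {G : Subgroup SL(2, ℂ)} {P : SL(2, ℂ)}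
    (h : TopOrSemi (conjSubgroup P G)) : TopOrSemi G :=
  h.imp eq_top_of_conjSubgroup HasSemiInvariant.of_conj

lemma IsClosedOfDegree.top_or_of_unipotent {d : ℕ} {G : Subgroup SL(2, ℂ)}
    (hG : IsClosedOfDegree d G) {B : SL(2, ℂ)} (hB : B ∈ G) (htr : B 0 0 + B 1 1 = 2)
    (h1 : B ≠ 1) : TopOrSemi G := by
  obtain ⟨P, hP⟩ := exists_conj_upper B
  have htr' := trace_conj B P
  have hmem := conj_mem_conjSubgroup (P := P) hB
  have hne : P⁻¹ * B * P ≠ 1 := by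
    intro h
    apply h1
    calc B = P * (P⁻¹ * B * P) * P⁻¹ := by group
      _ = 1 := by rw [h]; group
  generalize P⁻¹ * B * P = C at hP htr' hmem hne
  have hdet := sl2_det C
  rw [hP, mul_zero, sub_zero] at hdet
  rw [htr] at htr'
  have h00 : C 0 0 = 1 := by
    have : (C 0 0 - 1) ^ 2 = 0 := by linear_combination C 0 0 * htr' - hdet
    exact sub_eq_zero.1 (pow_eq_zero_iff two_ne_zero |>.1 this)
  have h11 : C 1 1 = 1 := by linear_combination htr' - h00
  have hC : C = upper (C 0 1) := by apply sl2_ext <;> simp [upper, h00, h11, hP]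
  refine TopOrSemi.of_conj (P := P) ((hG.conj P).top_or_of_upper (s := C 0 1) ?_ (hC ▸ hmem))
  intro h
  apply hne
  rw [hC, h]
  apply sl2_ext <;> simp [upper]

/-- If `G` is monomial, the form `x y` is semi-invariant. If not, multiplying a non-monomial element
by a torus element on both sides produces a nontrivial matrix of trace two, which reduces to the
unipotent case. -/
lemma IsClosedOfDegree.top_or_of_torus {d : ℕ} {G : Subgroup SL(2, ℂ)}
    (hG : IsClosedOfDegree d G) (h : ∀ t ht, torus t ht ∈ G) : TopOrSemi G := by
  by_cases hmon : ∀ A ∈ G, (A 0 1 = 0 ∧ A 1 0 = 0) ∨ (A 0 0 = 0 ∧ A 1 1 = 0)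
  · right
    refine ⟨Fin 2, inferInstance, inferInstance, ![![1, 0], ![0, 1]], fun i ↦ ?_, fun A hA ↦ ?_⟩
    · fin_cases i <;> simp
    · refine ⟨A 0 0 * A 1 1 + A 0 1 * A 1 0, fun v ↦ ?_⟩
      simp only [Fin.prod_univ_two, dotProduct, Fin.sum_univ_two, Matrix.mulVec]
      rcases hmon A hA with h | h
      · simp [h.1, h.2]
        ring
      · simp [h.1, h.2]
        ring
  push Not at hmon
  obtain ⟨A, hA, h1, h2⟩ := hmon
  -- For `T = torus x` the product `T A T` has diagonal entries `x² A 0 0` and `x⁻² A 1 1` and the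
  -- off-diagonal entries of `A`. This is the equation of trace two in `u = x²`.
  obtain ⟨u, hu0, hu⟩ : ∃ u : ℂ, u ≠ 0 ∧ A 0 0 * u ^ 2 + A 1 1 = 2 * u := by
    by_cases hp : A 0 0 = 0
    · have hs := h2 hp
      exact ⟨A 1 1 / 2, by simpa using hs, by rw [hp]; ring⟩
    -- The sign of the square root is chosen so that the solution `(1 + δ) / A 0 0` is not zero.
    · obtain ⟨δ, hδ, hδ1⟩ : ∃ δ : ℂ, δ * δ = 1 - A 0 0 * A 1 1 ∧ δ ≠ -1 := by
        obtain ⟨δ, hδ⟩ := IsAlgClosed.exists_eq_mul_self (1 - A 0 0 * A 1 1)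
        by_cases h : δ = -1
        · refine ⟨-δ, by rw [hδ]; ring, ?_⟩
          rw [h]
          norm_num
        · exact ⟨δ, hδ.symm, h⟩
      refine ⟨(1 + δ) / A 0 0, div_ne_zero (fun h ↦ hδ1 ?_) hp, ?_⟩
      · linear_combination h
      · field_simp
        linear_combination hδ
  obtain ⟨x, hx⟩ := IsAlgClosed.exists_eq_mul_self u
  have hx0 : x ≠ 0 := by
    rintro rfl
    exact hu0 (by simpa using hx)
  refine hG.top_or_of_unipotent (G.mul_mem (G.mul_mem (h x hx0) hA) (h x hx0)) ?_ fun h ↦ ?_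
  · simp only [torus, sl2_mul_apply, sl2_00, sl2_01, sl2_10, sl2_11]
    rw [hx] at hu
    field_simp
    linear_combination hu
  · have h01 := congrArg (fun B : SL(2, ℂ) ↦ B 0 1) h
    have h10 := congrArg (fun B : SL(2, ℂ) ↦ B 1 0) h
    simp only [torus, sl2_mul_apply, sl2_00, sl2_01, sl2_10, sl2_11] at h01 h10
    field_simp at h01 h10
    simp [hx0] at h01 h10
    exact h1 h01 h10

/-- Burnside's argument. The traces of `A` and of `torus u * A` determine the diagonal of `A`, as `u
≠ u⁻¹`. Unless `G` is triangular, products with fixed elements `C` and `B` then determine the other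
entries, so finitely many traces leave finitely many matrices. -/
lemma top_or_of_trace_mem_finite {G : Subgroup SL(2, ℂ)} {u : ℂ} (hu : u ≠ 0) (hu1 : u ≠ u⁻¹)
    (hG : torus u hu ∈ G) {T : Set ℂ} (hT : T.Finite) (h : ∀ A ∈ G, A 0 0 + A 1 1 ∈ T) :
    HasSemiInvariant G := by
  by_cases hq : ∀ A ∈ G, A 0 1 = 0
  · refine hasSemiInvariant_of_line (a := ![1, 0]) (by simp) fun A hA ↦ ⟨A 0 0, ?_⟩
    ext j
    fin_cases j <;> simp [vecMul_two, hq A hA]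
  by_cases hr : ∀ A ∈ G, A 1 0 = 0
  · refine hasSemiInvariant_of_line (a := ![0, 1]) (by simp) fun A hA ↦ ⟨A 1 1, ?_⟩
    ext j
    fin_cases j <;> simp [vecMul_two, hr A hA]
  push Not at hq hr
  obtain ⟨B, hB, hB0⟩ := hq
  obtain ⟨C, hC, hC0⟩ := hr
  have hsub : u - u⁻¹ ≠ 0 := sub_ne_zero.2 hu1
  let F₀ : Set ℂ := (fun x : ℂ × ℂ ↦ (x.2 - u⁻¹ * x.1) / (u - u⁻¹)) '' (T ×ˢ T)
  let F₁ : Set ℂ := (fun x : ℂ × ℂ ↦ (u * x.1 - x.2) / (u - u⁻¹)) '' (T ×ˢ T)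
  have hF₀ : F₀.Finite := (hT.prod hT).image _
  have hF₁ : F₁.Finite := (hT.prod hT).image _
  have h00 : ∀ A ∈ G, A 0 0 ∈ F₀ := by
    intro A hA
    refine ⟨(A 0 0 + A 1 1, (torus u hu * A) 0 0 + (torus u hu * A) 1 1),
      ⟨h A hA, h _ (G.mul_mem hG hA)⟩, ?_⟩
    simp only [torus, sl2_mul_apply, sl2_00, sl2_01, sl2_10, sl2_11]
    rw [div_eq_iff hsub]
    ring
  have h11 : ∀ A ∈ G, A 1 1 ∈ F₁ := by
    intro A hA
    refine ⟨(A 0 0 + A 1 1, (torus u hu * A) 0 0 + (torus u hu * A) 1 1),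
      ⟨h A hA, h _ (G.mul_mem hG hA)⟩, ?_⟩
    simp only [torus, sl2_mul_apply, sl2_00, sl2_01, sl2_10, sl2_11]
    rw [div_eq_iff hsub]
    ring
  let F₂ : Set ℂ := (fun x : ℂ × ℂ ↦ (x.2 - x.1 * C 0 0) / C 1 0) '' (F₀ ×ˢ F₀)
  let F₃ : Set ℂ := (fun x : ℂ × ℂ ↦ (x.2 - x.1 * B 1 1) / B 0 1) '' (F₁ ×ˢ F₁)
  have h01 : ∀ A ∈ G, A 0 1 ∈ F₂ := by
    intro A hA
    refine ⟨(A 0 0, (A * C) 0 0), ⟨h00 A hA, h00 _ (G.mul_mem hA hC)⟩, ?_⟩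
    simp only [sl2_mul_apply]
    rw [div_eq_iff hC0]
    ring
  have h10 : ∀ A ∈ G, A 1 0 ∈ F₃ := by
    intro A hA
    refine ⟨(A 1 1, (A * B) 1 1), ⟨h11 A hA, h11 _ (G.mul_mem hA hB)⟩, ?_⟩
    simp only [sl2_mul_apply]
    rw [div_eq_iff hB0]
    ring
  apply hasSemiInvariant_of_finite
  have hfin := (((hF₀.prod ((hF₀.prod hF₀).image _ : F₂.Finite)).prod
    (((hF₁.prod hF₁).image _ : F₃.Finite).prod hF₁)))
  refine Set.Finite.of_finite_image (f := fun A : SL(2, ℂ) ↦ ((A 0 0, A 0 1), (A 1 0, A 1 1)))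
    (hfin.subset ?_) ?_
  · rintro _ ⟨A, hA, rfl⟩
    exact ⟨⟨h00 A hA, h01 A hA⟩, ⟨h10 A hA, h11 A hA⟩⟩
  · intro A _ A' _ hAA'
    simp only [Prod.mk.injEq] at hAA'
    exact sl2_ext hAA'.1.1 hAA'.1.2 hAA'.2.1 hAA'.2.2

/-- Three cases: a nontrivial unipotent; a conjugate of a torus element with many distinct powers;
or neither, when every element is diagonalizable with eigenvalues of bounded order. -/
lemma IsClosedOfDegree.top_or {d : ℕ} {G : Subgroup SL(2, ℂ)} (hG : IsClosedOfDegree d G) :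
    TopOrSemi G := by
  by_cases hU : ∃ B ∈ G, B 0 0 + B 1 1 = 2 ∧ B ≠ 1
  · obtain ⟨B, hB, h2, h1⟩ := hU
    exact hG.top_or_of_unipotent hB h2 h1
  push Not at hU
  by_cases hbig : ∃ P : SL(2, ℂ), ∃ u : ℂ, ∃ hu : u ≠ 0, torus u hu ∈ conjSubgroup P G ∧
      Set.InjOn (fun k : ℕ ↦ u ^ k) (Finset.range (2 * d + 1))
  · obtain ⟨P, u, hu, hmem, hinj⟩ := hbig
    exact TopOrSemi.of_conj ((hG.conj P).top_or_of_torus ((hG.conj P).torus_mem hu hinj hmem))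
  push Not at hbig
  -- Two powers of `u` with exponents at most `2 * d` coincide, so the order of `u` divides `(2 * d
  -- + 1)!`. The factor `2` takes care of the scalar matrices `±1`.
  let N : ℕ := 2 * (2 * d + 1).factorial
  let T : Set ℂ := (fun x : ℂ ↦ x + x⁻¹) '' {x | x ^ N = 1}
  have hN : 0 < N := by positivity
  have hT : T.Finite := by
    refine Set.Finite.image _ ((Polynomial.nthRoots N (1 : ℂ)).toFinset.finite_toSet.subset ?_)
    intro x hx
    simpa [Polynomial.mem_nthRoots hN] using hx
  have hroot : ∀ P : SL(2, ℂ), ∀ u : ℂ, ∀ hu : u ≠ 0, torus u hu ∈ conjSubgroup P G →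
      u ^ N = 1 := by
    intro P u hu hmem
    have := hbig P u hu hmem
    simp only [Set.InjOn, not_forall] at this
    obtain ⟨i, hi, j, hj, hij, hne⟩ := this
    wlog hlt : i < j generalizing i j
    · exact this j hj i hi hij.symm (Ne.symm hne) (by omega)
    simp only [Finset.coe_range, Set.mem_Iio] at hi hj
    have h1 : u ^ (j - i) = 1 := by
      rw [pow_sub₀ u hu hlt.le]
      have : u ^ i ≠ 0 := pow_ne_zero i hu
      rw [← show u ^ i = u ^ j from hij]
      field_simp
    obtain ⟨k, hk⟩ : (j - i) ∣ N :=
      (Nat.dvd_factorial (by omega) (by omega)).trans (Dvd.intro_left 2 rfl)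
    rw [hk, pow_mul, h1, one_pow]
  have hsmall : ∀ A ∈ G, (∃ P : SL(2, ℂ), ∃ u : ℂ, ∃ hu : u ≠ 0, u ≠ u⁻¹ ∧
      P⁻¹ * A * P = torus u hu) ∨ ∃ c : ℂ, c ^ 2 = 1 ∧
        A 0 0 = c ∧ A 1 1 = c ∧ A 0 1 = 0 ∧ A 1 0 = 0 := by
    intro A hA
    obtain ⟨Q, hQ⟩ := exists_conj_upper A
    have hmem := conj_mem_conjSubgroup (P := Q) hA
    have hA' : A = Q * (Q⁻¹ * A * Q) * Q⁻¹ := by group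
    obtain ⟨C, hC⟩ : ∃ C, C = Q⁻¹ * A * Q := ⟨_, rfl⟩
    rw [← hC] at hA' hmem hQ
    have hdet := sl2_det C
    rw [hQ, mul_zero, sub_zero] at hdet
    have h0 : C 0 0 ≠ 0 := left_ne_zero_of_mul_eq_one hdet
    by_cases hne : C 0 0 = C 1 1
    · right
      -- Equal eigenvalues are `±1`, so `A * A` has trace two and is the identity because unipotents
      -- are excluded. This kills the off-diagonal entry of `C`.
      have hsq : A * A = 1 := by
        apply hU _ (G.mul_mem hA hA)
        have := trace_conj (A * A) Q
        rw [← this, show Q⁻¹ * (A * A) * Q = C * C by rw [hC]; group]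
        simp only [sl2_mul_apply, hQ, ← hne]
        rw [← hne] at hdet
        linear_combination 2 * hdet
      have hsqC : C * C = 1 := by
        rw [show C * C = Q⁻¹ * (A * A) * Q by rw [hC]; group, hsq]
        group
      have h01 : C 0 1 = 0 := by
        have := congrArg (fun B : SL(2, ℂ) ↦ B 0 1) hsqC
        simp only [sl2_mul_apply, ← hne] at this
        have h2 : 2 * C 0 0 * C 0 1 = 0 := by
          rw [show 2 * C 0 0 * C 0 1 = C 0 0 * C 0 1 + C 0 1 * C 0 0 by ring, this]
          simp
        simpa [h0] using h2
      have hdetQ := sl2_det Q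
      have hQi : Q⁻¹ = sl2 (Q 1 1) (-(Q 0 1)) (-(Q 1 0)) (Q 0 0) (by linear_combination hdetQ) := by
        rw [Matrix.SpecialLinearGroup.SL2_inv_expl]
        rfl
      refine ⟨C 0 0, by rw [sq]; rw [← hne] at hdet; exact hdet, ?_⟩
      rw [hA', hQi]
      simp only [sl2_mul_apply, sl2_00, sl2_01, sl2_10, sl2_11, h01, hQ, ← hne]
      refine ⟨?_, ?_, ?_, ?_⟩
      · linear_combination (C 0 0) * hdetQ
      · linear_combination (C 0 0) * hdetQ
      · ring
      · ring
    · left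
      obtain ⟨P, hP⟩ := exists_conj_torus C hQ hne h0
      refine ⟨Q * P, C 0 0, h0, ?_, ?_⟩
      · rwa [← eq_inv_of_mul_eq_one_right hdet]
      · rw [← hP, hC]
        group
  have htrace : ∀ A ∈ G, A 0 0 + A 1 1 ∈ T := by
    intro A hA
    rcases hsmall A hA with ⟨P, u, hu, -, hP⟩ | ⟨c, hc, h00, h11, -, -⟩
    · refine ⟨u, hroot P u hu (hP ▸ conj_mem_conjSubgroup hA), ?_⟩
      rw [← trace_conj A P, hP]
      rfl
    · refine ⟨c, ?_, ?_⟩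
      · rw [Set.mem_ofPred_eq, pow_mul, hc, one_pow]
      · rw [h00, h11]
        show c + c⁻¹ = c + c
        rw [inv_eq_of_mul_eq_one_right (show c * c = 1 by rw [← sq, hc])]
  by_cases hreg : ∃ A ∈ G, ∃ P : SL(2, ℂ), ∃ u : ℂ, ∃ hu : u ≠ 0, u ≠ u⁻¹ ∧
      P⁻¹ * A * P = torus u hu
  · obtain ⟨A, hA, P, u, hu, hu1, hP⟩ := hreg
    refine TopOrSemi.of_conj (P := P) (Or.inr (top_or_of_trace_mem_finite hu hu1
      (hP ▸ conj_mem_conjSubgroup hA) hT fun B hB ↦ ?_))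
    have := htrace _ (mem_conjSubgroup.1 hB)
    have h2 := trace_conj B P⁻¹
    rw [inv_inv] at h2
    rwa [h2] at this
  · right
    -- Without a regular element `G` is contained in `{1, -1}`, and any linear form is
    -- semi-invariant.
    refine hasSemiInvariant_of_line (a := ![1, 0]) (by simp) fun A hA ↦ ⟨A 0 0, ?_⟩
    rcases hsmall A hA with h | ⟨c, -, -, -, h01, -⟩
    · exact absurd ⟨A, hA, h⟩ hreg
    · ext j
      fin_cases j <;> simp [vecMul_two, h01]

/-- A subgroup of `SL₂(ℂ)` without semi-invariant binary forms is Zariski dense. -/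
theorem isZariskiDense_of_not_hasSemiInvariant {H : Subgroup SL(2, ℂ)}
    (h : ¬ HasSemiInvariant H) : IsZariskiDense (H : Set SL(2, ℂ)) := by
  intro p hp A
  obtain ⟨d, hd⟩ := exists_polyOfDegree p
  rcases (isClosedOfDegree_closureOfDegree d H).top_or with htop | hsemi
  · have : A ∈ closureOfDegree d H := htop ▸ Subgroup.mem_top A
    exact this _ hd fun B hB ↦ hp B hB
  · exact absurd (hsemi.mono (le_closureOfDegree d H)) h

end Oper
end

noncomputable section

namespace Oper

open MeasureTheory

/-! ### The Cauchy–Pompeiu formula for compactly supported functions -/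

/-- Twice the Wirtinger derivative `∂φ / ∂w̄`. -/
def dbar (φ : ℂ → ℂ) (w : ℂ) : ℂ := fderiv ℝ φ w 1 + Complex.I * fderiv ℝ φ w Complex.I

lemma fderiv_real_apply (φ : ℂ → ℂ) (w v : ℂ) :
    fderiv ℝ φ w v = v.re * fderiv ℝ φ w 1 + v.im * fderiv ℝ φ w Complex.I := by
  conv_lhs => rw [show v = v.re • (1 : ℂ) + v.im • Complex.I by
    simp [Complex.re_add_im]]
  rw [map_add, map_smul, map_smul, Complex.real_smul, Complex.real_smul]

lemma continuous_dbar {φ : ℂ → ℂ} (hφ : ContDiff ℝ 1 φ) : Continuous (dbar φ) := by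
  have h := hφ.continuous_fderiv one_ne_zero
  exact (h.clm_apply continuous_const).add (continuous_const.mul (h.clm_apply continuous_const))

lemma dbar_eq_zero_of_notMem_tsupport {φ : ℂ → ℂ} {w : ℂ} (hw : w ∉ tsupport φ) :
    dbar φ w = 0 := by
  rw [dbar, fderiv_of_notMem_tsupport (𝕜 := ℝ) hw]
  simp

lemma hasCompactSupport_dbar {φ : ℂ → ℂ} (hφ : HasCompactSupport φ) :
    HasCompactSupport (dbar φ) :=
  HasCompactSupport.intro hφ fun _ hw ↦ dbar_eq_zero_of_notMem_tsupport hw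

lemma integral_fderiv_eq_zero_of_compactSupport {φ : ℂ → ℂ} (hφ : ContDiff ℝ 1 φ)
    (hc : HasCompactSupport φ) (v : ℂ) : ∫ w, fderiv ℝ φ w v = 0 := by
  have hint : Integrable (fun w ↦ fderiv ℝ φ w v) :=
    ((hφ.continuous_fderiv one_ne_zero).clm_apply continuous_const).integrable_of_hasCompactSupport
      (hc.fderiv_apply ℝ v)
  have := integral_mul_fderiv_eq_neg_fderiv_mul_of_integrable (μ := (volume : Measure ℂ))
    (f := fun _ : ℂ ↦ (1 : ℂ)) (g := φ) (v := v) (by simp) (by simpa using hint)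
    (by simpa using hφ.continuous.integrable_of_hasCompactSupport hc)
    (fun _ _ ↦ differentiableAt_const _) (fun x _ ↦ hφ.differentiable one_ne_zero x)
  simpa using this

lemma integral_dbar_eq_zero {φ : ℂ → ℂ} (hφ : ContDiff ℝ 1 φ) (hc : HasCompactSupport φ) :
    ∫ w, dbar φ w = 0 := by
  have hint : ∀ v : ℂ, Integrable (fun w ↦ fderiv ℝ φ w v) := fun v ↦
    ((hφ.continuous_fderiv one_ne_zero).clm_apply continuous_const).integrable_of_hasCompactSupport
      (hc.fderiv_apply ℝ v)
  simp only [dbar]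
  rw [integral_add (hint 1) ((hint Complex.I).const_mul _), integral_const_mul,
    integral_fderiv_eq_zero_of_compactSupport hφ hc,
    integral_fderiv_eq_zero_of_compactSupport hφ hc]
  simp

lemma dbar_mul_of_differentiableAt {φ G : ℂ → ℂ} {w : ℂ} (hφ : DifferentiableAt ℝ φ w)
    (hG : DifferentiableAt ℂ G w) : dbar (fun z ↦ φ z * G z) w = dbar φ w * G w := by
  have hGr : HasFDerivAt G ((fderiv ℂ G w).restrictScalars ℝ) w := hG.hasFDerivAt.restrictScalars ℝ
  have := (hφ.hasFDerivAt.mul hGr).fderiv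
  have hI : fderiv ℂ G w Complex.I = Complex.I * fderiv ℂ G w 1 := by
    conv_lhs => rw [show Complex.I = Complex.I • (1 : ℂ) by simp]
    rw [map_smul, smul_eq_mul]
  simp only [dbar]
  rw [show (fun z ↦ φ z * G z) = φ * G from rfl, this]
  simp only [_root_.add_apply, _root_.smul_apply, ContinuousLinearMap.coe_restrictScalars',
    smul_eq_mul, hI]
  linear_combination (φ w * fderiv ℂ G w 1) * Complex.I_mul_I

/-- A function differentiable on an open set `V`, multiplied by a cutoff function. -/
lemma contDiff_mul_of_tsupport_subset {φ G : ℂ → ℂ} {V : Set ℂ} (hV : IsOpen V)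
    (hφ : ContDiff ℝ 1 φ) (hs : tsupport φ ⊆ V) (hG : DifferentiableOn ℂ G V) :
    ContDiff ℝ 1 (fun w ↦ φ w * G w) := by
  rw [contDiff_iff_contDiffAt]
  intro w
  by_cases hw : w ∈ V
  · have : ContDiffAt ℂ 1 G w := (hG.contDiffOn hV).contDiffAt (hV.mem_nhds hw)
    exact hφ.contDiffAt.mul (this.restrict_scalars ℝ)
  · have hw' : w ∉ tsupport φ := fun h ↦ hw (hs h)
    have h0 : (fun w ↦ φ w * G w) =ᶠ[𝓝 w] fun _ ↦ 0 := by
      filter_upwards [(isClosed_tsupport φ).isOpen_compl.mem_nhds hw'] with z hz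
      rw [image_eq_zero_of_notMem_tsupport hz, zero_mul]
    exact contDiffAt_const.congr_of_eventuallyEq h0

lemma integral_dbar_mul_eq_zero {φ G : ℂ → ℂ} {V : Set ℂ} (hV : IsOpen V)
    (hφ : ContDiff ℝ 1 φ) (hc : HasCompactSupport φ) (hs : tsupport φ ⊆ V)
    (hG : DifferentiableOn ℂ G V) : ∫ w, dbar φ w * G w = 0 := by
  rw [← integral_dbar_eq_zero (contDiff_mul_of_tsupport_subset hV hφ hs hG) hc.mul_right]
  congr 1
  ext w
  by_cases hw : w ∈ V
  · rw [dbar_mul_of_differentiableAt (hφ.differentiable one_ne_zero w)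
      (hG.differentiableAt (hV.mem_nhds hw))]
  · have hw' : w ∉ tsupport φ := fun h ↦ hw (hs h)
    rw [dbar_eq_zero_of_notMem_tsupport hw', dbar_eq_zero_of_notMem_tsupport, zero_mul]
    exact fun h ↦ hw' (closure_mono (Function.support_mul_subset_left φ G) h)

/-- A simple pole is locally integrable in real dimension two. -/
lemma integrable_mul_inv_sub {ψ : ℂ → ℂ} (hψ : Continuous ψ) (hc : HasCompactSupport ψ) (c : ℂ) :
    Integrable (fun w ↦ ψ w * (w - c)⁻¹) := by
  have h0 : LocallyIntegrable (fun w : ℂ ↦ w⁻¹) := by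
    refine locallyIntegrable_of_norm_le_rpow (C := 1) (α := 1)
      (by rw [Complex.finrank_real_complex]; norm_num) (by norm_num [Complex.finrank_real_complex]) ?_
      measurable_inv.aestronglyMeasurable
    filter_upwards with w
    rw [norm_inv, Real.rpow_neg_one, one_mul]
  have hc' : HasCompactSupport (fun w ↦ ψ (w + c)) := hc.comp_homeomorph (Homeomorph.addRight c)
  have := (h0.integrable_smul_left_of_hasCompactSupport
    (hψ.comp (continuous_id.add continuous_const)) hc').comp_sub_right c
  simpa using this

/-- In polar coordinates `r * dbar φ * w⁻¹` equals `∂φ/∂r + (i/r) ∂φ/∂θ`, written `A + I * B` in the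
proof. Each ray integrates the first term to `-φ 0`, and each circle integrates the second to zero
by periodicity. Since `dbar` is twice the Wirtinger derivative, the constant is `2π` rather than
`π`. -/
lemma pompeiu_zero {φ : ℂ → ℂ} (hφ : ContDiff ℝ 1 φ) (hc : HasCompactSupport φ) :
    ∫ w, dbar φ w * w⁻¹ = -(2 * Real.pi) * φ 0 := by
  obtain ⟨R, hR0, hR⟩ : ∃ R > 0, tsupport φ ⊆ Metric.ball 0 R := by
    obtain ⟨R, hR⟩ := hc.isBounded.subset_ball 0
    exact ⟨max R 1, by positivity, hR.trans (Metric.ball_subset_ball (le_max_left _ _))⟩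
  let γ : ℝ × ℝ → ℂ := fun p ↦ p.1 * Complex.exp (p.2 * Complex.I)
  have hγc : Continuous γ := by fun_prop
  let A : ℝ × ℝ → ℂ := fun p ↦ fderiv ℝ φ (γ p) (Complex.exp (p.2 * Complex.I))
  let B : ℝ × ℝ → ℂ := fun p ↦ fderiv ℝ φ (γ p) (Complex.I * Complex.exp (p.2 * Complex.I))
  have hA : Continuous A := ((hφ.continuous_fderiv one_ne_zero).comp hγc).clm_apply (by fun_prop)
  have hB : Continuous B := ((hφ.continuous_fderiv one_ne_zero).comp hγc).clm_apply (by fun_prop)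
  have hzero : ∀ p : ℝ × ℝ, R ≤ p.1 → fderiv ℝ φ (γ p) = 0 := by
    intro p hp
    apply fderiv_of_notMem_tsupport
    intro h
    have := hR h
    simp only [Metric.mem_ball, dist_zero_right, γ, norm_mul, Complex.norm_exp_ofReal_mul_I,
      mul_one, Complex.norm_real, Real.norm_eq_abs] at this
    linarith [le_abs_self p.1]
  have hint : ∀ F : ℝ × ℝ → ℂ, Continuous F → (∀ p, R ≤ p.1 → F p = 0) →
      IntegrableOn F (Ioi 0 ×ˢ Ioo (-Real.pi) Real.pi) (volume.prod volume) := by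
    intro F hF h0
    have h1 : IntegrableOn F (Icc 0 R ×ˢ Icc (-Real.pi) Real.pi) (volume.prod volume) :=
      hF.continuousOn.integrableOn_compact (isCompact_Icc.prod isCompact_Icc)
    refine h1.of_forall_sdiff_eq_zero (measurableSet_Ioi.prod measurableSet_Ioo) fun p hp ↦ h0 p ?_
    by_contra! hlt
    exact hp.2 ⟨⟨hp.1.1.le, hlt.le⟩, Ioo_subset_Icc_self hp.1.2⟩
  have hAint := hint A hA fun p hp ↦ by simp only [A, hzero p hp]; simp
  have hBint := hint B hB fun p hp ↦ by simp only [B, hzero p hp]; simp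
  have hexp : ∀ θ : ℝ, Complex.exp (θ * Complex.I) = Real.cos θ + Real.sin θ * Complex.I := by
    intro θ
    rw [Complex.exp_mul_I, Complex.ofReal_cos, Complex.ofReal_sin]
  have hintA : ∫ p in Ioi 0 ×ˢ Ioo (-Real.pi) Real.pi, A p ∂(volume.prod volume) =
      -(2 * Real.pi) * φ 0 := by
    have hsw := setIntegral_prod_swap (μ := (volume : Measure ℝ)) (ν := (volume : Measure ℝ))
      (Ioi (0 : ℝ)) (Ioo (-Real.pi) Real.pi) A
    rw [← hsw]
    change ∫ p in _, (A ∘ Prod.swap) p ∂_ = _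
    rw [setIntegral_prod _ hAint.swap]
    have : ∀ θ : ℝ, ∫ r in Ioi (0 : ℝ), A (Prod.swap (θ, r)) = - φ 0 := by
      intro θ
      have hf : ContDiff ℝ 1 (fun r : ℝ ↦ φ (r * Complex.exp (θ * Complex.I))) :=
        hφ.comp (Complex.ofRealCLM.contDiff.mul contDiff_const)
      have hfc : HasCompactSupport (fun r : ℝ ↦ φ (r * Complex.exp (θ * Complex.I))) := by
        refine HasCompactSupport.intro (isCompact_Icc (a := -R) (b := R)) fun r hr ↦ ?_
        apply image_eq_zero_of_notMem_tsupport
        intro h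
        have := hR h
        simp only [Metric.mem_ball, dist_zero_right, norm_mul, Complex.norm_exp_ofReal_mul_I,
          mul_one, Complex.norm_real, Real.norm_eq_abs] at this
        exact hr (abs_le.1 this.le)
      have := hfc.integral_Ioi_deriv_eq hf 0
      simp only [Complex.ofReal_zero, zero_mul] at this
      rw [← this]
      congr 1
      ext r
      have h1 : HasDerivAt (fun r : ℝ ↦ (r : ℂ) * Complex.exp (θ * Complex.I))
          (Complex.exp (θ * Complex.I)) r := by
        simpa using (Complex.ofRealCLM.hasDerivAt (x := r)).mul_const (Complex.exp (θ * Complex.I))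
      exact ((hφ.differentiable one_ne_zero _).hasFDerivAt.comp_hasDerivAt r h1).deriv.symm
    simp only [Function.comp_apply, this]
    rw [setIntegral_const, Real.volume_real_Ioo_of_le (by linarith [Real.pi_pos]),
      Complex.real_smul]
    push_cast
    ring
  have hintB : ∫ p in Ioi 0 ×ˢ Ioo (-Real.pi) Real.pi, B p ∂(volume.prod volume) = 0 := by
    rw [setIntegral_prod _ hBint]
    refine setIntegral_eq_zero_of_forall_eq_zero fun r hr ↦ ?_
    have hr : (0 : ℝ) < r := hr
    rw [← integral_Ioc_eq_integral_Ioo, ← intervalIntegral.integral_of_le (by linarith [Real.pi_pos])]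
    have hd : ∀ θ : ℝ, HasDerivAt (fun θ : ℝ ↦ φ (r * Complex.exp (θ * Complex.I)))
        (r * B (r, θ)) θ := by
      intro θ
      have h1 : HasDerivAt (fun θ : ℝ ↦ (r : ℂ) * Complex.exp (θ * Complex.I))
          ((r : ℂ) * (Complex.I * Complex.exp (θ * Complex.I))) θ := by
        have h2 : HasDerivAt (fun θ : ℝ ↦ (θ : ℂ) * Complex.I) Complex.I θ := by
          simpa using (Complex.ofRealCLM.hasDerivAt (x := θ)).mul_const Complex.I
        rw [mul_comm Complex.I]
        exact (h2.cexp).const_mul (r : ℂ)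
      have := (hφ.differentiable one_ne_zero _).hasFDerivAt.comp_hasDerivAt θ h1
      rw [show (r : ℂ) * (Complex.I * Complex.exp (θ * Complex.I)) =
        r • (Complex.I * Complex.exp (θ * Complex.I)) from Complex.real_smul.symm, map_smul,
        Complex.real_smul] at this
      exact this
    have hi := intervalIntegral.integral_eq_sub_of_hasDerivAt (a := -Real.pi) (b := Real.pi)
      (fun θ _ ↦ hd θ) ((continuous_const.mul (hB.comp (by fun_prop))).intervalIntegrable _ _)
    rw [intervalIntegral.integral_const_mul] at hi
    have hpi : Complex.exp (((-Real.pi : ℝ) : ℂ) * Complex.I) = Complex.exp (Real.pi * Complex.I) := by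
      rw [hexp, hexp]
      simp
    rw [hpi, sub_self] at hi
    exact (mul_eq_zero.1 hi).resolve_left (by exact_mod_cast hr.ne')
  rw [← Complex.integral_comp_polarCoord_symm]
  have hpt : ∀ p ∈ polarCoord.target, p.1 • (dbar φ (Complex.polarCoord.symm p) *
      (Complex.polarCoord.symm p)⁻¹) = A p + Complex.I * B p := by
    rintro ⟨r, θ⟩ ⟨hr, -⟩
    have hr : (0 : ℝ) < r := hr
    have hr' : (r : ℂ) ≠ 0 := by exact_mod_cast hr.ne'
    have hsc : (Complex.sin θ) ^ 2 + (Complex.cos θ) ^ 2 = 1 := Complex.sin_sq_add_cos_sq θ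
    have hinv : (Real.cos θ + Real.sin θ * Complex.I)⁻¹ =
        (Real.cos θ - Real.sin θ * Complex.I : ℂ) := by
      apply inv_eq_of_mul_eq_one_right
      push_cast
      linear_combination hsc - Complex.sin θ ^ 2 * Complex.I_mul_I
    simp only [A, B, γ, dbar, Complex.polarCoord_symm_apply, mul_inv, hinv, Complex.real_smul, hexp]
    rw [fderiv_real_apply φ _ (Real.cos θ + Real.sin θ * Complex.I),
      fderiv_real_apply φ _ (Complex.I * (Real.cos θ + Real.sin θ * Complex.I))]
    have e1 : (Real.cos θ + Real.sin θ * Complex.I : ℂ).re = Real.cos θ := by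
      simp [-Complex.ofReal_cos, -Complex.ofReal_sin]
    have e2 : (Real.cos θ + Real.sin θ * Complex.I : ℂ).im = Real.sin θ := by
      simp [-Complex.ofReal_cos, -Complex.ofReal_sin]
    have e3 : (Complex.I * (Real.cos θ + Real.sin θ * Complex.I : ℂ)).re = -Real.sin θ := by
      simp [-Complex.ofReal_cos, -Complex.ofReal_sin]
    have e4 : (Complex.I * (Real.cos θ + Real.sin θ * Complex.I : ℂ)).im = Real.cos θ := by
      simp [-Complex.ofReal_cos, -Complex.ofReal_sin]
    rw [e1, e2, e3, e4]
    push_cast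
    field_simp
    linear_combination (- Complex.sin θ * fderiv ℝ φ (r * (Complex.cos θ + Complex.sin θ *
      Complex.I)) Complex.I) * Complex.I_mul_I
  rw [setIntegral_congr_fun polarCoord.open_target.measurableSet hpt]
  have hvol : (volume : Measure (ℝ × ℝ)) = (volume : Measure ℝ).prod volume := rfl
  rw [polarCoord_target, hvol, integral_add hAint (hBint.const_mul _), integral_const_mul, hintA,
    hintB, mul_zero, add_zero]

lemma pompeiu {φ : ℂ → ℂ} (hφ : ContDiff ℝ 1 φ) (hc : HasCompactSupport φ) (c : ℂ) :
    ∫ w, dbar φ w * (w - c)⁻¹ = -(2 * Real.pi) * φ c := by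
  have hc' : HasCompactSupport (fun w ↦ φ (w + c)) := hc.comp_homeomorph (Homeomorph.addRight c)
  have := pompeiu_zero (φ := fun w ↦ φ (w + c)) (hφ.comp (contDiff_id.add contDiff_const)) hc'
  rw [zero_add] at this
  rw [← this, ← integral_add_right_eq_self (fun w ↦ dbar φ w * (w - c)⁻¹) c]
  congr 1
  ext w
  rw [add_sub_cancel_right]
  simp only [dbar, fderiv_comp_add_right]

end Oper
end

noncomputable section

namespace Oper

open MeasureTheory

/-! ### The residue theorem on a compact Riemann surface -/

section Residue

variable {C : Type*} [TopologicalSpace C] [ChartedSpace ℂ C]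

/-- The underlying real smooth structure is needed for partitions of unity, which do not exist
holomorphically. -/
lemma contDiffGroupoid_complex_le :
    contDiffGroupoid ω 𝓘(ℂ) ≤ contDiffGroupoid (H := ℂ) ∞ 𝓘(ℝ, ℂ) := by
  refine groupoid_of_pregroupoid_le _ _ fun f s hf ↦ ?_
  exact (ContDiffOn.restrict_scalars ℝ hf).of_le le_top

lemma isManifold_real [IsManifold 𝓘(ℂ) ω C] : IsManifold 𝓘(ℝ, ℂ) ∞ C := by
  have : HasGroupoid C (contDiffGroupoid (H := ℂ) ∞ 𝓘(ℝ, ℂ)) :=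
    hasGroupoid_of_le (G₁ := contDiffGroupoid ω 𝓘(ℂ)) inferInstance contDiffGroupoid_complex_le
  exact IsManifold.mk' _ _ _

lemma contDiffOn_comp_symm [IsManifold 𝓘(ℂ) ω C] {e : OpenPartialHomeomorph C ℂ}
    (he : e ∈ IsManifold.maximalAtlas 𝓘(ℂ) ω C) {ρ : C → ℂ}
    (hρ : ContMDiff 𝓘(ℝ, ℂ) 𝓘(ℝ, ℂ) 1 ρ) : ContDiffOn ℝ 1 (ρ ∘ e.symm) e.target := by
  have := isManifold_real (C := C)
  have he' : e ∈ IsManifold.maximalAtlas 𝓘(ℝ, ℂ) ∞ C :=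
    StructureGroupoid.maximalAtlas_mono contDiffGroupoid_complex_le he
  have h := (contMDiffOn_symm_of_mem_maximalAtlas he').of_le (m := 1) (by exact_mod_cast le_top)
  exact contMDiffOn_iff_contDiffOn.1 (hρ.comp_contMDiffOn h)

/-- A function read in a chart has no meaning off the target. When it vanishes outside a compact
part of the target, its extension by zero is as regular as the function itself. -/
lemma continuous_indicator_of_isCompact {V K : Set ℂ} (hV : IsOpen V) (hK : IsCompact K)
    (hKV : K ⊆ V) {f : ℂ → ℂ} (hf : ContinuousOn f V) (h0 : ∀ w ∈ V, w ∉ K → f w = 0) :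
    Continuous (V.indicator f) ∧ HasCompactSupport (V.indicator f) ∧ tsupport (V.indicator f) ⊆ K := by
  have hz : ∀ w ∉ K, V.indicator f w = 0 := by
    intro w hw
    by_cases hwV : w ∈ V
    · rw [indicator_of_mem hwV, h0 w hwV hw]
    · exact indicator_of_notMem hwV f
  refine ⟨?_, HasCompactSupport.intro hK hz, closure_minimal (fun w hw ↦ ?_) hK.isClosed⟩
  · rw [continuous_iff_continuousAt]
    intro w
    by_cases hw : w ∈ V
    · refine (hf.continuousAt (hV.mem_nhds hw)).congr ?_
      filter_upwards [hV.mem_nhds hw] with z hz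
      rw [indicator_of_mem hz]
    · refine (continuousAt_const (y := (0 : ℂ))).congr ?_
      filter_upwards [hK.isClosed.isOpen_compl.mem_nhds fun h ↦ hw (hKV h)] with z hz'
      rw [hz z hz']
  · by_contra h
    exact hw (hz w h)

lemma contDiff_indicator_of_isCompact {V K : Set ℂ} (hV : IsOpen V) (hK : IsCompact K)
    (hKV : K ⊆ V) {f : ℂ → ℂ} (hf : ContDiffOn ℝ 1 f V) (h0 : ∀ w ∈ V, w ∉ K → f w = 0) :
    ContDiff ℝ 1 (V.indicator f) := by
  rw [contDiff_iff_contDiffAt]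
  intro w
  by_cases hw : w ∈ V
  · refine (hf.contDiffAt (hV.mem_nhds hw)).congr_of_eventuallyEq ?_
    filter_upwards [hV.mem_nhds hw] with z hz
    rw [indicator_of_mem hz]
  · refine (contDiffAt_const (c := (0 : ℂ))).congr_of_eventuallyEq ?_
    filter_upwards [hK.isClosed.isOpen_compl.mem_nhds fun h ↦ hw (hKV h)] with z hz
    by_cases hzV : z ∈ V
    · rw [indicator_of_mem hzV, h0 z hzV hz]
    · exact indicator_of_notMem hzV f

lemma dbar_congr {f g : ℂ → ℂ} {w : ℂ} (h : f =ᶠ[𝓝 w] g) : dbar f w = dbar g w := by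
  rw [dbar, dbar, h.fderiv_eq]

lemma dbar_comp_symm_eq_zero {e : OpenPartialHomeomorph C ℂ} {ρ : C → ℂ} {w : ℂ}
    (hw : w ∈ e.target) (h : e.symm w ∉ tsupport ρ) : dbar (ρ ∘ e.symm) w = 0 := by
  have : ρ ∘ e.symm =ᶠ[𝓝 w] fun _ ↦ 0 := by
    filter_upwards [(e.continuousAt_symm hw).preimage_mem_nhds
      ((isClosed_tsupport ρ).isOpen_compl.mem_nhds h)] with z hz
    exact image_eq_zero_of_notMem_tsupport (f := ρ) hz
  rw [dbar_congr this]
  simp [dbar]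

lemma continuousOn_dbar {f : ℂ → ℂ} {V : Set ℂ} (hV : IsOpen V) (hf : ContDiffOn ℝ 1 f V) :
    ContinuousOn (dbar f) V := by
  have h := hf.continuousOn_fderiv_of_isOpen hV le_rfl
  exact (h.clm_apply continuousOn_const).add
    (continuousOn_const.mul (h.clm_apply continuousOn_const))

/-- A form with at most a simple pole at `c`, with residue `n`. -/
def polar (n : ℕ) (c : ℂ) (G : ℂ → ℂ) (w : ℂ) : ℂ := n * (w - c)⁻¹ + G w

lemma integrableOn_mul_polar {V K : Set ℂ} (hV : IsOpen V) (hK : IsCompact K)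
    (hKV : K ⊆ V) {f : ℂ → ℂ} (hf : ContinuousOn f V) (h0 : ∀ w ∈ V, w ∉ K → f w = 0)
    (n : ℕ) (c : ℂ) {G : ℂ → ℂ} (hG : DifferentiableOn ℂ G V) :
    IntegrableOn (fun w ↦ f w * polar n c G w) V := by
  obtain ⟨h1, h2, -⟩ := continuous_indicator_of_isCompact hV hK hKV hf h0
  obtain ⟨h3, h4, -⟩ := continuous_indicator_of_isCompact hV hK hKV (hf.mul hG.continuousOn)
    fun w hw hwK ↦ by simp [h0 w hw hwK]
  have := ((integrable_mul_inv_sub h1 h2 c).const_mul (n : ℂ)).add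
    (h3.integrable_of_hasCompactSupport h4)
  refine (this.integrableOn (s := V)).congr_fun (fun w hw ↦ ?_) hV.measurableSet
  simp only [Pi.add_apply, indicator_of_mem hw, polar, Pi.mul_apply]
  ring

/-- The Pompeiu formula evaluates the polar part, and the holomorphic part contributes nothing. -/
lemma integral_dbar_mul_polar [T2Space C] [CompactSpace C] [IsManifold 𝓘(ℂ) ω C]
    {e : OpenPartialHomeomorph C ℂ} (he : e ∈ IsManifold.maximalAtlas 𝓘(ℂ) ω C) {ρ : C → ℂ}
    (hρ : ContMDiff 𝓘(ℝ, ℂ) 𝓘(ℝ, ℂ) 1 ρ) (hs : tsupport ρ ⊆ e.source) {x : C} (hx : x ∈ e.source)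
    (n : ℕ) {G : ℂ → ℂ} (hG : DifferentiableOn ℂ G e.target) :
    ∫ w in e.target, dbar (ρ ∘ e.symm) w * polar n (e x) G w = -(2 * Real.pi) * (n * ρ x) := by
  have hK : IsCompact (e '' tsupport ρ) :=
    (isClosed_tsupport ρ).isCompact.image_of_continuousOn (e.continuousOn.mono hs)
  have hKV : e '' tsupport ρ ⊆ e.target := by
    rintro _ ⟨y, hy, rfl⟩
    exact e.map_source (hs hy)
  have hf := contDiffOn_comp_symm he hρ
  have hnot : ∀ w ∈ e.target, w ∉ e '' tsupport ρ → e.symm w ∉ tsupport ρ :=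
    fun w hw hwK h ↦ hwK ⟨e.symm w, h, e.right_inv hw⟩
  have h0 : ∀ w ∈ e.target, w ∉ e '' tsupport ρ → (ρ ∘ e.symm) w = 0 :=
    fun w hw hwK ↦ image_eq_zero_of_notMem_tsupport (f := ρ) (hnot w hw hwK)
  obtain ⟨-, hc, ht⟩ := continuous_indicator_of_isCompact e.open_target hK hKV hf.continuousOn h0
  have hφ := contDiff_indicator_of_isCompact e.open_target hK hKV hf h0
  set φ := e.target.indicator (ρ ∘ e.symm) with hφdef
  have hd : ∀ w ∈ e.target, dbar (ρ ∘ e.symm) w = dbar φ w := by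
    intro w hw
    apply dbar_congr
    filter_upwards [e.open_target.mem_nhds hw] with z hz
    rw [hφdef, indicator_of_mem hz]
  have hd0 : ∀ w ∉ e.target, dbar φ w = 0 := fun w hw ↦
    dbar_eq_zero_of_notMem_tsupport fun h ↦ hw (hKV (ht h))
  have hcd := hasCompactSupport_dbar hc
  have hI1 := integrable_mul_inv_sub (continuous_dbar hφ) hcd (e x)
  have hI2 : Integrable (fun w ↦ dbar φ w * G w) := by
    obtain ⟨h3, h4, -⟩ := continuous_indicator_of_isCompact e.open_target hK hKV
      ((continuous_dbar hφ).continuousOn.mul hG.continuousOn) fun w hw hwK ↦ by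
        simp [dbar_eq_zero_of_notMem_tsupport fun h ↦ hwK (ht h)]
    refine (h3.integrable_of_hasCompactSupport h4).congr (Filter.Eventually.of_forall fun w ↦ ?_)
    by_cases hw : w ∈ e.target
    · simp [indicator_of_mem hw]
    · simp [indicator_of_notMem hw, hd0 w hw]
  calc ∫ w in e.target, dbar (ρ ∘ e.symm) w * polar n (e x) G w
      = ∫ w in e.target, dbar φ w * polar n (e x) G w :=
        setIntegral_congr_fun e.open_target.measurableSet fun w hw ↦ by simp only [hd w hw]
    _ = ∫ w, dbar φ w * polar n (e x) G w :=
        setIntegral_eq_integral_of_forall_compl_eq_zero fun w hw ↦ by rw [hd0 w hw, zero_mul]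
    _ = ∫ w, (n * (dbar φ w * (w - e x)⁻¹) + dbar φ w * G w) := by
        congr 1
        ext w
        rw [polar]
        ring
    _ = -(2 * Real.pi) * (n * ρ x) := by
        rw [integral_add (hI1.const_mul _) hI2, integral_const_mul, pompeiu hφ hc,
          integral_dbar_mul_eq_zero e.open_target hφ hc (ht.trans hKV) hG, hφdef,
          indicator_of_mem (e.map_source hx), Function.comp_apply, e.left_inv hx]
        ring

lemma dbar_comp_of_differentiableAt {f τ : ℂ → ℂ} {w : ℂ} (hf : DifferentiableAt ℝ f (τ w))
    (hτ : DifferentiableAt ℂ τ w) :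
    dbar (f ∘ τ) w = (starRingEnd ℂ) (deriv τ w) * dbar f (τ w) := by
  have h1 : HasFDerivAt τ ((fderiv ℂ τ w).restrictScalars ℝ) w := hτ.hasFDerivAt.restrictScalars ℝ
  have h2 := (hf.hasFDerivAt.comp w h1).fderiv
  have h3 : ∀ v : ℂ, fderiv ℂ τ w v = v * deriv τ w := by
    intro v
    conv_lhs => rw [show v = v • (1 : ℂ) by simp]
    rw [map_smul, smul_eq_mul, fderiv_apply_one_eq_deriv]
  simp only [dbar]
  rw [h2]
  simp only [ContinuousLinearMap.comp_apply, ContinuousLinearMap.coe_restrictScalars', h3, one_mul]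
  rw [fderiv_real_apply f _ (deriv τ w), fderiv_real_apply f _ (Complex.I * deriv τ w)]
  have e3 : (Complex.I * deriv τ w).re = -(deriv τ w).im := by simp
  have e4 : (Complex.I * deriv τ w).im = (deriv τ w).re := by simp
  rw [e3, e4, show (starRingEnd ℂ) (deriv τ w) = (deriv τ w).re - (deriv τ w).im * Complex.I by
    apply Complex.ext <;> simp]
  push_cast
  linear_combination (((deriv τ w).im : ℂ) * fderiv ℝ f (τ w) Complex.I) * Complex.I_mul_I

lemma det_restrictScalars_fderiv (τ : ℂ → ℂ) (w : ℂ) :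
    ((fderiv ℂ τ w).restrictScalars ℝ).det = Complex.normSq (deriv τ w) := by
  rw [ContinuousLinearMap.det]
  change LinearMap.det ((fderiv ℂ τ w : ℂ →ₗ[ℂ] ℂ).restrictScalars ℝ) = _
  rw [LinearMap.det_restrictScalars, Algebra.norm_complex_apply, LinearMap.det_ring]
  simp

lemma differentiableAt_transition [IsManifold 𝓘(ℂ) ω C] {e e' : OpenPartialHomeomorph C ℂ}
    (he : e ∈ IsManifold.maximalAtlas 𝓘(ℂ) ω C) (he' : e' ∈ IsManifold.maximalAtlas 𝓘(ℂ) ω C)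
    {w : ℂ} (hw : w ∈ e.target) (hw' : e.symm w ∈ e'.source) :
    DifferentiableAt ℂ (e' ∘ e.symm) w := by
  have h1 := contMDiffAt_symm_of_mem_maximalAtlas he hw
  have h2 := contMDiffAt_of_mem_maximalAtlas he' hw'
  have h3 := (h2.comp w h1).contDiffAt
  exact h3.differentiableAt (by simp)

/-- The integrand is the `(1,1)`-form `σ ∂̄ρ ∧ Θ`: `dbar` contributes the conjugate of the
derivative of the transition map and `Θ` the derivative itself, and their product is the real
Jacobian. The supports of `ρ` and `σ` confine both integrals to the overlap, and the possible poles
form a null set. -/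
lemma integral_change_chart [IsManifold 𝓘(ℂ) ω C] {e e' : OpenPartialHomeomorph C ℂ}
    (he : e ∈ IsManifold.maximalAtlas 𝓘(ℂ) ω C) (he' : e' ∈ IsManifold.maximalAtlas 𝓘(ℂ) ω C)
    {ρ σ : C → ℂ} (hρ : ContMDiff 𝓘(ℝ, ℂ) 𝓘(ℝ, ℂ) 1 ρ)
    (hsρ : tsupport ρ ⊆ e.source) (hsσ : tsupport σ ⊆ e'.source) {Θ Θ' : ℂ → ℂ} {x x' : C}
    (hΘ : ∀ y ∈ e.source ∩ e'.source, y ≠ x → y ≠ x' →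
      Θ (e y) = Θ' (e' y) * deriv (e' ∘ e.symm) (e y)) :
    ∫ w in e.target, σ (e.symm w) * dbar (ρ ∘ e.symm) w * Θ w =
      ∫ w in e'.target, σ (e'.symm w) * dbar (ρ ∘ e'.symm) w * Θ' w := by
  let W : Set ℂ := e.target ∩ e.symm ⁻¹' e'.source
  let W' : Set ℂ := e'.target ∩ e'.symm ⁻¹' e.source
  have hW : IsOpen W := e.isOpen_inter_preimage_symm e'.open_source
  have hW' : IsOpen W' := e'.isOpen_inter_preimage_symm e.open_source
  have himage : (e' ∘ e.symm) '' W = W' := by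
    ext w
    constructor
    · rintro ⟨z, hz, rfl⟩
      refine ⟨e'.map_source hz.2, ?_⟩
      rw [mem_preimage, Function.comp_apply, e'.left_inv hz.2]
      exact e.map_target hz.1
    · intro hw
      refine ⟨e (e'.symm w), ⟨e.map_source hw.2, ?_⟩, ?_⟩
      · rw [mem_preimage, e.left_inv hw.2]
        exact e'.map_target hw.1
      · rw [Function.comp_apply, e.left_inv hw.2, e'.right_inv hw.1]
  have hinj : InjOn (e' ∘ e.symm) W := by
    intro z hz z' hz' h
    exact e.symm.injOn hz.1 hz'.1 (e'.injOn hz.2 hz'.2 h)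
  have hdiff : ∀ w ∈ W, DifferentiableAt ℂ (e' ∘ e.symm) w := fun w hw ↦
    differentiableAt_transition he he' hw.1 hw.2
  rw [setIntegral_eq_of_subset_of_forall_sdiff_eq_zero (t := e.target) (s := W)
      e.open_target.measurableSet inter_subset_left,
    setIntegral_eq_of_subset_of_forall_sdiff_eq_zero (t := e'.target) (s := W')
      e'.open_target.measurableSet inter_subset_left, ← himage,
    integral_image_eq_integral_abs_det_fderiv_smul volume hW.measurableSet
      (fun w hw ↦ ((hdiff w hw).hasFDerivAt.restrictScalars ℝ).hasFDerivWithinAt) hinj]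
  · refine setIntegral_congr_ae hW.measurableSet ?_
    have hfin : (volume : Measure ℂ) {e x, e x'} = 0 := (Set.toFinite _).measure_zero _
    filter_upwards [compl_mem_ae_iff.2 hfin] with w hw hwW
    have hw1 : e (e.symm w) = w := e.right_inv hwW.1
    have hΘw := hΘ (e.symm w) ⟨e.map_target hwW.1, hwW.2⟩
      (fun h ↦ hw (by rw [← hw1, h]; simp)) (fun h ↦ hw (by rw [← hw1, h]; simp))
    rw [hw1] at hΘw
    have hev : ρ ∘ e.symm =ᶠ[𝓝 w] (ρ ∘ e'.symm) ∘ (e' ∘ e.symm) := by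
      filter_upwards [hW.mem_nhds hwW] with z hz
      rw [Function.comp_apply, Function.comp_apply, Function.comp_apply, Function.comp_apply,
        e'.left_inv hz.2]
    have hmem : (e' ∘ e.symm) w ∈ e'.target := e'.map_source hwW.2
    have hfd : DifferentiableAt ℝ (ρ ∘ e'.symm) ((e' ∘ e.symm) w) :=
      ((contDiffOn_comp_symm he' hρ).contDiffAt (e'.open_target.mem_nhds hmem)).differentiableAt
        one_ne_zero
    rw [dbar_congr hev, dbar_comp_of_differentiableAt hfd (hdiff w hwW), hΘw,
      det_restrictScalars_fderiv, abs_of_nonneg (Complex.normSq_nonneg _), Complex.real_smul,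
      ← Complex.mul_conj]
    simp only [Function.comp_apply, e'.left_inv hwW.2]
    ring
  · intro w hw
    have : e'.symm w ∉ tsupport ρ := fun h ↦ hw.2 ⟨hw.1, hsρ h⟩
    rw [dbar_comp_symm_eq_zero hw.1 this]
    ring
  · intro w hw
    have : e.symm w ∉ tsupport σ := fun h ↦ hw.2 ⟨hw.1, hsσ h⟩
    rw [image_eq_zero_of_notMem_tsupport this]
    ring

/-- **Residue theorem**: a meromorphic `1`-form on a compact Riemann surface, with at most
simple poles, whose residues are all nonnegative integers, has no poles. -/
theorem residue_eq_zero [T2Space C] [CompactSpace C] [IsManifold 𝓘(ℂ) ω C]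
    (e : C → OpenPartialHomeomorph C ℂ) (he : ∀ x, e x ∈ IsManifold.maximalAtlas 𝓘(ℂ) ω C)
    (hx : ∀ x, x ∈ (e x).source) (n : C → ℕ) (G : C → ℂ → ℂ)
    (hG : ∀ x, DifferentiableOn ℂ (G x) (e x).target)
    (hΘ : ∀ x x', ∀ y ∈ (e x).source ∩ (e x').source, y ≠ x → y ≠ x' →
      polar (n x) (e x x) (G x) (e x y) =
        polar (n x') (e x' x') (G x') (e x' y) * deriv (e x' ∘ (e x).symm) (e x y))
    (p : C) : n p = 0 := by
  classical
  -- The point `p` is removed from every chart but its own, so that the partition function belonging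
  -- to `p` takes the value one at `p`.
  let V : C → Set C := fun x ↦ if x = p then (e x).source else (e x).source \ {p}
  have hVs : ∀ x, V x ⊆ (e x).source := by
    intro x
    by_cases h : x = p
    · simp [V, h]
    · simp [V, h]
  have hVo : ∀ x, IsOpen (V x) := by
    intro x
    by_cases h : x = p
    · simpa [V, h] using (e p).open_source
    · simpa [V, h] using (e x).open_source.sdiff isClosed_singleton
  have hVx : ∀ x, x ∈ V x := by
    intro x
    by_cases h : x = p
    · simpa [V, h] using hx p
    · simpa [V, h] using hx x
  obtain ⟨t, -, ht⟩ := isCompact_univ.elim_nhds_subcover V fun x _ ↦ (hVo x).mem_nhds (hVx x)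
  have hM := isManifold_real (C := C)
  obtain ⟨f, hf⟩ := SmoothPartitionOfUnity.exists_isSubordinate 𝓘(ℝ, ℂ) isClosed_univ
    (fun x : t ↦ V x) (fun x ↦ hVo x) (by
      intro y hy
      obtain ⟨x, hx, hy⟩ := mem_iUnion₂.1 (ht hy)
      exact mem_iUnion.2 ⟨⟨x, hx⟩, hy⟩)
  let ρ : t → C → ℂ := fun j y ↦ (f j y : ℂ)
  have hρ : ∀ j, ContMDiff 𝓘(ℝ, ℂ) 𝓘(ℝ, ℂ) 1 (ρ j) := by
    intro j
    have h1 : ContMDiff 𝓘(ℝ, ℂ) 𝓘(ℝ, ℝ) 1 (f j) :=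
      (f j).contMDiff.of_le (by exact_mod_cast le_top)
    exact Complex.ofRealCLM.contMDiff.comp h1
  have hts : ∀ j, tsupport (ρ j) ⊆ V j := fun j ↦
    (closure_mono fun y hy ↦ by
      simp only [Function.mem_support, ρ] at hy ⊢
      exact_mod_cast hy).trans (hf j)
  have hsum : ∀ y, ∑ j, f j y = 1 := by
    intro y
    have := f.sum_eq_one (mem_univ y)
    rwa [finsum_eq_sum_of_fintype] at this
  have hsumρ : ∀ y, ∑ j, ρ j y = 1 := by
    intro y
    simp only [ρ]
    exact_mod_cast hsum y
  have hint : ∀ j k l : t, (l = j ∨ l = k) → IntegrableOn (fun w ↦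
      ρ k ((e l).symm w) * dbar (ρ j ∘ (e l).symm) w * polar (n l) (e l l) (G l) w) (e l).target := by
    intro j k l hl
    have hcont : ContinuousOn (fun w ↦ ρ k ((e l).symm w) * dbar (ρ j ∘ (e l).symm) w)
        (e l).target := (contDiffOn_comp_symm (he l) (hρ k)).continuousOn.mul
      (continuousOn_dbar (e l).open_target (contDiffOn_comp_symm (he l) (hρ j)))
    have hK : ∀ m : t, m = l → IsCompact ((e l) '' tsupport (ρ m)) ∧
        (e l) '' tsupport (ρ m) ⊆ (e l).target ∧
        ∀ w ∈ (e l).target, w ∉ (e l) '' tsupport (ρ m) → (e l).symm w ∉ tsupport (ρ m) := by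
      rintro m rfl
      have hs := (hts m).trans (hVs m)
      refine ⟨(isClosed_tsupport _).isCompact.image_of_continuousOn ((e m).continuousOn.mono hs),
        ?_, fun w hw hwK h ↦ hwK ⟨(e m).symm w, h, (e m).right_inv hw⟩⟩
      rintro _ ⟨y, hy, rfl⟩
      exact (e m).map_source (hs hy)
    rcases hl with hl | hl
    · obtain ⟨h1, h2, h3⟩ := hK j hl.symm
      exact integrableOn_mul_polar (e l).open_target h1 h2 hcont (fun w hw hwK ↦ by
        rw [dbar_comp_symm_eq_zero hw (h3 w hw hwK), mul_zero]) _ _ (hG l)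
    · obtain ⟨h1, h2, h3⟩ := hK k hl.symm
      exact integrableOn_mul_polar (e l).open_target h1 h2 hcont (fun w hw hwK ↦ by
        rw [image_eq_zero_of_notMem_tsupport (h3 w hw hwK), zero_mul]) _ _ (hG l)
  -- The double sum of `∫ ρ_k ∂̄ρ_j ∧ Θ` is evaluated in two ways. Over `k`, in the chart of `j`,
  -- the `ρ_k` add up to one and a residue remains.
  have hrow : ∀ j : t, ∑ k, ∫ w in (e j).target,
      ρ k ((e j).symm w) * dbar (ρ j ∘ (e j).symm) w * polar (n j) (e j j) (G j) w =
        -(2 * Real.pi) * (n j * ρ j j) := by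
    intro j
    rw [← integral_finsetSum _ fun k _ ↦ hint j k j (Or.inl rfl),
      ← integral_dbar_mul_polar (he j) (hρ j) ((hts j).trans (hVs j)) (hx j) (n j) (hG j)]
    congr 1
    ext w
    rw [← Finset.sum_mul, ← Finset.sum_mul, hsumρ, one_mul]
  -- Over `j`, in the chart of `k`, the integrand vanishes since `∑ ρ_j` is constant.
  have hcol : ∀ k : t, ∑ j, ∫ w in (e k).target,
      ρ k ((e k).symm w) * dbar (ρ j ∘ (e k).symm) w * polar (n k) (e k k) (G k) w = 0 := by
    intro k
    rw [← integral_finsetSum _ fun j _ ↦ hint j k k (Or.inr rfl)]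
    refine setIntegral_eq_zero_of_forall_eq_zero fun w hw ↦ ?_
    rw [← Finset.sum_mul, ← Finset.mul_sum]
    have hd : ∀ j, DifferentiableAt ℝ (ρ j ∘ (e k).symm) w := fun j ↦
      ((contDiffOn_comp_symm (he k) (hρ j)).contDiffAt
        ((e k).open_target.mem_nhds hw)).differentiableAt one_ne_zero
    have : ∑ j, dbar (ρ j ∘ (e k).symm) w = 0 := by
      have h1 : fderiv ℝ (fun z ↦ ∑ j, (ρ j ∘ (e k).symm) z) w =
          ∑ j, fderiv ℝ (ρ j ∘ (e k).symm) w := fderiv_fun_sum fun j _ ↦ hd j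
      have h2 : (fun z ↦ ∑ j, (ρ j ∘ (e k).symm) z) = fun _ ↦ 1 := by
        ext z
        exact hsumρ _
      rw [h2, fderiv_fun_const] at h1
      simp only [dbar]
      rw [Finset.sum_add_distrib, ← Finset.mul_sum, ← _root_.sum_apply,
        ← _root_.sum_apply, ← h1]
      simp
    rw [this, mul_zero, zero_mul]
  have hswap : ∀ j k : t, ∫ w in (e j).target,
      ρ k ((e j).symm w) * dbar (ρ j ∘ (e j).symm) w * polar (n j) (e j j) (G j) w =
      ∫ w in (e k).target,
      ρ k ((e k).symm w) * dbar (ρ j ∘ (e k).symm) w * polar (n k) (e k k) (G k) w := fun j k ↦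
    integral_change_chart (he j) (he k) (hρ j) ((hts j).trans (hVs j)) ((hts k).trans (hVs k))
      (hΘ j k)
  have htotal : ∑ j : t, -(2 * Real.pi : ℂ) * (n j * ρ j j) = 0 := by
    rw [← Finset.sum_congr rfl fun j _ ↦ hrow j]
    rw [Finset.sum_congr rfl fun j _ ↦ Finset.sum_congr rfl fun k _ ↦ hswap j k]
    rw [Finset.sum_comm]
    exact Finset.sum_eq_zero fun k _ ↦ hcol k
  have hreal : ∑ j : t, (n j : ℝ) * f j j = 0 := by
    rw [← Finset.mul_sum] at htotal
    have hpi : -(2 * Real.pi : ℂ) ≠ 0 := by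
      simp [Real.pi_ne_zero]
    have := (mul_eq_zero.1 htotal).resolve_left hpi
    have h2 : ((∑ j : t, (n j : ℝ) * f j j : ℝ) : ℂ) = 0 := by
      rw [← this]
      push_cast
      rfl
    exact_mod_cast h2
  have hfp : ∀ j : t, (j : C) ≠ p → f j p = 0 := by
    intro j hj
    have : p ∉ tsupport (f j) := fun h ↦ by
      have := hf j h
      simp [V, hj] at this
    exact image_eq_zero_of_notMem_tsupport this
  have hp : p ∈ t := by
    by_contra hp
    have := hsum p
    rw [Finset.sum_eq_zero fun j _ ↦ hfp j fun h ↦ hp (h ▸ j.2)] at this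
    exact zero_ne_one this
  have hone : f ⟨p, hp⟩ p = 1 := by
    rw [← hsum p, Finset.sum_eq_single (⟨p, hp⟩ : t) (fun j _ hj ↦ hfp j fun h ↦ hj (Subtype.ext h))
      (by simp)]
  -- A vanishing sum of nonnegative terms: this is where the sign of the residues enters.
  have := (Finset.sum_eq_zero_iff_of_nonneg fun j _ ↦
    mul_nonneg (Nat.cast_nonneg _) (f.nonneg j j)).1 hreal ⟨p, hp⟩ (Finset.mem_univ _)
  simpa [hone] using this

end Residue

end Oper
end

noncomputable section

namespace Oper

/-! ### Parallel transport in the flat frames of a projective coordinate system -/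

namespace ProjectiveCoordinateSystem

variable {C : Type*} [TopologicalSpace C] [ChartedSpace ℂ C] [IsManifold 𝓘(ℂ) ω C] {ι : Type*}
  (P : ProjectiveCoordinateSystem C ι)

lemma isOpen_U (α : ι) : IsOpen (P.U α) := (P.z α).open_source

lemma f_self {α : ι} {x : C} (hx : x ∈ P.U α) : P.f α α = 1 := by
  have := P.cocycle α α α ⟨x, ⟨hx, hx⟩, hx⟩
  simpa using this

lemma f_mul_f {α β γ : ι} {x : C} (hα : x ∈ P.U α) (hβ : x ∈ P.U β) (hγ : x ∈ P.U γ) :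
    P.f α β * P.f β γ = P.f α γ :=
  P.cocycle α β γ ⟨x, ⟨hα, hβ⟩, hγ⟩

lemma f_inv {α β : ι} {x : C} (hα : x ∈ P.U α) (hβ : x ∈ P.U β) : (P.f α β)⁻¹ = P.f β α := by
  rw [inv_eq_iff_mul_eq_one, P.f_mul_f hα hβ hα, P.f_self hα]

lemma xi_ne_zero {α β : ι} {x : C} (hα : x ∈ P.U α) (hβ : x ∈ P.U β) : P.xi α β x ≠ 0 :=
  (P.mobius α β x ⟨hα, hβ⟩).1

lemma xi_mul_z {α β : ι} {x : C} (hα : x ∈ P.U α) (hβ : x ∈ P.U β) :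
    P.xi α β x * P.z α x = P.f α β 0 0 * P.z β x + P.f α β 0 1 := by
  have h := (P.mobius α β x ⟨hα, hβ⟩).2
  have h' := P.xi_ne_zero hα hβ
  rw [h]
  rw [xi] at h' ⊢
  field_simp

lemma f_mulVec {α β : ι} {x : C} (hα : x ∈ P.U α) (hβ : x ∈ P.U β) :
    (P.f α β : Matrix (Fin 2) (Fin 2) ℂ) *ᵥ ![P.z β x, 1] = P.xi α β x • ![P.z α x, 1] := by
  ext i
  fin_cases i
  · simp [Matrix.mulVec, dotProduct, Fin.sum_univ_two, P.xi_mul_z hα hβ]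
  · simp [Matrix.mulVec, dotProduct, Fin.sum_univ_two, xi]

/-- Parallel transport, from the frame over `U_α` at `x` to the frame over `U_β` at `y`, for the
flat bundle with transition functions `f`. -/
inductive Transport : C → ι → C → ι → SL(2, ℂ) → Prop
  | path {α : ι} {x y : C} (h : JoinedIn (P.U α) x y) : Transport x α y α 1
  | change {α β : ι} {x : C} (hα : x ∈ P.U α) (hβ : x ∈ P.U β) : Transport x α x β (P.f β α)
  | trans {α β γ : ι} {x y z : C} {A B : SL(2, ℂ)} (h₁ : Transport x α y β A)
      (h₂ : Transport y β z γ B) : Transport x α z γ (B * A)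

variable {P}

lemma Transport.symm {α β : ι} {x y : C} {A : SL(2, ℂ)} (h : P.Transport x α y β A) :
    P.Transport y β x α A⁻¹ := by
  induction h with
  | path h => simpa using Transport.path h.symm
  | change hα hβ =>
    rw [P.f_inv hβ hα]
    exact Transport.change hβ hα
  | trans _ _ ih₁ ih₂ =>
    rw [mul_inv_rev]
    exact ih₂.trans ih₁

variable (P) in
/-- The holonomy group, in the frame over `U_α`. -/
def holonomyGroup {x : C} {α : ι} (hx : x ∈ P.U α) : Subgroup SL(2, ℂ) where
  carrier := {A | P.Transport x α x α A}
  one_mem' := Transport.path (JoinedIn.refl hx)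
  mul_mem' hA hB := hB.trans hA
  inv_mem' hA := hA.symm

/-- The set of reachable points is open and closed, because path components of the `U_β` are open on
a locally path connected space. -/
lemma exists_transport [ConnectedSpace C] {x : C} {α : ι} (hx : x ∈ P.U α) {y : C} {β : ι}
    (hy : y ∈ P.U β) : ∃ A, P.Transport x α y β A := by
  have := ChartedSpace.locallyPathConnectedSpace ℂ C
  let V : Set C := {y | ∃ β, ∃ A, y ∈ P.U β ∧ P.Transport x α y β A}
  have hloc : ∀ y z β, z ∈ pathComponentIn (P.U β) y → (y ∈ V ↔ z ∈ V) := by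
    intro y z β hz
    have hz : JoinedIn (P.U β) y z := hz
    constructor
    · rintro ⟨γ, A, hyγ, hA⟩
      exact ⟨β, _, hz.target_mem, (hA.trans (.change hyγ hz.source_mem)).trans (.path hz)⟩
    · rintro ⟨γ, A, hzγ, hA⟩
      exact ⟨β, _, hz.source_mem, (hA.trans (.change hzγ hz.target_mem)).trans (.path hz.symm)⟩
  have hopen : IsOpen V := by
    rw [isOpen_iff_mem_nhds]
    intro y hyV
    obtain ⟨β, A, hyβ, -⟩ := id hyV
    filter_upwards [((P.isOpen_U β).pathComponentIn y).mem_nhds (mem_pathComponentIn_self hyβ)]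
      with z hz
    exact (hloc y z β hz).1 hyV
  have hclosed : IsClosed V := by
    rw [← isOpen_compl_iff, isOpen_iff_mem_nhds]
    intro y hyV
    obtain ⟨β, hyβ⟩ := P.cover y
    filter_upwards [((P.isOpen_U β).pathComponentIn y).mem_nhds (mem_pathComponentIn_self hyβ)]
      with z hz
    exact fun hzV ↦ hyV ((hloc y z β hz).2 hzV)
  have huniv : V = univ := IsClopen.eq_univ ⟨hclosed, hopen⟩
    ⟨x, α, 1, hx, Transport.path (JoinedIn.refl hx)⟩
  obtain ⟨γ, A, hyγ, hA⟩ : y ∈ V := huniv ▸ mem_univ y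
  exact ⟨_, hA.trans (.change hyγ hy)⟩

/-! ### Semi-invariant binary forms and holomorphic `1`-forms -/

/-- `h` is the family of coefficients of a holomorphic `1`-form `h_β dz_β`. -/
structure IsFormCoeff (P : ProjectiveCoordinateSystem C ι) (h : ι → C → ℂ) : Prop where
  differentiableOn : ∀ β, DifferentiableOn ℂ (h β ∘ (P.z β).symm) (P.z β).target
  transform : ∀ α β, ∀ x ∈ P.U α ∩ P.U β, h α x = P.xi α β x ^ 2 * h β x

lemma IsFormCoeff.analyticAt {h : ι → C → ℂ} (hh : P.IsFormCoeff h) {β : ι} {w : ℂ}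
    (hw : w ∈ (P.z β).target) : AnalyticAt ℂ (h β ∘ (P.z β).symm) w :=
  (hh.differentiableOn β).analyticAt ((P.z β).open_target.mem_nhds hw)

lemma IsFormCoeff.eq_zero_iff {h : ι → C → ℂ} (hh : P.IsFormCoeff h) {α β : ι} {x : C}
    (hα : x ∈ P.U α) (hβ : x ∈ P.U β) : h α x = 0 ↔ h β x = 0 := by
  rw [hh.transform α β x ⟨hα, hβ⟩]
  simp [P.xi_ne_zero hα hβ]

/-- The identity theorem for holomorphic `1`-forms. -/
lemma IsFormCoeff.eq_zero_of_eventually [ConnectedSpace C] {h : ι → C → ℂ} (hh : P.IsFormCoeff h)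
    {β : ι} {x : C} (hx : x ∈ P.U β) (h0 : ∀ᶠ w in 𝓝 (P.z β x), (h β ∘ (P.z β).symm) w = 0)
    {γ : ι} {y : C} (hy : y ∈ P.U γ) : h γ y = 0 := by
  let V : Set C := {y | ∀ γ, y ∈ P.U γ → h γ y = 0}
  have hnhds : ∀ {γ : ι} {y : C}, y ∈ P.U γ →
      (y ∈ interior V ↔ ∀ᶠ w in 𝓝 (P.z γ y), (h γ ∘ (P.z γ).symm) w = 0) := by
    intro γ y hy
    rw [mem_interior_iff_mem_nhds, ← (P.z γ).symm_map_nhds_eq hy]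
    constructor
    · intro hV
      have := Filter.mem_map.1 hV
      filter_upwards [this, (P.z γ).open_target.mem_nhds ((P.z γ).map_source hy)] with w hw hwt
      exact hw γ ((P.z γ).map_target hwt)
    · intro hV
      rw [Filter.mem_map]
      filter_upwards [hV, (P.z γ).open_target.mem_nhds ((P.z γ).map_source hy)] with w hw hwt
      intro δ hδ
      exact (hh.eq_zero_iff hδ ((P.z γ).map_target hwt)).2 hw
  -- At a limit of interior points the zeros accumulate, so by isolation of zeros the coefficient
  -- vanishes near that limit.
  have hclosed : IsClosed (interior V) := by
    rw [← closure_subset_iff_isClosed]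
    intro y hy
    obtain ⟨γ, hγ⟩ := P.cover y
    rw [hnhds hγ]
    by_contra hne
    have hev := ((hh.analyticAt ((P.z γ).map_source hγ)).eventually_eq_zero_or_eventually_ne_zero
      ).resolve_left hne
    rw [eventually_nhdsWithin_iff] at hev
    have hcont := (P.z γ).continuousAt hγ
    have hev' : ∀ᶠ z in 𝓝 y, z ∈ P.U γ → z ≠ y → z ∉ V := by
      filter_upwards [hcont.eventually hev] with z hz hzU hzy hzV
      refine hz (fun h ↦ hzy ((P.z γ).injOn hzU hγ h)) ?_
      rw [Function.comp_apply, (P.z γ).left_inv hzU]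
      exact hzV γ hzU
    obtain ⟨W, hW, hWo, hyW⟩ := eventually_nhds_iff.1
      (hev'.and ((P.isOpen_U γ).eventually_mem hγ))
    obtain ⟨z, hzW, hzV⟩ := mem_closure_iff.1 hy W hWo hyW
    have hzy : z = y := by
      by_contra hzy
      exact (hW z hzW).1 (hW z hzW).2 hzy (interior_subset hzV)
    exact hne ((hnhds hγ).1 (hzy ▸ hzV))
  have huniv : interior V = univ := IsClopen.eq_univ ⟨hclosed, isOpen_interior⟩
    ⟨x, (hnhds hx).2 h0⟩
  have : y ∈ interior V := huniv ▸ mem_univ y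
  exact interior_subset this γ hy

/-- Each factor is an affine function of `w` with coefficient vector `a i ᵥ* A`, nonzero because `A`
is invertible. -/
lemma eventually_prod_ne_zero {κ : Type} [Fintype κ] {a : κ → Fin 2 → ℂ} (ha : ∀ i, a i ≠ 0)
    (A : SL(2, ℂ)) (c : ℂ) : ∀ᶠ w in 𝓝[≠] c,
      ∏ i, a i ⬝ᵥ ((A : Matrix (Fin 2) (Fin 2) ℂ) *ᵥ ![w, 1]) ≠ 0 := by
  have key : ∀ i, ∀ᶠ w in 𝓝[≠] c, a i ⬝ᵥ ((A : Matrix (Fin 2) (Fin 2) ℂ) *ᵥ ![w, 1]) ≠ 0 := by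
    intro i
    let b := a i ᵥ* (A : Matrix (Fin 2) (Fin 2) ℂ)
    have hb : b ≠ 0 := by
      intro hb
      apply ha i
      have := congrArg (fun v ↦ v ᵥ* ((A⁻¹ : SL(2, ℂ)) : Matrix (Fin 2) (Fin 2) ℂ)) hb
      simp only [b, Matrix.vecMul_vecMul, ← Matrix.SpecialLinearGroup.coe_mul, mul_inv_cancel,
        Matrix.zero_vecMul] at this
      simpa using this
    have hlin : ∀ w : ℂ, a i ⬝ᵥ ((A : Matrix (Fin 2) (Fin 2) ℂ) *ᵥ ![w, 1]) = b 0 * w + b 1 := by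
      intro w
      rw [Matrix.dotProduct_mulVec]
      simp [dotProduct, Fin.sum_univ_two, b]
    have han : AnalyticAt ℂ (fun w : ℂ ↦ b 0 * w + b 1) c := by fun_prop
    rcases han.eventually_eq_zero_or_eventually_ne_zero with h | h
    · exfalso
      apply hb
      have hd : deriv (fun w : ℂ ↦ b 0 * w + b 1) c = 0 := by
        rw [Filter.EventuallyEq.deriv_eq (f := fun _ ↦ (0 : ℂ)) h]
        simp
      have h0 : b 0 = 0 := by simpa using hd
      have h1 := h.self_of_nhds
      rw [h0, zero_mul, zero_add] at h1
      ext j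
      fin_cases j
      · exact h0
      · exact h1
    · filter_upwards [h] with w hw
      rwa [hlin]
  filter_upwards [Filter.eventually_all.2 key] with w hw
  exact Finset.prod_ne_zero_iff.2 fun i _ ↦ hw i

end ProjectiveCoordinateSystem

end Oper
end

/-! ### The logarithmic derivative attached to a semi-invariant form -/

noncomputable section

namespace Oper
namespace ProjectiveCoordinateSystem

variable {C : Type*} [TopologicalSpace C] [ChartedSpace ℂ C] [IsManifold 𝓘(ℂ) ω C] {ι : Type*}
  {P : ProjectiveCoordinateSystem C ι} {κ : Type} [Fintype κ]

/-- The binary form `∏ a_i`, transported by `A`, at the vector `(z_β, 1)`: twice its divisor is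
the divisor of a section of a power of the tangent bundle, which `h` turns into a function. -/
def semiForm (P : ProjectiveCoordinateSystem C ι) (a : κ → Fin 2 → ℂ) (h : ι → C → ℂ) (β : ι)
    (A : SL(2, ℂ)) (w : ℂ) : ℂ :=
  (∏ i, a i ⬝ᵥ (((A⁻¹ : SL(2, ℂ)) : Matrix (Fin 2) (Fin 2) ℂ) *ᵥ ![w, 1])) ^ 2 *
    ((h β ∘ (P.z β).symm) w) ^ Fintype.card κ

lemma IsFormCoeff.analyticAt_semiForm {h : ι → C → ℂ} (hh : P.IsFormCoeff h)
    (a : κ → Fin 2 → ℂ) {β : ι} (A : SL(2, ℂ)) {w : ℂ} (hw : w ∈ (P.z β).target) :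
    AnalyticAt ℂ (P.semiForm a h β A) w := by
  have h1 := hh.analyticAt hw
  have h2 : ∀ i, AnalyticAt ℂ
      (fun w ↦ a i ⬝ᵥ (((A⁻¹ : SL(2, ℂ)) : Matrix (Fin 2) (Fin 2) ℂ) *ᵥ ![w, 1])) w := by
    intro i
    simp only [dotProduct, Matrix.mulVec, Fin.sum_univ_two, Matrix.cons_val_zero,
      Matrix.cons_val_one]
    fun_prop
  have h3 : AnalyticAt ℂ (fun w ↦
      ∏ i, a i ⬝ᵥ (((A⁻¹ : SL(2, ℂ)) : Matrix (Fin 2) (Fin 2) ℂ) *ᵥ ![w, 1])) w :=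
    Finset.analyticAt_fun_prod _ fun i _ ↦ h2 i
  exact (h3.pow 2).mul (h1.pow _)

lemma IsFormCoeff.semiForm_not_eventually_zero [ConnectedSpace C] {h : ι → C → ℂ}
    (hh : P.IsFormCoeff h) {γ : ι} {y : C} (hy : y ∈ P.U γ) (hne : h γ y ≠ 0)
    {a : κ → Fin 2 → ℂ} (ha : ∀ i, a i ≠ 0) {β : ι} (A : SL(2, ℂ)) {x : C} (hx : x ∈ P.U β) :
    ¬ ∀ᶠ w in 𝓝 (P.z β x), P.semiForm a h β A w = 0 := by
  intro h0
  have h1 := (hh.analyticAt ((P.z β).map_source hx)).eventually_eq_zero_or_eventually_ne_zero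
  have h2 : ¬ ∀ᶠ w in 𝓝 (P.z β x), (h β ∘ (P.z β).symm) w = 0 :=
    fun h2 ↦ hne (hh.eq_zero_of_eventually hx h2 hy)
  obtain ⟨w, ⟨hw1, hw2⟩, hw3⟩ := (((h1.resolve_left h2).and
    (eventually_prod_ne_zero ha A⁻¹ (P.z β x))).and (h0.filter_mono nhdsWithin_le_nhds)).exists
  exact mul_ne_zero (pow_ne_zero _ hw2) (pow_ne_zero _ hw1) hw3

/-- The weights cancel. Since `f (z_β, 1) = ξ (z_β', 1)`, a product of `k` linear forms scales by
`ξ^(-k)`, while `h ^ k` scales by `ξ^(2k)`. Only the square of the constant `χ` survives. -/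
lemma IsFormCoeff.semiForm_transform {h : ι → C → ℂ} (hh : P.IsFormCoeff h)
    (a : κ → Fin 2 → ℂ) {β β' : ι} (A A' : SL(2, ℂ)) {χ : ℂ}
    (hχ : ∀ v, ∏ i, a i ⬝ᵥ (((A'⁻¹ * P.f β' β * A : SL(2, ℂ)) : Matrix (Fin 2) (Fin 2) ℂ) *ᵥ v) =
      χ * ∏ i, a i ⬝ᵥ v) {y : C} (hy : y ∈ P.U β) (hy' : y ∈ P.U β') :
    P.semiForm a h β' A' (P.z β' y) = χ ^ 2 * P.semiForm a h β A (P.z β y) := by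
  have hξ := P.xi_ne_zero hy' hy
  have key : P.xi β' β y ^ Fintype.card κ *
      ∏ i, a i ⬝ᵥ (((A'⁻¹ : SL(2, ℂ)) : Matrix (Fin 2) (Fin 2) ℂ) *ᵥ ![P.z β' y, 1]) =
      χ * ∏ i, a i ⬝ᵥ (((A⁻¹ : SL(2, ℂ)) : Matrix (Fin 2) (Fin 2) ℂ) *ᵥ ![P.z β y, 1]) := by
    rw [← hχ, ← Finset.card_univ, ← Finset.prod_const, ← Finset.prod_mul_distrib]
    refine Finset.prod_congr rfl fun i _ ↦ ?_
    rw [Matrix.mulVec_mulVec, ← Matrix.SpecialLinearGroup.coe_mul, mul_assoc (A'⁻¹ * _),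
      mul_inv_cancel, mul_one, Matrix.SpecialLinearGroup.coe_mul, ← Matrix.mulVec_mulVec,
      P.f_mulVec hy' hy, Matrix.mulVec_smul, dotProduct_smul, smul_eq_mul]
  have hhy := hh.transform β' β y ⟨hy', hy⟩
  simp only [semiForm, Function.comp_apply]
  rw [(P.z β').left_inv hy', (P.z β).left_inv hy, hhy, mul_pow, ← mul_assoc, ← mul_assoc,
    ← mul_pow χ, ← key]
  ring

/-- A coordinate ball is convex, so its points are joined inside `U_β` and the transport matrix does
not change. -/
lemma Transport.of_ball {x₀ x y : C} {α β : ι} {A : SL(2, ℂ)} (hx : x ∈ P.U β)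
    (hA : P.Transport x₀ α x β A) {r : ℝ} (hr : Metric.ball (P.z β x) r ⊆ (P.z β).target)
    (hy : y ∈ P.U β) (hyr : P.z β y ∈ Metric.ball (P.z β x) r) : P.Transport x₀ α y β A := by
  have hr0 : P.z β x ∈ Metric.ball (P.z β x) r :=
    Metric.mem_ball_self ((dist_nonneg).trans_lt hyr)
  have h1 : JoinedIn (Metric.ball (P.z β x) r) (P.z β x) (P.z β y) :=
    ((convex_ball _ r).isPathConnected ⟨_, hr0⟩).joinedIn _ hr0 _ hyr
  have h2 := h1.map_continuousOn ((P.z β).continuousOn_symm.mono hr)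
  rw [(P.z β).left_inv hx, (P.z β).left_inv hy] at h2
  have h3 : JoinedIn (P.U β) x y := h2.mono (by
    rintro _ ⟨w, hw, rfl⟩
    exact (P.z β).map_target (hr hw))
  simpa using hA.trans (.path h3)

/-- Around `x` the function factors as `(w - c) ^ n * g` with `g` zero-free on a small ball, so its
logarithmic derivative is `n / (w - c) + g' / g`. The chart is `z_β` restricted to that ball, where
one transport matrix serves all points. -/
lemma IsFormCoeff.exists_polar [ConnectedSpace C] {h : ι → C → ℂ}
    (hh : P.IsFormCoeff h) {γ : ι} {y : C} (hy : y ∈ P.U γ) (hne : h γ y ≠ 0)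
    {a : κ → Fin 2 → ℂ} [Nonempty κ] (ha : ∀ i, a i ≠ 0) {α : ι} {x₀ : C} (hx₀ : x₀ ∈ P.U α)
    (x : C) : ∃ (e : OpenPartialHomeomorph C ℂ) (β : ι) (A : SL(2, ℂ)) (n : ℕ) (G : ℂ → ℂ),
      e ∈ IsManifold.maximalAtlas 𝓘(ℂ) ω C ∧ x ∈ e.source ∧ DifferentiableOn ℂ G e.target ∧
      e.source ⊆ P.U β ∧ (⇑e = P.z β) ∧ (⇑e.symm = (P.z β).symm) ∧
      (∀ y ∈ e.source, P.Transport x₀ α y β A) ∧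
      (∀ y ∈ e.source, y ≠ x → P.semiForm a h β A (P.z β y) ≠ 0 ∧
        logDeriv (P.semiForm a h β A) (P.z β y) = polar n (P.z β x) G (P.z β y)) ∧
      (h β x = 0 → n ≠ 0) := by
  obtain ⟨β, hx⟩ := P.cover x
  obtain ⟨A, hA⟩ := exists_transport hx₀ hx
  have hxt := (P.z β).map_source hx
  obtain ⟨n, g, hg, hg0, hev⟩ :=
    (hh.analyticAt_semiForm a A hxt).exists_eventuallyEq_pow_smul_nonzero_iff.2
      (hh.semiForm_not_eventually_zero hy hne ha A hx)
  obtain ⟨r, hr, hball⟩ := Metric.eventually_nhds_iff_ball.1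
    (((hev.eventually_nhds.and hg.eventually_analyticAt).and (hg.continuousAt.eventually_ne hg0)).and
      ((P.z β).open_target.eventually_mem hxt))
  have hs := (P.z β).isOpen_inter_preimage (Metric.isOpen_ball (x := P.z β x) (ε := r))
  have hsrc : ((P.z β).restr ((P.z β).source ∩ P.z β ⁻¹' Metric.ball (P.z β x) r)).source =
      (P.z β).source ∩ P.z β ⁻¹' Metric.ball (P.z β x) r := by
    rw [OpenPartialHomeomorph.restr_source' _ _ hs, ← inter_assoc, inter_self]
  refine ⟨(P.z β).restr ((P.z β).source ∩ P.z β ⁻¹' Metric.ball (P.z β x) r), β, A, n,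
    fun w ↦ deriv g w / g w, restr_mem_maximalAtlas _ (P.holomorphic β) hs, ?_, ?_, ?_, rfl, rfl,
    ?_, ?_, ?_⟩
  · rw [hsrc]
    exact ⟨hx, Metric.mem_ball_self hr⟩
  · intro w hw
    have hw' := OpenPartialHomeomorph.map_target _ hw
    rw [hsrc] at hw'
    have hwt : w ∈ (P.z β).target := hw.1
    have hwb : w ∈ Metric.ball (P.z β x) r := by
      have := hw'.2
      rwa [mem_preimage, OpenPartialHomeomorph.restr_symm_apply, (P.z β).right_inv hwt] at this
    have := hball w hwb
    exact (this.1.1.2.deriv.div this.1.1.2 this.1.2).differentiableAt.differentiableWithinAt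
  · rw [hsrc]
    exact inter_subset_left
  · intro y hy
    rw [hsrc] at hy
    exact hA.of_ball hx (fun w hw ↦ (hball w hw).2) hy.1 hy.2
  · intro y hy hyx
    rw [hsrc] at hy
    have hb := hball _ hy.2
    have hne : P.z β y - P.z β x ≠ 0 := fun h ↦ hyx ((P.z β).injOn hy.1 hx (sub_eq_zero.1 h))
    have hS := hb.1.1.1
    constructor
    · rw [hS.self_of_nhds]
      exact mul_ne_zero (pow_ne_zero _ hne) hb.1.2
    · have hd : DifferentiableAt ℂ (fun w ↦ (w - P.z β x) ^ n) (P.z β y) := by fun_prop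
      have hS' : P.semiForm a h β A =ᶠ[𝓝 (P.z β y)] fun w ↦ (w - P.z β x) ^ n * g w := hS
      rw [logDeriv_apply, hS'.deriv_eq, hS'.self_of_nhds, ← logDeriv_apply,
        logDeriv_mul (f := fun w ↦ (w - P.z β x) ^ n) _ (pow_ne_zero _ hne) hb.1.2 hd hb.1.1.2.differentiableAt, polar,
        logDeriv_apply g]
      congr 1
      rw [logDeriv_fun_pow (by fun_prop), logDeriv_apply]
      simp
  -- The exponent of `h` is the number of linear factors, which is positive; so a zero of `h` forces
  -- a positive vanishing order.
  · rintro hx0 rfl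
    apply hg0
    have := hev.self_of_nhds
    rw [pow_zero, one_smul] at this
    rw [← this, semiForm, Function.comp_apply, (P.z β).left_inv hx, hx0,
      zero_pow Fintype.card_ne_zero, mul_zero]

/-- If there is a nonzero holomorphic `1`-form with a zero, then the holonomy group has no
semi-invariant. -/
theorem IsFormCoeff.not_hasSemiInvariant [T2Space C] [CompactSpace C] [ConnectedSpace C]
    {h : ι → C → ℂ} (hh : P.IsFormCoeff h) {γ : ι} {y : C} (hy : y ∈ P.U γ) (hne : h γ y ≠ 0)
    {δ : ι} {p : C} (hp : p ∈ P.U δ) (hp0 : h δ p = 0) {α : ι} {x₀ : C} (hx₀ : x₀ ∈ P.U α) :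
    ¬ HasSemiInvariant (P.holonomyGroup hx₀) := by
  rintro ⟨κ, _, _, a, ha, hinv⟩
  choose e β A n G he hx hG hU hcoe hsymm htr hS hn using hh.exists_polar hy hne ha hx₀
  refine hn p ((hh.eq_zero_iff (hU p (hx p)) hp).2 hp0)
    (residue_eq_zero e he hx n G hG ?_ p)
  rintro x x' y ⟨hyx, hyx'⟩ hne hne'
  rw [hcoe x, hcoe x', hsymm x, ← (hS x y hyx hne).2, ← (hS x' y hyx' hne').2]
  -- The holonomy of a loop: out from `x₀` to `y` through the chart at `x`, change of frame at `y`,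
  -- and back through the chart at `x'`.
  have hmem : (A x')⁻¹ * P.f (β x') (β x) * A x ∈ P.holonomyGroup hx₀ := by
    have h1 := ((htr x y hyx).trans (.change (hU x hyx) (hU x' hyx'))).trans (htr x' y hyx').symm
    rw [mul_assoc]
    exact h1
  obtain ⟨χ, hχ⟩ := hinv _ hmem
  have hyU := hU x hyx
  have hyU' := hU x' hyx'
  have hyt := (P.z (β x)).map_source hyU
  have hsrc : ∀ᶠ w in 𝓝 (P.z (β x) y), (P.z (β x)).symm w ∈ P.U (β x') := by
    have := (P.z (β x)).continuousAt_symm hyt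
    rw [ContinuousAt, (P.z (β x)).left_inv hyU] at this
    exact this.eventually ((P.isOpen_U _).mem_nhds hyU')
  have hτ : (P.z (β x') ∘ (P.z (β x)).symm) (P.z (β x) y) = P.z (β x') y := by
    rw [Function.comp_apply, (P.z (β x)).left_inv hyU]
  have hev : P.semiForm a h (β x') (A x') ∘ (P.z (β x') ∘ (P.z (β x)).symm)
      =ᶠ[𝓝 (P.z (β x) y)] fun w ↦ χ ^ 2 * P.semiForm a h (β x) (A x) w := by
    filter_upwards [hsrc, (P.z (β x)).open_target.mem_nhds hyt] with w hw hwt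
    have := hh.semiForm_transform a (A x) (A x') hχ ((P.z (β x)).map_target hwt) hw
    rwa [(P.z (β x)).right_inv hwt] at this
  have hχ0 : χ ^ 2 ≠ 0 := by
    intro h0
    have := hev.self_of_nhds
    simp only [h0, zero_mul] at this
    rw [Function.comp_apply, hτ] at this
    exact (hS x' y hyx' hne').1 this
  have hd : DifferentiableAt ℂ (P.z (β x') ∘ (P.z (β x)).symm) (P.z (β x) y) :=
    differentiableAt_transition (P.holomorphic _) (P.holomorphic _) hyt
      (by rwa [(P.z (β x)).left_inv hyU])
  have h1 := logDeriv_comp (f := P.semiForm a h (β x') (A x'))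
    (g := P.z (β x') ∘ (P.z (β x)).symm) (x := P.z (β x) y)
    (by rw [hτ]; exact (hh.analyticAt_semiForm a _ ((P.z _).map_source hyU')).differentiableAt) hd
  rw [hτ] at h1
  rw [← h1, logDeriv_apply (_ ∘ _), hev.deriv_eq, hev.self_of_nhds, ← logDeriv_apply,
    logDeriv_const_mul _ _ hχ0]

end ProjectiveCoordinateSystem
end Oper
end

noncomputable section

set_option linter.unusedSectionVars false

namespace Oper

/-! ### Holomorphic sections of bundles of homomorphisms -/

section HomBundle

variable {C : Type*} [TopologicalSpace C] [ChartedSpace ℂ C] [IsManifold 𝓘(ℂ) ω C]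
  {F : Type*} [NormedAddCommGroup F] [NormedSpace ℂ F]
  {E : C → Type*} [TopologicalSpace (TotalSpace F E)]
  [∀ x, AddCommGroup (E x)] [∀ x, Module ℂ (E x)] [∀ x, TopologicalSpace (E x)]
  [FiberBundle F E] [VectorBundle ℂ F E]
  {F' : Type*} [NormedAddCommGroup F'] [NormedSpace ℂ F']
  {E' : C → Type*} [TopologicalSpace (TotalSpace F' E')]
  [∀ x, AddCommGroup (E' x)] [∀ x, Module ℂ (E' x)] [∀ x, TopologicalSpace (E' x)]
  [FiberBundle F' E'] [VectorBundle ℂ F' E']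
  [∀ x, IsTopologicalAddGroup (E' x)] [∀ x, ContinuousSMul ℂ (E' x)]

lemma contMDiffAt_mvfderiv {f : C → ℂ} {x₀ : C} (hf : ContMDiffAt 𝓘(ℂ) 𝓘(ℂ) ω f x₀) :
    ContMDiffAt 𝓘(ℂ) (𝓘(ℂ).prod 𝓘(ℂ, ℂ →L[ℂ] ℂ)) ω
      (fun x ↦ TotalSpace.mk' (ℂ →L[ℂ] ℂ) (E := Canonical C) x (mvfderiv 𝓘(ℂ) f x)) x₀ := by
  rw [contMDiffAt_hom_bundle]
  refine ⟨contMDiffAt_id, ?_⟩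
  have h := hf.mfderiv_const (m := ω) le_rfl
  refine h.congr_of_eventuallyEq (Filter.Eventually.of_forall fun x ↦ ?_)
  ext
  simp [inTangentCoordinates, ContinuousLinearMap.inCoordinates, mvfderiv]
  rfl

lemma contMDiffAt_smulRight {σ : ∀ x, E x →L[ℂ] Bundle.Trivial C ℂ x} {s : ∀ x, E' x} {x₀ : C}
    (hσ : ContMDiffAt 𝓘(ℂ) (𝓘(ℂ).prod 𝓘(ℂ, F →L[ℂ] ℂ)) ω
      (fun x ↦ TotalSpace.mk' (F →L[ℂ] ℂ) (E := fun x ↦ E x →L[ℂ] Bundle.Trivial C ℂ x) x (σ x)) x₀)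
    (hs : ContMDiffAt 𝓘(ℂ) (𝓘(ℂ).prod 𝓘(ℂ, F')) ω (fun x ↦ TotalSpace.mk' F' x (s x)) x₀) :
    ContMDiffAt 𝓘(ℂ) (𝓘(ℂ).prod 𝓘(ℂ, F →L[ℂ] F')) ω
      (fun x ↦ TotalSpace.mk' (F →L[ℂ] F') (E := fun x ↦ E x →L[ℂ] E' x) x
        (ContinuousLinearMap.smulRight (M₂ := E' x) (σ x : E x →L[ℂ] ℂ) (s x))) x₀ := by
  rw [contMDiffAt_hom_bundle] at hσ ⊢
  refine ⟨contMDiffAt_id, ?_⟩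
  rw [contMDiffAt_section] at hs
  have hb : ContMDiffAt 𝓘(ℂ) 𝓘(ℂ, F →L[ℂ] F') ω _ x₀ :=
    (ContinuousLinearMap.smulRightL ℂ F F').isBoundedBilinearMap.contDiff.contMDiff.contMDiffAt.comp
      x₀ (hσ.2.prodMk_space hs)
  refine hb.congr_of_eventuallyEq ?_
  filter_upwards [(trivializationAt F' E' x₀).open_baseSet.mem_nhds
    (mem_baseSet_trivializationAt F' E' x₀)] with x hx
  ext v
  simp [ContinuousLinearMap.inCoordinates, Trivialization.coe_linearMapAt_of_mem _ hx]

/-- For the line bundle `K^{1/2}` the coordinate map is the local frame of the dual; its holomorphy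
yields that of the projection onto `K^{-1/2}`. -/
lemma contMDiffAt_continuousLinearMapAt [ContMDiffVectorBundle ω F E 𝓘(ℂ)]
    (e : Trivialization F (TotalSpace.proj : TotalSpace F E → C)) [MemTrivializationAtlas e]
    {x₀ : C} (hx₀ : x₀ ∈ e.baseSet) :
    ContMDiffAt 𝓘(ℂ) (𝓘(ℂ).prod 𝓘(ℂ, F →L[ℂ] F)) ω
      (fun x ↦ TotalSpace.mk' (F →L[ℂ] F) (E := fun x ↦ E x →L[ℂ] Bundle.Trivial C F x) x
        (e.continuousLinearMapAt ℂ x)) x₀ := by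
  rw [contMDiffAt_hom_bundle]
  refine ⟨contMDiffAt_id, ?_⟩
  have hx₀' := mem_baseSet_trivializationAt F E x₀
  refine (contMDiffAt_coordChangeL hx₀' hx₀).congr_of_eventuallyEq ?_
  filter_upwards [(trivializationAt F E x₀).open_baseSet.mem_nhds hx₀',
    e.open_baseSet.mem_nhds hx₀] with x hx hxe
  ext v
  simp [ContinuousLinearMap.inCoordinates, Trivialization.coe_linearMapAt_of_mem _ hxe,
    Trivialization.coordChangeL_apply _ _ ⟨hx, hxe⟩, Trivialization.symmL_apply _ hx]

end HomBundle

/-! ### The coordinates `z_α` and their differentials -/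

namespace ProjectiveCoordinateSystem

variable {C : Type*} [TopologicalSpace C] [ChartedSpace ℂ C] [IsManifold 𝓘(ℂ) ω C] {ι : Type*}
  (P : ProjectiveCoordinateSystem C ι)

lemma contMDiffAt_z {α : ι} {x : C} (hx : x ∈ P.U α) : ContMDiffAt 𝓘(ℂ) 𝓘(ℂ) ω (P.z α) x :=
  contMDiffAt_of_mem_maximalAtlas (P.holomorphic α) hx

lemma contMDiffAt_z_symm {α : ι} {w : ℂ} (hw : w ∈ (P.z α).target) :
    ContMDiffAt 𝓘(ℂ) 𝓘(ℂ) ω (P.z α).symm w :=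
  contMDiffAt_symm_of_mem_maximalAtlas (P.holomorphic α) hw

lemma mdifferentiableAt_z {α : ι} {x : C} (hx : x ∈ P.U α) :
    MDifferentiableAt 𝓘(ℂ) 𝓘(ℂ) (P.z α) x :=
  (P.contMDiffAt_z hx).mdifferentiableAt (by simp)

section Chart

variable {F : Type*} [NormedAddCommGroup F] [NormedSpace ℂ F] [CompleteSpace F]

lemma eventually_comp_symm_comp {α : ι} {x : C} (hx : x ∈ P.U α) (f : C → F) :
    (f ∘ (P.z α).symm) ∘ P.z α =ᶠ[𝓝 x] f := by
  filter_upwards [(P.isOpen_U α).mem_nhds hx] with y hy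
  simp [(P.z α).left_inv hy]

lemma differentiableAt_comp_symm {α : ι} {x : C} (hx : x ∈ P.U α) {f : C → F}
    (hf : MDifferentiableAt 𝓘(ℂ) 𝓘(ℂ, F) f x) :
    DifferentiableAt ℂ (f ∘ (P.z α).symm) (P.z α x) := by
  rw [← mdifferentiableAt_iff_differentiableAt]
  refine MDifferentiableAt.comp (I' := 𝓘(ℂ)) _ ?_
    ((P.contMDiffAt_z_symm ((P.z α).map_source hx)).mdifferentiableAt (by simp))
  rwa [(P.z α).left_inv hx]

lemma analyticAt_comp_symm {α : ι} {x : C} (hx : x ∈ P.U α) {f : C → F}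
    (hf : ContMDiffAt 𝓘(ℂ) 𝓘(ℂ, F) ω f x) : AnalyticAt ℂ (f ∘ (P.z α).symm) (P.z α x) := by
  rw [← analyticWithinAt_univ, ← contDiffWithinAt_omega_iff_analyticWithinAt, contDiffWithinAt_univ,
    ← contMDiffAt_iff_contDiffAt]
  refine ContMDiffAt.comp (I' := 𝓘(ℂ)) _ ?_ (P.contMDiffAt_z_symm ((P.z α).map_source hx))
  rwa [(P.z α).left_inv hx]

lemma contMDiffAt_comp_z {α : ι} {x : C} (hx : x ∈ P.U α) {f : ℂ → F}
    (hf : AnalyticAt ℂ f (P.z α x)) : ContMDiffAt 𝓘(ℂ) 𝓘(ℂ, F) ω (f ∘ P.z α) x :=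
  ContMDiffAt.comp (I' := 𝓘(ℂ)) x (hf.contDiffAt.contMDiffAt) (P.contMDiffAt_z hx)

lemma mvfderiv_comp_z {α : ι} {x : C} (hx : x ∈ P.U α) {f : ℂ → F}
    (hf : DifferentiableAt ℂ f (P.z α x)) (v : TangentSpace 𝓘(ℂ) x) :
    mvfderiv 𝓘(ℂ) (f ∘ P.z α) x v = P.dz α x v • deriv f (P.z α x) := by
  have h := mfderiv_comp_apply (I := 𝓘(ℂ)) (I' := 𝓘(ℂ)) (I'' := 𝓘(ℂ, F)) x
    hf.mdifferentiableAt (P.mdifferentiableAt_z hx) v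
  rw [mfderiv_eq_fderiv] at h
  have h2 : fderiv ℂ f (P.z α x) (P.dz α x v) = P.dz α x v • deriv f (P.z α x) := by
    conv_lhs => rw [← mul_one (P.dz α x v)]
    rw [← smul_eq_mul]
    erw [map_smul]
    rw [fderiv_apply_one_eq_deriv]
  exact h.trans h2

/-- The derivative of a function in terms of the coordinate `z_α`. -/
lemma mvfderiv_eq_dz_smul {α : ι} {x : C} (hx : x ∈ P.U α) {f : C → F}
    (hf : MDifferentiableAt 𝓘(ℂ) 𝓘(ℂ, F) f x) (v : TangentSpace 𝓘(ℂ) x) :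
    mvfderiv 𝓘(ℂ) f x v = P.dz α x v • deriv (f ∘ (P.z α).symm) (P.z α x) := by
  rw [← P.mvfderiv_comp_z hx (P.differentiableAt_comp_symm hx hf)]
  have := (P.eventually_comp_symm_comp hx f).mfderiv_eq (I := 𝓘(ℂ)) (I' := 𝓘(ℂ, F))
  rw [mvfderiv, mvfderiv, this]
  rfl

end Chart

/-- Supplies the coordinate vector `∂/∂z_α`, on which linear maps on the tangent line are tested. -/
lemma exists_dz_eq_one {α : ι} {x : C} (hx : x ∈ P.U α) :
    ∃ v₀ : TangentSpace 𝓘(ℂ) x, P.dz α x v₀ = 1 ∧ ∀ v, v = P.dz α x v • v₀ := by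
  have hd : (P.z α).MDifferentiable 𝓘(ℂ) 𝓘(ℂ) :=
    ⟨(contMDiffOn_of_mem_maximalAtlas (P.holomorphic α)).mdifferentiableOn (by simp),
      (contMDiffOn_symm_of_mem_maximalAtlas (P.holomorphic α)).mdifferentiableOn (by simp)⟩
  have hbij : Function.Bijective (P.dz α x) := hd.mfderiv_bijective hx
  obtain ⟨v₀, hv₀⟩ := hbij.2 1
  refine ⟨v₀, hv₀, fun v ↦ hbij.1 ?_⟩
  rw [map_smul, hv₀]
  exact (mul_one _).symm

end ProjectiveCoordinateSystem

end Oper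
end

noncomputable section

set_option linter.unusedSectionVars false

namespace Oper

/-! ### Coordinates in bundles given by cocycles -/

section Coords

variable {C : Type*} [TopologicalSpace C] {ι : Type*}
  {F : Type*} [NormedAddCommGroup F] [NormedSpace ℂ F] (Z : VectorBundleCore ℂ C F ι)

/-- The coordinates in the local frame with index `α`, as an isomorphism. -/
def coordsEquiv (α : ι) {x : C} (hx : x ∈ Z.baseSet α) : Z.Fiber x ≃L[ℂ] F :=
  (Z.localTriv α).continuousLinearEquivAt ℂ x hx

lemma coords_symm_apply {α : ι} {x : C} (hx : x ∈ Z.baseSet α) (v : F) :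
    coords Z α ((coordsEquiv Z α hx).symm v) = v :=
  (coordsEquiv Z α hx).apply_symm_apply v

lemma coords_injective {α : ι} {x : C} (hx : x ∈ Z.baseSet α) :
    Function.Injective (coords Z α : Z.Fiber x → F) :=
  (coordsEquiv Z α hx).injective

lemma coords_add {α : ι} {x : C} (hx : x ∈ Z.baseSet α) (v w : Z.Fiber x) :
    coords Z α (v + w) = coords Z α v + coords Z α w := (coordsEquiv Z α hx).map_add v w

lemma coords_smul {α : ι} {x : C} (hx : x ∈ Z.baseSet α) (c : ℂ) (v : Z.Fiber x) :
    coords Z α (c • v) = c • coords Z α v := (coordsEquiv Z α hx).map_smul c v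

lemma coords_zero {α : ι} {x : C} (hx : x ∈ Z.baseSet α) : coords Z α (0 : Z.Fiber x) = 0 :=
  (coordsEquiv Z α hx).map_zero

lemma coordChange_coords {α β : ι} {x : C} (hα : x ∈ Z.baseSet α) (hβ : x ∈ Z.baseSet β)
    (v : Z.Fiber x) : Z.coordChange β α x (coords Z β v) = coords Z α v :=
  Z.coordChange_comp _ _ _ x ⟨⟨Z.mem_baseSet_at x, hβ⟩, hα⟩ v

instance (α : ι) : MemTrivializationAtlas (Z.localTriv α) := ⟨⟨α, rfl⟩⟩

section Holomorphic

variable [ChartedSpace ℂ C]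

lemma mdifferentiableAt_section_iff_coords [Z.IsContMDiff 𝓘(ℂ) ω] {α : ι} {x : C}
    (hx : x ∈ Z.baseSet α) (s : Π x, Z.Fiber x) :
    MDifferentiableAt 𝓘(ℂ) (𝓘(ℂ).prod 𝓘(ℂ, F)) (fun y ↦ TotalSpace.mk' F y (s y)) x ↔
      MDifferentiableAt 𝓘(ℂ) 𝓘(ℂ, F) (fun y ↦ coords Z α (s y)) x := by
  have : Z.IsContMDiff 𝓘(ℂ) 1 :=
    ⟨fun i j ↦ (Z.contMDiffOn_coordChange (n := ω) 𝓘(ℂ) i j).of_le le_top⟩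
  exact (Z.localTriv α).mdifferentiableAt_section_iff 𝓘(ℂ) s hx

lemma contMDiffAt_section_iff_coords [Z.IsContMDiff 𝓘(ℂ) ω] {α : ι} {x : C}
    (hx : x ∈ Z.baseSet α) (s : Π x, Z.Fiber x) :
    ContMDiffAt 𝓘(ℂ) (𝓘(ℂ).prod 𝓘(ℂ, F)) ω (fun y ↦ TotalSpace.mk' F y (s y)) x ↔
      ContMDiffAt 𝓘(ℂ) 𝓘(ℂ, F) ω (fun y ↦ coords Z α (s y)) x :=
  (Z.localTriv α).contMDiffAt_section_iff hx

end Holomorphic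

end Coords

section SectionAt

variable {C : Type*} [TopologicalSpace C] [ChartedSpace ℂ C]
  {F : Type*} [NormedAddCommGroup F] [NormedSpace ℂ F]
  {E : C → Type*} [TopologicalSpace (TotalSpace F E)]
  [∀ x, AddCommGroup (E x)] [∀ x, Module ℂ (E x)] [∀ x, TopologicalSpace (E x)]
  [FiberBundle F E]

lemma isHolomorphicSection_iff {U : Set C} (hU : IsOpen U) {s : Π x, E x} :
    IsHolomorphicSection F U s ↔ ∀ x ∈ U,
      ContMDiffAt 𝓘(ℂ) (𝓘(ℂ).prod 𝓘(ℂ, F)) ω (fun x ↦ TotalSpace.mk' F x (s x)) x :=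
  ⟨fun h x hx ↦ (h x hx).contMDiffAt (hU.mem_nhds hx), fun h x hx ↦ (h x hx).contMDiffWithinAt⟩

end SectionAt

/-! ### The bundles defined by the cocycles `ξ`, `f` and `g` -/

/-- The linear map `v ↦ M v`. -/
def mulVecCLM : (Fin 2 → Fin 2 → ℂ) →L[ℂ] ((Fin 2 → ℂ) →L[ℂ] (Fin 2 → ℂ)) :=
  LinearMap.toContinuousLinearMap
    { toFun := fun M ↦ LinearMap.toContinuousLinearMap (Matrix.mulVecLin (Matrix.of M))
      map_add' := fun M N ↦ by
        ext v : 1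
        exact Matrix.add_mulVec (Matrix.of M) (Matrix.of N) v
      map_smul' := fun c M ↦ by
        ext v : 1
        exact Matrix.smul_mulVec c (Matrix.of M) v }

lemma mulVecCLM_apply (M : Matrix (Fin 2) (Fin 2) ℂ) (v : Fin 2 → ℂ) :
    mulVecCLM M v = M *ᵥ v := rfl

lemma contMDiffAt_mulVecCLM {C : Type*} [TopologicalSpace C] [ChartedSpace ℂ C]
    {M : C → Matrix (Fin 2) (Fin 2) ℂ} {x : C}
    (h : ∀ i j, ContMDiffAt 𝓘(ℂ) 𝓘(ℂ) ω (fun x ↦ M x i j) x) :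
    ContMDiffAt 𝓘(ℂ) 𝓘(ℂ, (Fin 2 → ℂ) →L[ℂ] (Fin 2 → ℂ)) ω (fun x ↦ mulVecCLM (M x)) x := by
  have h' : ContMDiffAt 𝓘(ℂ) 𝓘(ℂ, Fin 2 → Fin 2 → ℂ) ω (fun x i j ↦ M x i j) x :=
    contMDiffAt_pi_space.2 fun i ↦ contMDiffAt_pi_space.2 fun j ↦ h i j
  exact mulVecCLM.contMDiff.contMDiffAt.comp x h'

namespace ProjectiveCoordinateSystem

variable {C : Type*} [TopologicalSpace C] [ChartedSpace ℂ C] [IsManifold 𝓘(ℂ) ω C] {ι : Type*}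
  (P : ProjectiveCoordinateSystem C ι)

/-- The vector bundle with transition functions `h`. -/
def core {F : Type*} [NormedAddCommGroup F] [NormedSpace ℂ F] (h : ι → ι → C → F →L[ℂ] F)
    (h_self : ∀ α, ∀ x ∈ P.U α, ∀ v, h α α x v = v)
    (h_comp : ∀ α β γ, ∀ x, x ∈ P.U α → x ∈ P.U β → x ∈ P.U γ → ∀ v,
      h α β x (h β γ x v) = h α γ x v)
    (h_holo : ∀ α β, ∀ x, x ∈ P.U α → x ∈ P.U β →
      ContMDiffAt 𝓘(ℂ) 𝓘(ℂ, F →L[ℂ] F) ω (h α β) x) : VectorBundleCore ℂ C F ι where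
  baseSet := P.U
  isOpen_baseSet := P.isOpen_U
  indexAt x := (P.cover x).choose
  mem_baseSet_at x := (P.cover x).choose_spec
  coordChange α β := h β α
  coordChange_self := h_self
  continuousOn_coordChange α β x hx := (h_holo β α x hx.2 hx.1).continuousAt.continuousWithinAt
  coordChange_comp α β γ x hx v := h_comp γ β α x hx.2 hx.1.2 hx.1.1 v

lemma isDefinedBy_core {F : Type*} [NormedAddCommGroup F] [NormedSpace ℂ F]
    (h : ι → ι → C → F →L[ℂ] F) (h_self h_comp h_holo) :
    P.IsDefinedBy (P.core h h_self h_comp h_holo) (fun α β x v ↦ h α β x v) where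
  baseSet_eq := rfl
  coordChange_eq _ _ _ _ _ := rfl
  holomorphic := ⟨fun α β x hx ↦ (h_holo β α x hx.2 hx.1).contMDiffWithinAt⟩

lemma contMDiffAt_xi {α β : ι} {x : C} (hβ : x ∈ P.U β) :
    ContMDiffAt 𝓘(ℂ) 𝓘(ℂ) ω (P.xi α β) x :=
  (contMDiffAt_const.mul (P.contMDiffAt_z hβ)).add contMDiffAt_const

/-- The matrix relating the flat frame over `U_α` with the frame of `E`. -/
def flatMatrix (α : ι) (x : C) : Matrix (Fin 2) (Fin 2) ℂ := !![0, 1; -1, P.z α x]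

/-- The inverse of `P.flatMatrix α x`. -/
def flatMatrixInv (α : ι) (x : C) : Matrix (Fin 2) (Fin 2) ℂ := !![P.z α x, -1; 1, 0]

lemma flatMatrix_mul_inv (α : ι) (x : C) : P.flatMatrix α x * P.flatMatrixInv α x = 1 := by
  ext i j
  fin_cases i <;> fin_cases j <;> simp [flatMatrix, flatMatrixInv]

lemma flatMatrixInv_mul (α : ι) (x : C) : P.flatMatrixInv α x * P.flatMatrix α x = 1 := by
  ext i j
  fin_cases i <;> fin_cases j <;> simp [flatMatrix, flatMatrixInv]

/-- The gauge identity between the constant cocycle `f` and the cocycle `g`, an entrywise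
consequence of the Möbius relation and `det f = 1`. The cocycle properties of `g` and `ξ` and the
isomorphism of the flat bundle with `E` all rest on it. -/
lemma flatMatrix_mul_f {α β : ι} {x : C} (hα : x ∈ P.U α) (hβ : x ∈ P.U β) :
    P.flatMatrix α x * P.f α β = P.g α β x * P.flatMatrix β x := by
  have h1 := P.xi_mul_z hα hβ
  have h2 := P.xi_ne_zero hα hβ
  have h3 := sl2_det (P.f α β)
  have h4 : P.xi α β x = P.f α β 1 0 * P.z β x + P.f α β 1 1 := rfl
  have h5 : P.z α x = (P.xi α β x)⁻¹ * (P.f α β 0 0 * P.z β x + P.f α β 0 1) := by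
    rw [← h1, inv_mul_cancel_left₀ h2]
  ext i j
  fin_cases i <;> fin_cases j <;> simp [flatMatrix, g, Matrix.mul_apply, Fin.sum_univ_two, h5]
  · linear_combination -h4
  · field_simp
    linear_combination -(P.f α β 0 0 * h4) - h3
  · field_simp
    linear_combination -(P.f α β 0 1 * h4) + P.z β x * h3

lemma g_eq {α β : ι} {x : C} (hα : x ∈ P.U α) (hβ : x ∈ P.U β) :
    P.g α β x = P.flatMatrix α x * P.f α β * P.flatMatrixInv β x := by
  rw [P.flatMatrix_mul_f hα hβ, mul_assoc, flatMatrix_mul_inv, mul_one]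

lemma g_self {α : ι} {x : C} (hα : x ∈ P.U α) : P.g α α x = 1 := by
  rw [P.g_eq hα hα, P.f_self hα, Matrix.SpecialLinearGroup.coe_one, mul_one, flatMatrix_mul_inv]

lemma g_mul_g {α β γ : ι} {x : C} (hα : x ∈ P.U α) (hβ : x ∈ P.U β) (hγ : x ∈ P.U γ) :
    P.g α β x * P.g β γ x = P.g α γ x := by
  rw [P.g_eq hα hβ, P.g_eq hβ hγ, P.g_eq hα hγ, ← P.f_mul_f hα hβ hγ,
    Matrix.SpecialLinearGroup.coe_mul]
  simp only [mul_assoc]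
  rw [← mul_assoc (P.flatMatrixInv β x), flatMatrixInv_mul, one_mul]

lemma xi_self {α : ι} {x : C} (hα : x ∈ P.U α) : P.xi α α x = 1 := by
  simpa [g] using congrFun (congrFun (P.g_self hα) 0) 0

lemma xi_mul_xi {α β γ : ι} {x : C} (hα : x ∈ P.U α) (hβ : x ∈ P.U β) (hγ : x ∈ P.U γ) :
    P.xi α β x * P.xi β γ x = P.xi α γ x := by
  simpa [g, Matrix.mul_apply, Fin.sum_univ_two] using congrFun (congrFun (P.g_mul_g hα hβ hγ) 0) 0

/-- The theta characteristic `K^{1/2}`. -/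
def thetaCore : VectorBundleCore ℂ C ℂ ι :=
  P.core (fun α β x ↦ P.xi α β x • ContinuousLinearMap.id ℂ ℂ)
    (fun α x hx v ↦ by simp [P.xi_self hx])
    (fun α β γ x hα hβ hγ v ↦ by simp [← P.xi_mul_xi hα hβ hγ, mul_assoc])
    (fun α β x _ hβ ↦ (P.contMDiffAt_xi hβ).smul contMDiffAt_const)

/-- The rank `2` bundle `E`. -/
def operCore : VectorBundleCore ℂ C (Fin 2 → ℂ) ι :=
  P.core (fun α β x ↦ mulVecCLM (P.g α β x))
    (fun α x hx v ↦ by rw [mulVecCLM_apply, P.g_self hx, Matrix.one_mulVec])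
    (fun α β γ x hα hβ hγ v ↦ by
      simp only [mulVecCLM_apply, Matrix.mulVec_mulVec, P.g_mul_g hα hβ hγ])
    (fun α β x hα hβ ↦ by
      refine contMDiffAt_mulVecCLM fun i j ↦ ?_
      have h := P.contMDiffAt_xi (α := α) hβ
      fin_cases i <;> fin_cases j
      · exact h
      · exact contMDiffAt_const
      · exact contMDiffAt_const
      · exact h.inv₀ (P.xi_ne_zero hα hβ))

/-- The flat bundle with transition functions `f`. -/
def flatCore : VectorBundleCore ℂ C (Fin 2 → ℂ) ι :=
  P.core (fun α β _ ↦ mulVecCLM (P.f α β : Matrix (Fin 2) (Fin 2) ℂ))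
    (fun α x hx v ↦ by
      rw [mulVecCLM_apply, P.f_self hx, Matrix.SpecialLinearGroup.coe_one, Matrix.one_mulVec])
    (fun α β γ x hα hβ hγ v ↦ by
      simp only [mulVecCLM_apply, Matrix.mulVec_mulVec, ← Matrix.SpecialLinearGroup.coe_mul,
        P.f_mul_f hα hβ hγ])
    (fun α β x _ _ ↦ contMDiffAt_const)

lemma thetaCore_isDefinedBy : P.IsDefinedBy P.thetaCore (fun α β x v ↦ P.xi α β x * v) :=
  P.isDefinedBy_core _ _ _ _

lemma operCore_isDefinedBy : P.IsDefinedBy P.operCore (fun α β x v ↦ P.g α β x *ᵥ v) :=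
  P.isDefinedBy_core _ _ _ _

lemma flatCore_isDefinedBy :
    P.IsDefinedBy P.flatCore (fun α β _ v ↦ (P.f α β : Matrix (Fin 2) (Fin 2) ℂ) *ᵥ v) :=
  P.isDefinedBy_core _ _ _ _

instance : P.thetaCore.IsContMDiff 𝓘(ℂ) ω := P.thetaCore_isDefinedBy.holomorphic

instance : P.operCore.IsContMDiff 𝓘(ℂ) ω := P.operCore_isDefinedBy.holomorphic

instance : P.flatCore.IsContMDiff 𝓘(ℂ) ω := P.flatCore_isDefinedBy.holomorphic

/-- The local frame of `K^{1/2}` over `U_α`. -/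
def thetaFrame {α : ι} {x : C} (hx : x ∈ P.U α) : ℂ ≃L[ℂ] P.thetaCore.Fiber x :=
  (coordsEquiv P.thetaCore α hx).symm

/-- The local frame of `E` over `U_α`. -/
def operFrame {α : ι} {x : C} (hx : x ∈ P.U α) : (Fin 2 → ℂ) ≃L[ℂ] P.operCore.Fiber x :=
  (coordsEquiv P.operCore α hx).symm

lemma coords_thetaFrame {α : ι} {x : C} (hx : x ∈ P.U α) (c : ℂ) :
    coords P.thetaCore α (P.thetaFrame hx c) = c := coords_symm_apply P.thetaCore hx c

lemma coords_operFrame {α : ι} {x : C} (hx : x ∈ P.U α) (c : Fin 2 → ℂ) :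
    coords P.operCore α (P.operFrame hx c) = c := coords_symm_apply P.operCore hx c

lemma coords_thetaCore {α β : ι} {x : C} (hα : x ∈ P.U α) (hβ : x ∈ P.U β)
    (v : P.thetaCore.Fiber x) :
    coords P.thetaCore α v = P.xi α β x * coords P.thetaCore β v :=
  (coordChange_coords P.thetaCore hα hβ v).symm

lemma coords_operCore {α β : ι} {x : C} (hα : x ∈ P.U α) (hβ : x ∈ P.U β)
    (v : P.operCore.Fiber x) :
    coords P.operCore α v = P.g α β x *ᵥ coords P.operCore β v :=
  (coordChange_coords P.operCore hα hβ v).symm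

lemma coords_flatCore {α β : ι} {x : C} (hα : x ∈ P.U α) (hβ : x ∈ P.U β)
    (v : P.flatCore.Fiber x) :
    coords P.flatCore α v = (P.f α β : Matrix (Fin 2) (Fin 2) ℂ) *ᵥ coords P.flatCore β v :=
  (coordChange_coords P.flatCore hα hβ v).symm

end ProjectiveCoordinateSystem

end Oper
end

noncomputable section

set_option linter.unusedSectionVars false

namespace Oper

/-! ### Derivatives of vector-valued functions on the surface -/

section Mvfderiv

variable {C : Type*} [TopologicalSpace C] [ChartedSpace ℂ C]
  {F : Type*} [NormedAddCommGroup F] [NormedSpace ℂ F]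
  {F' : Type*} [NormedAddCommGroup F'] [NormedSpace ℂ F']

lemma mvfderiv_congr {f f' : C → F} {x : C} (h : f =ᶠ[𝓝 x] f') :
    mvfderiv 𝓘(ℂ) f x = mvfderiv 𝓘(ℂ) f' x := by
  rw [mvfderiv, mvfderiv, h.mfderiv_eq]
  rfl

lemma mvfderiv_clm_comp (L : F →L[ℂ] F') {f : C → F} {x : C}
    (hf : MDifferentiableAt 𝓘(ℂ) 𝓘(ℂ, F) f x) (v : TangentSpace 𝓘(ℂ) x) :
    mvfderiv 𝓘(ℂ) (fun y ↦ L (f y)) x v = L (mvfderiv 𝓘(ℂ) f x v) := by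
  have h := mfderiv_comp_apply (I := 𝓘(ℂ)) (I' := 𝓘(ℂ, F)) (I'' := 𝓘(ℂ, F')) x
    L.differentiableAt.mdifferentiableAt hf v
  rw [mfderiv_eq_fderiv, L.fderiv] at h
  exact h

lemma mvfderiv_apply {f : C → Fin 2 → ℂ} {x : C}
    (hf : MDifferentiableAt 𝓘(ℂ) 𝓘(ℂ, Fin 2 → ℂ) f x) (v : TangentSpace 𝓘(ℂ) x) (i : Fin 2) :
    mvfderiv 𝓘(ℂ) (fun y ↦ f y i) x v = mvfderiv 𝓘(ℂ) f x v i :=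
  mvfderiv_clm_comp (ContinuousLinearMap.proj (R := ℂ) (φ := fun _ : Fin 2 ↦ ℂ) i) hf v

lemma mdifferentiableAt_pi {f : C → Fin 2 → ℂ} {x : C} :
    MDifferentiableAt 𝓘(ℂ) 𝓘(ℂ, Fin 2 → ℂ) f x ↔
      ∀ i, MDifferentiableAt 𝓘(ℂ) 𝓘(ℂ) (fun y ↦ f y i) x := by
  constructor
  · intro h i
    exact ((ContinuousLinearMap.proj (R := ℂ) (φ := fun _ : Fin 2 ↦ ℂ)
      i).differentiableAt.mdifferentiableAt).comp x h
  · intro h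
    have h1 : f = (fun y ↦ f y 0 • ![(1 : ℂ), 0]) + fun y ↦ f y 1 • ![(0 : ℂ), 1] := by
      ext y i
      fin_cases i <;> simp
    rw [h1]
    exact ((h 0).smul mdifferentiableAt_const).add ((h 1).smul mdifferentiableAt_const)

end Mvfderiv

namespace ProjectiveCoordinateSystem

variable {C : Type*} [TopologicalSpace C] [ChartedSpace ℂ C] [IsManifold 𝓘(ℂ) ω C] {ι : Type*}
  (P : ProjectiveCoordinateSystem C ι)

/-! ### The flat connection -/

/-- A preferred index `α` with `x ∈ U_α`. -/
def index (x : C) : ι := (P.cover x).choose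

lemma mem_index (x : C) : x ∈ P.U (P.index x) := (P.cover x).choose_spec

/-- The covariant derivative `d` in the flat frames. -/
def flatDeriv (s : Π x, P.flatCore.Fiber x) (x : C) :
    TangentSpace 𝓘(ℂ) x →L[ℂ] P.flatCore.Fiber x :=
  (coordsEquiv P.flatCore (P.index x) (P.mem_index x)).symm.toContinuousLinearMap ∘L
    mvfderiv 𝓘(ℂ) (fun y ↦ coords P.flatCore (P.index x) (s y)) x

/-- The pointwise choice of frame in `flatDeriv` is immaterial, because the transition matrices are
constant and commute with differentiation. -/
lemma coords_flatDeriv {α : ι} {x : C} (hx : x ∈ P.U α) {s : Π x, P.flatCore.Fiber x}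
    (hs : MDifferentiableAt 𝓘(ℂ) (𝓘(ℂ).prod 𝓘(ℂ, Fin 2 → ℂ))
      (fun y ↦ TotalSpace.mk' (Fin 2 → ℂ) y (s y)) x) (v : TangentSpace 𝓘(ℂ) x) :
    coords P.flatCore α (P.flatDeriv s x v) =
      mvfderiv 𝓘(ℂ) (fun y ↦ coords P.flatCore α (s y)) x v := by
  have hi := P.mem_index x
  have h1 : (fun y ↦ coords P.flatCore α (s y)) =ᶠ[𝓝 x] fun y ↦
      mulVecCLM (P.f α (P.index x) : Matrix (Fin 2) (Fin 2) ℂ)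
        (coords P.flatCore (P.index x) (s y)) := by
    filter_upwards [(P.isOpen_U _).mem_nhds hx, (P.isOpen_U _).mem_nhds hi] with y hy hy'
    exact P.coords_flatCore hy hy' (s y)
  rw [mvfderiv_congr h1,
    mvfderiv_clm_comp _ ((mdifferentiableAt_section_iff_coords P.flatCore hi s).1 hs),
    P.coords_flatCore hx hi]
  exact congrArg _ (coords_symm_apply P.flatCore hi _)

/-- The flat connection on the bundle with transition functions `f`. -/
def flatConnection : CovariantDerivative 𝓘(ℂ) (Fin 2 → ℂ) P.flatCore.Fiber where
  toFun := P.flatDeriv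
  isCovariantDerivativeOnUniv :=
    { add := by
        intro s t x hs ht _
        refine ContinuousLinearMap.ext fun v ↦ ?_
        have hx := P.mem_index x
        have hs' := (mdifferentiableAt_section_iff_coords P.flatCore hx s).1 hs
        have ht' := (mdifferentiableAt_section_iff_coords P.flatCore hx t).1 ht
        have h1 : (fun y ↦ coords P.flatCore (P.index x) ((s + t) y)) =ᶠ[𝓝 x]
            (fun y ↦ coords P.flatCore (P.index x) (s y)) +
              fun y ↦ coords P.flatCore (P.index x) (t y) := by
          filter_upwards [(P.isOpen_U _).mem_nhds hx] with y hy
          exact coords_add P.flatCore hy _ _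
        have hst : MDifferentiableAt 𝓘(ℂ) (𝓘(ℂ).prod 𝓘(ℂ, Fin 2 → ℂ))
            (fun y ↦ TotalSpace.mk' (Fin 2 → ℂ) y ((s + t) y)) x :=
          (mdifferentiableAt_section_iff_coords P.flatCore hx _).2
            ((hs'.add ht').congr_of_eventuallyEq h1)
        apply coords_injective P.flatCore hx
        rw [P.coords_flatDeriv hx hst, mvfderiv_congr h1, mvfderiv_add hs' ht',
          add_apply, add_apply, coords_add P.flatCore hx,
          P.coords_flatDeriv hx hs, P.coords_flatDeriv hx ht]
      leibniz := by
        intro s g x hs hg _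
        refine ContinuousLinearMap.ext fun v ↦ ?_
        have hx := P.mem_index x
        have hs' := (mdifferentiableAt_section_iff_coords P.flatCore hx s).1 hs
        have h1 : (fun y ↦ coords P.flatCore (P.index x) ((g • s) y)) =ᶠ[𝓝 x]
            g • (fun y ↦ coords P.flatCore (P.index x) (s y)) := by
          filter_upwards [(P.isOpen_U _).mem_nhds hx] with y hy
          exact coords_smul P.flatCore hy _ _
        have hgs : MDifferentiableAt 𝓘(ℂ) (𝓘(ℂ).prod 𝓘(ℂ, Fin 2 → ℂ))
            (fun y ↦ TotalSpace.mk' (Fin 2 → ℂ) y ((g • s) y)) x :=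
          (mdifferentiableAt_section_iff_coords P.flatCore hx _).2
            ((hg.smul hs').congr_of_eventuallyEq h1)
        apply coords_injective P.flatCore hx
        rw [P.coords_flatDeriv hx hgs, mvfderiv_congr h1, mvfderiv_smul hg hs',
          add_apply, add_apply, coords_add P.flatCore hx,
          smul_apply, smul_apply,
          coords_smul P.flatCore hx, P.coords_flatDeriv hx hs,
          ContinuousLinearMap.smulRight_apply, ContinuousLinearMap.smulRight_apply,
          coords_smul P.flatCore hx] }

lemma flatConnection_apply (s : Π x, P.flatCore.Fiber x) (x : C) :
    P.flatConnection s x = P.flatDeriv s x := rfl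

lemma hasConnectionMatrix_flatConnection :
    P.HasConnectionMatrix P.flatCore P.flatConnection (fun _ _ _ ↦ 0) := by
  intro α x hx s hs v
  rw [Matrix.zero_mulVec, add_zero, flatConnection_apply, P.coords_flatDeriv hx hs]

/-! ### The isomorphism of the flat bundle with `E` -/

/-- The isomorphism `Φ` given by the matrices `P.flatMatrix α x`. -/
def flatIso (x : C) : P.flatCore.Fiber x ≃L[ℂ] P.operCore.Fiber x :=
  ((coordsEquiv P.flatCore (P.index x) (P.mem_index x)).trans
    (Matrix.toLin'OfInv (P.flatMatrixInv_mul (P.index x) x)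
      (P.flatMatrix_mul_inv (P.index x) x)).toContinuousLinearEquiv).trans
    (coordsEquiv P.operCore (P.index x) (P.mem_index x)).symm

lemma coords_flatIso {α : ι} {x : C} (hx : x ∈ P.U α) (v : P.flatCore.Fiber x) :
    coords P.operCore α (P.flatIso x v) = P.flatMatrix α x *ᵥ coords P.flatCore α v := by
  have hi := P.mem_index x
  have h1 : coords P.operCore (P.index x) (P.flatIso x v) =
      P.flatMatrix (P.index x) x *ᵥ coords P.flatCore (P.index x) v := by
    exact coords_symm_apply P.operCore hi _
  rw [P.coords_operCore hx hi, h1, P.coords_flatCore hx hi, Matrix.mulVec_mulVec,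
    Matrix.mulVec_mulVec, P.flatMatrix_mul_f hx hi]

lemma coords_flatIso_symm {α : ι} {x : C} (hx : x ∈ P.U α) (e : P.operCore.Fiber x) :
    coords P.flatCore α ((P.flatIso x).symm e) =
      ![P.z α x * coords P.operCore α e 0 - coords P.operCore α e 1, coords P.operCore α e 0] := by
  obtain ⟨v, rfl⟩ := (P.flatIso x).surjective e
  rw [ContinuousLinearEquiv.symm_apply_apply, P.coords_flatIso hx]
  ext i
  fin_cases i <;> simp [flatMatrix, Matrix.mulVec, dotProduct, Fin.sum_univ_two]

lemma mdifferentiableAt_flatIso_symm {x : C} {s : Π x, P.operCore.Fiber x}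
    (hs : MDifferentiableAt 𝓘(ℂ) (𝓘(ℂ).prod 𝓘(ℂ, Fin 2 → ℂ))
      (fun y ↦ TotalSpace.mk' (Fin 2 → ℂ) y (s y)) x) :
    MDifferentiableAt 𝓘(ℂ) (𝓘(ℂ).prod 𝓘(ℂ, Fin 2 → ℂ))
      (fun y ↦ TotalSpace.mk' (Fin 2 → ℂ) y ((P.flatIso y).symm (s y))) x := by
  have hx := P.mem_index x
  rw [mdifferentiableAt_section_iff_coords P.flatCore hx]
  rw [mdifferentiableAt_section_iff_coords P.operCore hx, mdifferentiableAt_pi] at hs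
  have hz := P.mdifferentiableAt_z hx
  have h1 : (fun y ↦ coords P.flatCore (P.index x) ((P.flatIso y).symm (s y))) =ᶠ[𝓝 x] fun y ↦
      ![P.z (P.index x) y * coords P.operCore (P.index x) (s y) 0 -
        coords P.operCore (P.index x) (s y) 1, coords P.operCore (P.index x) (s y) 0] := by
    filter_upwards [(P.isOpen_U _).mem_nhds hx] with y hy
    exact P.coords_flatIso_symm hy (s y)
  refine MDifferentiableAt.congr_of_eventuallyEq (mdifferentiableAt_pi.2 fun i ↦ ?_) h1
  fin_cases i
  · exact (hz.mul (hs 0)).sub (hs 1)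
  · exact hs 0

lemma isHolomorphicHom_flatIso :
    IsHolomorphicHom (Fin 2 → ℂ) (Fin 2 → ℂ) (fun x ↦ (P.flatIso x).toLinearEquiv.toLinearMap) := by
  intro U s hU hs
  rw [isHolomorphicSection_iff hU] at hs ⊢
  intro x hxU
  have hx := P.mem_index x
  have h := (contMDiffAt_section_iff_coords P.flatCore hx s).1 (hs x hxU)
  rw [contMDiffAt_section_iff_coords P.operCore hx]
  rw [contMDiffAt_pi_space] at h
  have h1 : (fun y ↦ coords P.operCore (P.index x) (P.flatIso y (s y))) =ᶠ[𝓝 x] fun y ↦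
      P.flatMatrix (P.index x) y *ᵥ coords P.flatCore (P.index x) (s y) := by
    filter_upwards [(P.isOpen_U _).mem_nhds hx] with y hy
    exact P.coords_flatIso hy (s y)
  refine ContMDiffAt.congr_of_eventuallyEq (contMDiffAt_pi_space.2 fun i ↦ ?_) h1
  simp only [flatMatrix, Matrix.mulVec, dotProduct, Fin.sum_univ_two]
  fin_cases i
  · exact (contMDiffAt_const.mul (h 0)).add (contMDiffAt_const.mul (h 1))
  · exact (contMDiffAt_const.mul (h 0)).add ((P.contMDiffAt_z hx).mul (h 1))

/-! ### The connection on `E` -/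

/-- The connection on `E`. -/
def operConnection : CovariantDerivative 𝓘(ℂ) (Fin 2 → ℂ) P.operCore.Fiber where
  toFun s x := (P.flatIso x).toContinuousLinearMap ∘L
    P.flatConnection (fun y ↦ (P.flatIso y).symm (s y)) x
  isCovariantDerivativeOnUniv :=
    { add := by
        intro s t x hs ht _
        have h1 : (fun y ↦ (P.flatIso y).symm ((s + t) y)) =
            (fun y ↦ (P.flatIso y).symm (s y)) + fun y ↦ (P.flatIso y).symm (t y) := by
          ext y : 1
          exact map_add _ _ _
        rw [h1, P.flatConnection.isCovariantDerivativeOnUniv.add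
          (P.mdifferentiableAt_flatIso_symm hs) (P.mdifferentiableAt_flatIso_symm ht),
          ContinuousLinearMap.comp_add]
      leibniz := by
        intro s g x hs hg _
        have h1 : (fun y ↦ (P.flatIso y).symm ((g • s) y)) =
            g • fun y ↦ (P.flatIso y).symm (s y) := by
          ext y : 1
          exact (P.flatIso y).symm.map_smul _ _
        rw [h1, P.flatConnection.isCovariantDerivativeOnUniv.leibniz
          (P.mdifferentiableAt_flatIso_symm hs) hg]
        refine ContinuousLinearMap.ext fun v ↦ ?_
        simp }

lemma operConnection_apply (s : Π x, P.operCore.Fiber x) (x : C) (v : TangentSpace 𝓘(ℂ) x) :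
    P.operConnection s x v =
      P.flatIso x (P.flatConnection (fun y ↦ (P.flatIso y).symm (s y)) x v) := rfl

lemma operConnection_flatIso (s : Π x, P.flatCore.Fiber x) (x : C) (v : TangentSpace 𝓘(ℂ) x) :
    P.operConnection (fun y ↦ P.flatIso y (s y)) x v = P.flatIso x (P.flatConnection s x v) := by
  simp only [operConnection_apply, ContinuousLinearEquiv.symm_apply_apply]

/-- The correction term comes from differentiating the entry `z_α` of the inverse gauge matrix by
the product rule; it is `-dM_α M_α⁻¹` applied to the coordinates. -/
lemma coords_operConnection {α : ι} {x : C} (hx : x ∈ P.U α) {s : Π x, P.operCore.Fiber x}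
    (hs : MDifferentiableAt 𝓘(ℂ) (𝓘(ℂ).prod 𝓘(ℂ, Fin 2 → ℂ))
      (fun y ↦ TotalSpace.mk' (Fin 2 → ℂ) y (s y)) x) (v : TangentSpace 𝓘(ℂ) x) :
    coords P.operCore α (P.operConnection s x v) =
      mvfderiv 𝓘(ℂ) (fun y ↦ coords P.operCore α (s y)) x v -
        ![0, P.dz α x v * coords P.operCore α (s x) 0] := by
  have hs0 := P.mdifferentiableAt_flatIso_symm hs
  have hs1 := (mdifferentiableAt_section_iff_coords P.flatCore hx _).1 hs0
  have hs' := (mdifferentiableAt_section_iff_coords P.operCore hx _).1 hs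
  have hs2 := mdifferentiableAt_pi.1 hs'
  have hz := P.mdifferentiableAt_z hx
  have h1 : (fun y ↦ coords P.flatCore α ((P.flatIso y).symm (s y))) =ᶠ[𝓝 x] fun y ↦
      ![P.z α y * coords P.operCore α (s y) 0 - coords P.operCore α (s y) 1,
        coords P.operCore α (s y) 0] := by
    filter_upwards [(P.isOpen_U _).mem_nhds hx] with y hy
    exact P.coords_flatIso_symm hy (s y)
  have h2 := hs1.congr_of_eventuallyEq h1.symm
  have e0 : mvfderiv 𝓘(ℂ) (fun y ↦ P.z α y * coords P.operCore α (s y) 0 -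
      coords P.operCore α (s y) 1) x v =
      P.z α x * mvfderiv 𝓘(ℂ) (fun y ↦ coords P.operCore α (s y)) x v 0 +
        coords P.operCore α (s x) 0 * P.dz α x v -
        mvfderiv 𝓘(ℂ) (fun y ↦ coords P.operCore α (s y)) x v 1 := by
    have hm : MDifferentiableAt 𝓘(ℂ) 𝓘(ℂ)
        (fun y ↦ P.z α y * coords P.operCore α (s y) 0) x := hz.mul (hs2 0)
    rw [mvfderiv_fun_sub hm (hs2 1), mvfderiv_fun_mul hz (hs2 0)]
    simp only [sub_apply, add_apply,
      smul_apply, mvfderiv_apply hs', smul_eq_mul, dz]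
  have e1 := mvfderiv_apply hs' v 0
  rw [operConnection_apply, P.coords_flatIso hx, flatConnection_apply, P.coords_flatDeriv hx hs0,
    mvfderiv_congr h1]
  have f0 := mvfderiv_apply h2 v 0
  have f1 := mvfderiv_apply h2 v 1
  simp only [Matrix.cons_val_zero, Matrix.cons_val_one] at f0 f1
  rw [e0] at f0
  rw [e1] at f1
  ext i
  fin_cases i
  · simp [flatMatrix, Matrix.mulVec, dotProduct, Fin.sum_univ_two, ← f1]
  · simp [flatMatrix, Matrix.mulVec, dotProduct, Fin.sum_univ_two, ← f0, ← f1]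
    ring

lemma hasConnectionMatrix_operConnection :
    P.HasConnectionMatrix P.operCore P.operConnection (fun α x v ↦ -(P.dz α x v • Xminus)) := by
  intro α x hx s hs v
  rw [P.coords_operConnection hx hs, sub_eq_add_neg]
  congr 1
  ext i
  fin_cases i <;> simp [Xminus, Matrix.mulVec, dotProduct, Fin.sum_univ_two]

end ProjectiveCoordinateSystem

end Oper
end

noncomputable section

set_option linter.unusedSectionVars false

namespace Oper

namespace ProjectiveCoordinateSystem

variable {C : Type*} [TopologicalSpace C] [ChartedSpace ℂ C] [IsManifold 𝓘(ℂ) ω C] {ι : Type*}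
  (P : ProjectiveCoordinateSystem C ι)

/-! ### The theta characteristic -/

/-- A Möbius map of determinant one has derivative `(c z + d)⁻²`. -/
lemma dz_eq {α β : ι} {x : C} (hα : x ∈ P.U α) (hβ : x ∈ P.U β) :
    P.dz β x = P.xi α β x ^ 2 • P.dz α x := by
  refine ContinuousLinearMap.ext fun v ↦ ?_
  have hξ := P.xi_ne_zero hα hβ
  have h3 := sl2_det (P.f α β)
  have h1 : P.z α =ᶠ[𝓝 x] (fun w ↦ (P.f α β 0 0 * w + P.f α β 0 1) /
      (P.f α β 1 0 * w + P.f α β 1 1)) ∘ P.z β := by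
    filter_upwards [(P.isOpen_U _).mem_nhds hα, (P.isOpen_U _).mem_nhds hβ] with y hy hy'
    exact (P.mobius α β y ⟨hy, hy'⟩).2
  have hd : HasDerivAt (fun w ↦ (P.f α β 0 0 * w + P.f α β 0 1) /
      (P.f α β 1 0 * w + P.f α β 1 1)) ((P.xi α β x ^ 2)⁻¹) (P.z β x) := by
    have h := (((hasDerivAt_id (P.z β x)).const_mul (P.f α β 0 0)).add_const (P.f α β 0 1)).div
      (((hasDerivAt_id (P.z β x)).const_mul (P.f α β 1 0)).add_const (P.f α β 1 1)) hξ
    refine h.congr_deriv ?_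
    rw [xi] at hξ ⊢
    simp only [id]
    field_simp
    linear_combination h3
  have h2 := P.mvfderiv_comp_z hβ hd.differentiableAt v
  rw [← mvfderiv_congr h1, hd.deriv] at h2
  change P.dz β x v = P.xi α β x ^ 2 • mvfderiv 𝓘(ℂ) (P.z α) x v
  rw [h2, smul_eq_mul, smul_eq_mul]
  field_simp

/-- The bilinear map `(v, w) ↦ v_α w_α dz_α` on the fibres of `K^{1/2}`. -/
def thetaMul (x : C) : P.thetaCore.Fiber x →ₗ[ℂ] P.thetaCore.Fiber x →ₗ[ℂ] Canonical C x :=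
  LinearMap.mk₂ ℂ (fun v w ↦ (coords P.thetaCore (P.index x) v *
      coords P.thetaCore (P.index x) w) • P.dz (P.index x) x)
    (fun v v' w ↦ by
      rw [coords_add _ (P.mem_index x), add_mul]
      exact add_smul _ _ (P.dz (P.index x) x))
    (fun c v w ↦ by
      rw [coords_smul _ (P.mem_index x), smul_eq_mul, mul_assoc]
      exact mul_smul _ _ (P.dz (P.index x) x))
    (fun v w w' ↦ by
      rw [coords_add _ (P.mem_index x), mul_add]
      exact add_smul _ _ (P.dz (P.index x) x))
    (fun c v w ↦ by
      rw [coords_smul _ (P.mem_index x), smul_eq_mul, mul_left_comm]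
      exact mul_smul _ _ (P.dz (P.index x) x))

lemma thetaMul_apply {α : ι} {x : C} (hx : x ∈ P.U α) (v w : P.thetaCore.Fiber x) :
    P.thetaMul x v w = (coords P.thetaCore α v * coords P.thetaCore α w) • P.dz α x := by
  have hi := P.mem_index x
  rw [P.dz_eq hi hx, smul_smul]
  refine congrArg (fun c : ℂ ↦ c • P.dz (P.index x) x) ?_
  rw [P.coords_thetaCore hi hx, P.coords_thetaCore hi hx]
  ring

lemma contMDiffAt_dz {α : ι} {x : C} (hx : x ∈ P.U α) :
    ContMDiffAt 𝓘(ℂ) (𝓘(ℂ).prod 𝓘(ℂ, ℂ →L[ℂ] ℂ)) ω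
      (fun y ↦ TotalSpace.mk' (ℂ →L[ℂ] ℂ) (E := Canonical C) y (P.dz α y)) x :=
  contMDiffAt_mvfderiv (P.contMDiffAt_z hx)

lemma isThetaCharacteristic_thetaMul : IsThetaCharacteristic ℂ P.thetaMul := by
  refine ⟨fun U s t hU hs ht ↦ ?_, fun x ↦ ⟨?_, ?_⟩⟩
  · rw [isHolomorphicSection_iff hU] at hs ht ⊢
    intro x hxU
    have hx := P.mem_index x
    have hs' := (contMDiffAt_section_iff_coords P.thetaCore hx s).1 (hs x hxU)
    have ht' := (contMDiffAt_section_iff_coords P.thetaCore hx t).1 (ht x hxU)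
    have h := (hs'.mul ht').smul_section (P.contMDiffAt_dz hx)
    refine h.congr_of_eventuallyEq ?_
    filter_upwards [(P.isOpen_U _).mem_nhds hx] with y hy
    exact congrArg _ (P.thetaMul_apply hy (s y) (t y))
  · have hx := P.mem_index x
    let u := P.thetaFrame hx 1
    have hu : coords P.thetaCore (P.index x) u = 1 := P.coords_thetaFrame hx _
    -- The fibre is a line spanned by `u`, so every tensor is pure with second factor `u`.
    have hgen : ∀ t : TensorProduct ℂ (P.thetaCore.Fiber x) (P.thetaCore.Fiber x),
        ∃ v, t = TensorProduct.tmul ℂ v u := by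
      intro t
      induction t using TensorProduct.induction_on with
      | zero => exact ⟨0, (TensorProduct.zero_tmul _ _).symm⟩
      | tmul v w =>
        have hw : w = coords P.thetaCore (P.index x) w • u := by
          apply coords_injective P.thetaCore hx
          rw [coords_smul _ hx, hu, smul_eq_mul, mul_one]
        refine ⟨coords P.thetaCore (P.index x) w • v, ?_⟩
        rw [TensorProduct.smul_tmul, ← hw]
      | add a b ha hb =>
        obtain ⟨v, rfl⟩ := ha
        obtain ⟨w, rfl⟩ := hb
        exact ⟨v + w, (TensorProduct.add_tmul _ _ _).symm⟩
    rw [injective_iff_map_eq_zero]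
    intro t ht
    obtain ⟨v, rfl⟩ := hgen t
    rw [TensorProduct.lift.tmul, P.thetaMul_apply hx, hu, mul_one] at ht
    obtain ⟨v₀, hv₀, -⟩ := P.exists_dz_eq_one hx
    have h1 := congrArg (fun l : Canonical C x ↦ l v₀) ht
    have h2 : coords P.thetaCore (P.index x) v * P.dz (P.index x) x v₀ = 0 := h1
    rw [hv₀, mul_one] at h2
    have h3 : v = 0 := by
      apply coords_injective P.thetaCore hx
      rw [h2, coords_zero _ hx]
    rw [h3, TensorProduct.zero_tmul]
  · intro l
    have hx := P.mem_index x
    obtain ⟨v₀, hv₀, hv⟩ := P.exists_dz_eq_one hx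
    refine ⟨TensorProduct.tmul ℂ (P.thetaFrame hx (l v₀))
      (P.thetaFrame hx 1), ?_⟩
    rw [TensorProduct.lift.tmul, P.thetaMul_apply hx, P.coords_thetaFrame hx, P.coords_thetaFrame hx, mul_one]
    refine ContinuousLinearMap.ext fun v ↦ ?_
    conv_rhs => rw [hv v, map_smul]
    exact mul_comm _ _

/-! ### The extension `0 → K^{1/2} → E → K^{-1/2} → 0` -/

/-- The inclusion `K^{1/2} → E`. -/
def incl (x : C) : P.thetaCore.Fiber x →ₗ[ℂ] P.operCore.Fiber x where
  toFun v := P.operFrame (P.mem_index x)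
    ![coords P.thetaCore (P.index x) v, 0]
  map_add' v w := by
    rw [coords_add _ (P.mem_index x), ← map_add]
    simp
  map_smul' c v := by
    rw [coords_smul _ (P.mem_index x), RingHom.id_apply,
      ← (P.operFrame (P.mem_index x)).map_smul]
    simp

/-- The projection `E → K^{-1/2}`. -/
def proj (x : C) :
    P.operCore.Fiber x →ₗ[ℂ] (P.thetaCore.Fiber x →L[ℂ] Bundle.Trivial C ℂ x) where
  toFun e := coords P.operCore (P.index x) e 1 •
    (coordsEquiv P.thetaCore (P.index x) (P.mem_index x)).toContinuousLinearMap
  map_add' e e' := by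
    rw [coords_add _ (P.mem_index x)]
    exact add_smul _ _
      (coordsEquiv P.thetaCore (P.index x) (P.mem_index x)).toContinuousLinearMap
  map_smul' c e := by
    rw [coords_smul _ (P.mem_index x)]
    exact mul_smul _ _
      (coordsEquiv P.thetaCore (P.index x) (P.mem_index x)).toContinuousLinearMap

lemma coords_incl {α : ι} {x : C} (hx : x ∈ P.U α) (v : P.thetaCore.Fiber x) :
    coords P.operCore α (P.incl x v) = ![coords P.thetaCore α v, 0] := by
  have hi := P.mem_index x
  have h : coords P.operCore (P.index x) (P.incl x v) = ![coords P.thetaCore (P.index x) v, 0] :=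
    P.coords_operFrame hi _
  rw [P.coords_operCore hx hi, h, P.coords_thetaCore hx hi]
  ext i
  fin_cases i <;> simp [g, Matrix.mulVec, dotProduct, Fin.sum_univ_two]

lemma coords_operCore_one {α β : ι} {x : C} (hα : x ∈ P.U α) (hβ : x ∈ P.U β)
    (e : P.operCore.Fiber x) :
    coords P.operCore α e 1 = (P.xi α β x)⁻¹ * coords P.operCore β e 1 := by
  rw [P.coords_operCore hα hβ]
  simp [g, Matrix.mulVec, dotProduct, Fin.sum_univ_two]

lemma proj_apply {α : ι} {x : C} (hx : x ∈ P.U α) (e : P.operCore.Fiber x)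
    (v : P.thetaCore.Fiber x) :
    P.proj x e v = coords P.operCore α e 1 * coords P.thetaCore α v := by
  have hi := P.mem_index x
  have h : P.proj x e v = coords P.operCore (P.index x) e 1 *
    coords P.thetaCore (P.index x) v := rfl
  have hξ := P.xi_ne_zero hx hi
  rw [h, P.coords_operCore_one hx hi, P.coords_thetaCore hx hi]
  field_simp

lemma mem_range_incl {α : ι} {x : C} (hx : x ∈ P.U α) (e : P.operCore.Fiber x) :
    e ∈ LinearMap.range (P.incl x) ↔ coords P.operCore α e 1 = 0 := by
  constructor
  · rintro ⟨v, rfl⟩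
    rw [P.coords_incl hx]
    rfl
  · intro h
    refine ⟨P.thetaFrame hx (coords P.operCore α e 0), ?_⟩
    apply coords_injective P.operCore hx
    rw [P.coords_incl hx, P.coords_thetaFrame hx]
    ext i
    fin_cases i
    · rfl
    · exact h.symm

lemma incl_injective (x : C) : Function.Injective (P.incl x) := by
  intro v w h
  have hx := P.mem_index x
  apply coords_injective P.thetaCore hx
  have := congrFun (congrArg (coords P.operCore (P.index x)) h) 0
  rwa [P.coords_incl hx, P.coords_incl hx] at this

lemma exact_incl_proj (x : C) : Function.Exact (P.incl x) (P.proj x) := by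
  intro e
  have hx := P.mem_index x
  change P.proj x e = 0 ↔ e ∈ LinearMap.range (P.incl x)
  rw [P.mem_range_incl hx]
  constructor
  · intro h
    have h1 := P.proj_apply hx e (P.thetaFrame hx 1)
    rw [P.coords_thetaFrame hx, mul_one, h] at h1
    exact h1.symm
  · intro h
    refine ContinuousLinearMap.ext fun v ↦ ?_
    rw [P.proj_apply hx, h, zero_mul]
    rfl

lemma proj_surjective (x : C) : Function.Surjective (P.proj x) := by
  intro l
  have hx := P.mem_index x
  let u := P.thetaFrame hx 1
  refine ⟨P.operFrame hx ![0, l u], ?_⟩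
  refine ContinuousLinearMap.ext fun v ↦ ?_
  have hv : v = coords P.thetaCore (P.index x) v • u := by
    apply coords_injective P.thetaCore hx
    rw [coords_smul _ hx, P.coords_thetaFrame hx, smul_eq_mul, mul_one]
  rw [P.proj_apply hx, P.coords_operFrame hx]
  conv_rhs => rw [hv, map_smul]
  exact mul_comm _ _

lemma isHolomorphicHom_incl : IsHolomorphicHom ℂ (Fin 2 → ℂ) P.incl := by
  intro U s hU hs
  rw [isHolomorphicSection_iff hU] at hs ⊢
  intro x hxU
  have hx := P.mem_index x
  have h := (contMDiffAt_section_iff_coords P.thetaCore hx s).1 (hs x hxU)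
  rw [contMDiffAt_section_iff_coords P.operCore hx]
  have h1 : (fun y ↦ coords P.operCore (P.index x) (P.incl y (s y))) =ᶠ[𝓝 x] fun y ↦
      ![coords P.thetaCore (P.index x) (s y), 0] := by
    filter_upwards [(P.isOpen_U _).mem_nhds hx] with y hy
    exact P.coords_incl hy (s y)
  refine ContMDiffAt.congr_of_eventuallyEq (contMDiffAt_pi_space.2 fun i ↦ ?_) h1
  fin_cases i
  · exact h
  · exact contMDiffAt_const

lemma isHolomorphicHom_proj :
    IsHolomorphicHom (E' := fun x ↦ P.thetaCore.Fiber x →L[ℂ] Bundle.Trivial C ℂ x)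
      (Fin 2 → ℂ) (ℂ →L[ℂ] ℂ) P.proj := by
  intro U s hU hs
  rw [isHolomorphicSection_iff hU] at hs ⊢
  intro x hxU
  have hx := P.mem_index x
  have h := (contMDiffAt_section_iff_coords P.operCore hx s).1 (hs x hxU)
  rw [contMDiffAt_pi_space] at h
  have h1 := (h 1).smul_section (contMDiffAt_continuousLinearMapAt
    (P.thetaCore.localTriv (P.index x)) hx)
  refine h1.congr_of_eventuallyEq ?_
  filter_upwards [(P.isOpen_U _).mem_nhds hx] with y hy
  refine congrArg _ (ContinuousLinearMap.ext fun v ↦ ?_)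
  rw [P.proj_apply hy]
  refine congrArg _ ?_
  exact ((P.thetaCore.localTriv (P.index x)).continuousLinearMapAt_apply_of_mem ℂ hy v).symm

end ProjectiveCoordinateSystem

end Oper
end

noncomputable section

set_option linter.unusedSectionVars false

namespace Oper

namespace ProjectiveCoordinateSystem

variable {C : Type*} [TopologicalSpace C] [ChartedSpace ℂ C] [IsManifold 𝓘(ℂ) ω C] {ι : Type*}
  (P : ProjectiveCoordinateSystem C ι)

/-! ### The second fundamental form -/

/-- The isomorphism `F ≅ (E / F) ⊗ K` given by the `(2, 1)` entry of the connection matrix. -/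
def secondForm (x : C) : LinearMap.range (P.incl x) →ₗ[ℂ]
    TangentSpace 𝓘(ℂ) x →ₗ[ℂ] P.operCore.Fiber x ⧸ LinearMap.range (P.incl x) :=
  LinearMap.mk₂ ℂ (fun w v ↦ (LinearMap.range (P.incl x)).mkQ (P.operFrame (P.mem_index x)
      (-(P.dz (P.index x) x v * coords P.operCore (P.index x) (w : P.operCore.Fiber x) 0) •
        ![0, 1])))
    (fun w w' v ↦ by
      rw [Submodule.coe_add, coords_add _ (P.mem_index x), ← map_add, ← map_add, Pi.add_apply]
      congr 2
      module)
    (fun c w v ↦ by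
      rw [Submodule.coe_smul, coords_smul _ (P.mem_index x), ← map_smul, ← map_smul, Pi.smul_apply,
        smul_eq_mul]
      congr 2
      module)
    (fun w v v' ↦ by
      rw [ContinuousLinearMap.map_add, ← LinearMap.map_add, ← ContinuousLinearEquiv.map_add]
      congr 2
      module)
    (fun c w v ↦ by
      rw [ContinuousLinearMap.map_smul, ← LinearMap.map_smul, ← ContinuousLinearEquiv.map_smul,
        smul_eq_mul]
      congr 2
      module)

/-- The second coordinate is a coordinate on `E / F`; all identities in the quotient are checked
through it. -/
lemma mkQ_eq_mkQ_iff {α : ι} {x : C} (hx : x ∈ P.U α) (e e' : P.operCore.Fiber x) :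
    (LinearMap.range (P.incl x)).mkQ e = (LinearMap.range (P.incl x)).mkQ e' ↔
      coords P.operCore α e 1 = coords P.operCore α e' 1 := by
  have h : coords P.operCore α e 1 =
      coords P.operCore α (e - e') 1 + coords P.operCore α e' 1 := by
    have h := coords_add P.operCore hx (e - e') e'
    rw [sub_add_cancel] at h
    rw [h, Pi.add_apply]
  rw [Submodule.mkQ_apply, Submodule.mkQ_apply, Submodule.Quotient.eq, P.mem_range_incl hx, h,
    add_eq_right]

lemma secondForm_apply {α : ι} {x : C} (hx : x ∈ P.U α) (w : LinearMap.range (P.incl x))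
    (v : TangentSpace 𝓘(ℂ) x) (e : P.operCore.Fiber x)
    (he : coords P.operCore α e 1 =
      -(P.dz α x v * coords P.operCore α (w : P.operCore.Fiber x) 0)) :
    P.secondForm x w v = (LinearMap.range (P.incl x)).mkQ e := by
  have hi := P.mem_index x
  have hξ := P.xi_ne_zero hi hx
  change (LinearMap.range (P.incl x)).mkQ _ = _
  rw [P.mkQ_eq_mkQ_iff hi, P.coords_operFrame hi, P.coords_operCore_one hi hx, he, P.dz_eq hi hx]
  obtain ⟨u, hu⟩ := w.2
  rw [← hu, P.coords_incl hi, P.coords_incl hx, P.coords_thetaCore hi hx]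
  change -(P.dz (P.index x) x v * (P.xi (P.index x) α x * coords P.thetaCore α u)) * 1 =
    (P.xi (P.index x) α x)⁻¹ * -(P.xi (P.index x) α x ^ 2 * P.dz (P.index x) x v *
      coords P.thetaCore α u)
  field_simp

/-- The second coordinate of a section of `F` is identically zero, so its derivative drops out and
only the entry of the connection matrix remains. -/
lemma isInducedBy_secondForm :
    IsInducedBy P.operConnection (fun x ↦ LinearMap.range (P.incl x)) P.secondForm := by
  intro U s hU hs hsL x hxU v
  have hx := P.mem_index x
  have hs' := ((isHolomorphicSection_iff hU).1 hs x hxU).mdifferentiableAt (by simp)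
  have hc := (mdifferentiableAt_section_iff_coords P.operCore hx s).1 hs'
  refine P.secondForm_apply hx _ v _ ?_
  rw [P.coords_operConnection hx hs']
  have h1 : (fun y ↦ coords P.operCore (P.index x) (s y) 1) =ᶠ[𝓝 x] fun _ ↦ 0 := by
    filter_upwards [(P.isOpen_U _).mem_nhds hx, hU.mem_nhds hxU] with y hy hyU
    exact (P.mem_range_incl hy _).1 (hsL y hyU)
  have h2 := mvfderiv_apply hc v 1
  rw [mvfderiv_congr h1, mvfderiv_const] at h2
  rw [Pi.sub_apply, ← h2]
  simp

lemma bijective_secondForm (x : C) : Function.Bijective (P.secondForm x) := by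
  have hx := P.mem_index x
  obtain ⟨v₀, hv₀, hv⟩ := P.exists_dz_eq_one hx
  have key : ∀ w : LinearMap.range (P.incl x), P.secondForm x w v₀ =
      (LinearMap.range (P.incl x)).mkQ (P.operFrame hx
        ![0, -coords P.operCore (P.index x) (w : P.operCore.Fiber x) 0]) := by
    intro w
    refine P.secondForm_apply hx w v₀ _ ?_
    rw [P.coords_operFrame hx, hv₀, one_mul]
    rfl
  constructor
  · rw [injective_iff_map_eq_zero]
    intro w hw
    have h1 := key w
    rw [hw, LinearMap.zero_apply, ← map_zero (LinearMap.range (P.incl x)).mkQ,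
      P.mkQ_eq_mkQ_iff hx, P.coords_operFrame hx, coords_zero P.operCore hx] at h1
    have h2 : coords P.operCore (P.index x) (w : P.operCore.Fiber x) 0 = 0 :=
      neg_eq_zero.1 h1.symm
    apply Subtype.ext
    apply coords_injective P.operCore hx
    rw [Submodule.coe_zero, coords_zero P.operCore hx]
    ext i
    fin_cases i
    · exact h2
    · exact (P.mem_range_incl hx _).1 w.2
  · intro ψ
    obtain ⟨e, he⟩ := Submodule.mkQ_surjective _ (ψ v₀)
    refine ⟨⟨P.incl x (P.thetaFrame hx (-coords P.operCore (P.index x) e 1)), _, rfl⟩, ?_⟩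
    refine LinearMap.ext fun v ↦ ?_
    rw [hv v, map_smul, map_smul, key, ← he]
    congr 1
    rw [P.mkQ_eq_mkQ_iff hx, P.coords_operFrame hx, P.coords_incl hx, P.coords_thetaFrame hx]
    simp

lemma isLineSubbundle_incl : IsLineSubbundle (Fin 2 → ℂ) fun x ↦ LinearMap.range (P.incl x) := by
  classical
  intro x₀
  have hx₀ := P.mem_index x₀
  let α := P.index x₀
  let s : Π x, P.operCore.Fiber x := fun x ↦
    if hx : x ∈ P.U α then P.operFrame hx ![1, 0] else 0
  have hs : ∀ x ∈ P.U α, coords P.operCore α (s x) = ![1, 0] := by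
    intro x hx
    simp only [s, hx, dif_pos]
    exact P.coords_operFrame hx _
  refine ⟨P.U α, s, P.isOpen_U α, hx₀, ?_, fun x hx ↦ ⟨?_, ?_⟩⟩
  · rw [isHolomorphicSection_iff (P.isOpen_U α)]
    intro x hx
    rw [contMDiffAt_section_iff_coords P.operCore hx]
    refine (contMDiffAt_const (c := ![(1 : ℂ), 0])).congr_of_eventuallyEq ?_
    filter_upwards [(P.isOpen_U α).mem_nhds hx] with y hy
    exact hs y hy
  · intro h0
    have h1 := hs x hx
    rw [h0, coords_zero P.operCore hx] at h1
    exact zero_ne_one (congrFun h1 0)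
  · ext e
    rw [P.mem_range_incl hx, Submodule.mem_span_singleton]
    constructor
    · intro h
      refine ⟨coords P.operCore α e 0, ?_⟩
      apply coords_injective P.operCore hx
      rw [coords_smul P.operCore hx, hs x hx]
      ext i
      fin_cases i
      · simp
      · simp [h]
    · rintro ⟨c, rfl⟩
      rw [coords_smul P.operCore hx, hs x hx]
      simp

/-! ### The connection on `E` is a holomorphic `SL₂`-connection -/

/-- The alternating form given by the determinant in the frames of `E`. -/
def operVol (x : C) : P.operCore.Fiber x [⋀^Fin 2]→ₗ[ℂ] ℂ :=
  (Matrix.detRowAlternating (n := Fin 2) (R := ℂ)).compLinearMap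
    (coordsEquiv P.operCore (P.index x) (P.mem_index x)).toLinearEquiv.toLinearMap

/-- Independence of the frame, since `g` has determinant one. -/
lemma operVol_apply {α : ι} {x : C} (hx : x ∈ P.U α) (e e' : P.operCore.Fiber x) :
    P.operVol x ![e, e'] = coords P.operCore α e 0 * coords P.operCore α e' 1 -
      coords P.operCore α e 1 * coords P.operCore α e' 0 := by
  have hi := P.mem_index x
  have hξ := P.xi_ne_zero hi hx
  have h : P.operVol x ![e, e'] =
      Matrix.det !![coords P.operCore (P.index x) e 0, coords P.operCore (P.index x) e 1;
        coords P.operCore (P.index x) e' 0, coords P.operCore (P.index x) e' 1] := by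
    change Matrix.det (fun i ↦ coords P.operCore (P.index x) (![e, e'] i)) = _
    congr 1
    ext i j
    fin_cases i <;> fin_cases j <;> rfl
  rw [h, Matrix.det_fin_two_of, P.coords_operCore hi hx, P.coords_operCore hi hx]
  simp [g, Matrix.mulVec, dotProduct, Fin.sum_univ_two]
  field_simp
  ring

lemma isSL2Connection_operConnection : IsSL2Connection P.operConnection := by
  refine ⟨by simp, P.operVol, fun x h0 ↦ ?_, fun U s t hU hs ht ↦ ?_⟩
  · have hx := P.mem_index x
    have h := P.operVol_apply hx (P.operFrame hx ![1, 0]) (P.operFrame hx ![0, 1])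
    rw [h0, P.coords_operFrame hx, P.coords_operFrame hx] at h
    simp at h
  · rw [isHolomorphicSection_iff hU] at hs ht
    have hev : ∀ x, (fun y ↦ P.operVol y ![s y, t y]) =ᶠ[𝓝 x] fun y ↦
        coords P.operCore (P.index x) (s y) 0 * coords P.operCore (P.index x) (t y) 1 -
        coords P.operCore (P.index x) (s y) 1 * coords P.operCore (P.index x) (t y) 0 := by
      intro x
      filter_upwards [(P.isOpen_U _).mem_nhds (P.mem_index x)] with y hy
      exact P.operVol_apply hy _ _
    constructor
    · intro x hxU
      have hx := P.mem_index x
      have hs' := (contMDiffAt_section_iff_coords P.operCore hx s).1 (hs x hxU)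
      have ht' := (contMDiffAt_section_iff_coords P.operCore hx t).1 (ht x hxU)
      rw [contMDiffAt_pi_space] at hs' ht'
      exact ((((hs' 0).mul (ht' 1)).sub ((hs' 1).mul (ht' 0))).congr_of_eventuallyEq
        (hev x)).contMDiffWithinAt
    · intro x hxU v
      have hx := P.mem_index x
      have hs1 := (hs x hxU).mdifferentiableAt (by simp)
      have ht1 := (ht x hxU).mdifferentiableAt (by simp)
      have hs2 := (mdifferentiableAt_section_iff_coords P.operCore hx s).1 hs1
      have ht2 := (mdifferentiableAt_section_iff_coords P.operCore hx t).1 ht1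
      have hs3 := mdifferentiableAt_pi.1 hs2
      have ht3 := mdifferentiableAt_pi.1 ht2
      have hm1 : MDifferentiableAt 𝓘(ℂ) 𝓘(ℂ) (fun y ↦
        coords P.operCore (P.index x) (s y) 0 * coords P.operCore (P.index x) (t y) 1) x :=
        (hs3 0).mul (ht3 1)
      have hm2 : MDifferentiableAt 𝓘(ℂ) 𝓘(ℂ) (fun y ↦
        coords P.operCore (P.index x) (s y) 1 * coords P.operCore (P.index x) (t y) 0) x :=
        (hs3 1).mul (ht3 0)
      rw [mvfderiv_congr (hev x), mvfderiv_fun_sub hm1 hm2, mvfderiv_fun_mul (hs3 0) (ht3 1),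
        mvfderiv_fun_mul (hs3 1) (ht3 0), P.operVol_apply hx, P.operVol_apply hx,
        P.coords_operConnection hx hs1, P.coords_operConnection hx ht1]
      simp only [sub_apply, add_apply, smul_apply, mvfderiv_apply hs2, mvfderiv_apply ht2,
        smul_eq_mul, Pi.sub_apply, Matrix.cons_val_zero, Matrix.cons_val_one]
      ring

lemma isHolomorphicConnection_operConnection : IsHolomorphicConnection P.operConnection := by
  classical
  refine fun U hU ↦ ⟨fun {s} hs ↦ ?_⟩
  have hs : IsHolomorphicSection (Fin 2 → ℂ) U s := hs
  rw [isHolomorphicSection_iff hU] at hs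
  intro x hxU
  have hx := P.mem_index x
  let α := P.index x
  let c : C → Fin 2 → ℂ := fun y ↦ coords P.operCore α (s y)
  -- Near `x` the covariant derivative is `dz_α ⊗ t`, where the section `t` has coordinates `dc/dz_α
  -- - X₋ c`; both factors are holomorphic.
  let d : C → Fin 2 → ℂ := fun y ↦ deriv (c ∘ (P.z α).symm) (P.z α y) - c y 0 • ![0, 1]
  let t : Π y, P.operCore.Fiber y := fun y ↦
    if hy : y ∈ P.U α then P.operFrame hy (d y) else 0
  have ht : ∀ y ∈ P.U α, coords P.operCore α (t y) = d y := by
    intro y hy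
    simp only [t, hy, dif_pos]
    exact P.coords_operFrame hy _
  have hc := (contMDiffAt_section_iff_coords P.operCore hx s).1 (hs x hxU)
  have hd : ContMDiffAt 𝓘(ℂ) 𝓘(ℂ, Fin 2 → ℂ) ω d x :=
    (P.contMDiffAt_comp_z hx (P.analyticAt_comp_symm hx hc).deriv).sub
      ((contMDiffAt_pi_space.1 hc 0).smul contMDiffAt_const)
  have ht' := (contMDiffAt_section_iff_coords P.operCore hx t).2 (hd.congr_of_eventuallyEq (by
    filter_upwards [(P.isOpen_U α).mem_nhds hx] with y hy
    exact ht y hy))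
  refine ((contMDiffAt_smulRight (P.contMDiffAt_dz hx) ht').congr_of_eventuallyEq
    ?_).contMDiffWithinAt
  filter_upwards [(P.isOpen_U α).mem_nhds hx, hU.mem_nhds hxU] with y hy hyU
  refine congrArg _ (ContinuousLinearMap.ext fun v ↦ ?_)
  apply coords_injective P.operCore hy
  have hs1 := (hs y hyU).mdifferentiableAt (by simp)
  have hs2 := (mdifferentiableAt_section_iff_coords P.operCore hy s).1 hs1
  refine (P.coords_operConnection hy hs1 v).trans ?_
  rw [P.mvfderiv_eq_dz_smul hy hs2]
  refine Eq.trans ?_ (coords_smul P.operCore hy (P.dz α y v) (t y)).symm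
  rw [ht y hy]
  ext i
  fin_cases i
  · simp only [d, c, Fin.zero_eta, Pi.sub_apply, Pi.smul_apply, smul_eq_mul, Matrix.cons_val_zero,
      mul_zero, sub_zero]
  · simp only [d, c, Fin.mk_one, Pi.sub_apply, Pi.smul_apply, smul_eq_mul, Matrix.cons_val_one,
      Matrix.cons_val_fin_one, mul_one, mul_sub]

lemma contMDiffVectorBundle_operCore :
    ContMDiffVectorBundle ω (Fin 2 → ℂ) P.operCore.Fiber 𝓘(ℂ) := inferInstance

end ProjectiveCoordinateSystem

end Oper
end

/-! ### Holonomy, forms with zeros, and irreducibility -/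

noncomputable section

set_option linter.unusedSectionVars false

namespace Oper

/-- Zariski density is invariant under conjugation. -/
lemma IsZariskiDense.of_conj {H S : Set SL(2, ℂ)} (hH : IsZariskiDense H)
    {Q Q' : Matrix (Fin 2) (Fin 2) ℂ} (hQ : Q * Q' = 1)
    (hS : ∀ A ∈ H, ∀ B : SL(2, ℂ), (B : Matrix (Fin 2) (Fin 2) ℂ) = Q' * A * Q → B ∈ S) :
    IsZariskiDense S := by
  intro p hp B
  have hQ' : Q' * Q = 1 := mul_eq_one_comm.1 hQ
  -- The polynomial `p` composed with `A ↦ Q' A Q`, whose entries are linear in those of `A`.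
  let q : MvPolynomial (Fin 2 × Fin 2) ℂ := MvPolynomial.bind₁
    (fun i ↦ ∑ j, ∑ k, MvPolynomial.C (Q' i.1 j * Q k i.2) * MvPolynomial.X (j, k)) p
  have hq : ∀ A : Matrix (Fin 2) (Fin 2) ℂ, MvPolynomial.eval (fun i ↦ A i.1 i.2) q =
      MvPolynomial.eval (fun i ↦ (Q' * A * Q) i.1 i.2) p := by
    intro A
    have h1 : MvPolynomial.eval (fun i : Fin 2 × Fin 2 ↦ A i.1 i.2) q =
        MvPolynomial.eval (fun i : Fin 2 × Fin 2 ↦ MvPolynomial.eval (fun i ↦ A i.1 i.2)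
          (∑ j, ∑ k, MvPolynomial.C (Q' i.1 j * Q k i.2) * MvPolynomial.X (j, k))) p :=
      MvPolynomial.eval₂Hom_bind₁ _ _ _ _
    rw [h1]
    congr 2
    ext i
    simp [Matrix.mul_apply, Fin.sum_univ_two]
    ring
  have hconj : ∀ (A : SL(2, ℂ)) {R R' : Matrix (Fin 2) (Fin 2) ℂ}, R * R' = 1 →
      Matrix.det (R * (A : Matrix (Fin 2) (Fin 2) ℂ) * R') = 1 := by
    intro A R R' hR
    rw [Matrix.det_mul, Matrix.det_mul, A.det_coe, mul_one, ← Matrix.det_mul, hR, Matrix.det_one]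
  have h2 := hH q (fun A hA ↦ by
    rw [hq]
    exact hp ⟨Q' * A * Q, hconj A hQ'⟩ (hS A hA _ rfl)) ⟨Q * B * Q', hconj B hQ⟩
  rw [hq] at h2
  have h3 : Q' * (Q * (B : Matrix (Fin 2) (Fin 2) ℂ) * Q') * Q = B := by
    rw [mul_assoc, mul_assoc, hQ', mul_one, ← mul_assoc, hQ', one_mul]
  rwa [h3] at h2

namespace ProjectiveCoordinateSystem

variable {C : Type*} [TopologicalSpace C] [ChartedSpace ℂ C] [IsManifold 𝓘(ℂ) ω C] {ι : Type*}
  (P : ProjectiveCoordinateSystem C ι)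

/-! ### Parallel transport along paths -/

open Classical in
/-- The flat section of `E` over `U_α` with coordinates `c` in the flat frame. -/
def flatSection (α : ι) (c : Fin 2 → ℂ) (x : C) : P.operCore.Fiber x :=
  if hx : x ∈ P.U α then P.flatIso x ((coordsEquiv P.flatCore α hx).symm c) else 0

variable {P} in
lemma flatSection_of_mem {α : ι} {x : C} (hx : x ∈ P.U α) (c : Fin 2 → ℂ) :
    P.flatSection α c x = P.flatIso x ((coordsEquiv P.flatCore α hx).symm c) := dif_pos hx

lemma coords_flatSection {α : ι} {x : C} (hx : x ∈ P.U α) (c : Fin 2 → ℂ) :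
    coords P.flatCore α ((P.flatIso x).symm (P.flatSection α c x)) = c := by
  rw [flatSection_of_mem hx, ContinuousLinearEquiv.symm_apply_apply]
  exact coords_symm_apply P.flatCore hx c

/-- The criterion does not involve the point `x`, so flat sections that agree at one point of an
overlap agree on all of it. -/
lemma flatSection_eq_iff {α β : ι} {x : C} (hα : x ∈ P.U α) (hβ : x ∈ P.U β)
    (c d : Fin 2 → ℂ) : P.flatSection α c x = P.flatSection β d x ↔
      c = (P.f α β : Matrix (Fin 2) (Fin 2) ℂ) *ᵥ d := by
  rw [← (P.flatIso x).symm.injective.eq_iff, ← (coords_injective P.flatCore hα).eq_iff,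
    P.coords_flatSection hα, P.coords_flatCore hα hβ, P.coords_flatSection hβ]

lemma isHolomorphicSection_flatSection (α : ι) (c : Fin 2 → ℂ) :
    IsHolomorphicSection (Fin 2 → ℂ) (P.U α) (P.flatSection α c) := by
  rw [isHolomorphicSection_iff (P.isOpen_U α)]
  intro x hx
  rw [contMDiffAt_section_iff_coords P.operCore hx]
  have h1 : (fun y ↦ coords P.operCore α (P.flatSection α c y)) =ᶠ[𝓝 x] fun y ↦
      P.flatMatrix α y *ᵥ c := by
    filter_upwards [(P.isOpen_U _).mem_nhds hx] with y hy
    rw [flatSection_of_mem hy, P.coords_flatIso hy]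
    exact congrArg _ (coords_symm_apply P.flatCore hy c)
  refine ContMDiffAt.congr_of_eventuallyEq (contMDiffAt_pi_space.2 fun i ↦ ?_) h1
  simp only [flatMatrix, Matrix.mulVec, dotProduct, Fin.sum_univ_two]
  fin_cases i
  · exact contMDiffAt_const (c := 0 * c 0 + 1 * c 1)
  · exact (contMDiffAt_const (c := -1 * c 0)).add
      ((P.contMDiffAt_z hx).mul (contMDiffAt_const (c := c 1)))

lemma operConnection_flatSection {α : ι} {x : C} (hx : x ∈ P.U α) (c : Fin 2 → ℂ) :
    P.operConnection (P.flatSection α c) x = 0 := by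
  refine ContinuousLinearMap.ext fun v ↦ ?_
  have hs := ((isHolomorphicSection_iff (P.isOpen_U α)).1
    (P.isHolomorphicSection_flatSection α c) x hx).mdifferentiableAt (by simp)
  have h1 : (fun y ↦ coords P.flatCore α ((P.flatIso y).symm (P.flatSection α c y))) =ᶠ[𝓝 x]
      fun _ ↦ c := by
    filter_upwards [(P.isOpen_U _).mem_nhds hx] with y hy
    exact P.coords_flatSection hy c
  have h2 := P.coords_flatDeriv hx (P.mdifferentiableAt_flatIso_symm hs) v
  rw [mvfderiv_congr h1, mvfderiv_const] at h2
  rw [operConnection_apply, flatConnection_apply]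
  have h3 : P.flatDeriv (fun y ↦ (P.flatIso y).symm (P.flatSection α c y)) x v = 0 := by
    apply coords_injective P.flatCore hx
    rw [h2, coords_zero P.flatCore hx]
    rfl
  rw [h3, map_zero]
  rfl

/-- The lift `Γ` of `γ` is given locally by the flat sections `P.flatSection α c`. -/
def IsFlatLift {x y : C} (γ : Path x y) (Γ : unitInterval → TotalSpace (Fin 2 → ℂ) P.operCore.Fiber) :
    Prop :=
  ∀ t, ∃ α c, γ t ∈ P.U α ∧
    ∀ᶠ t' in 𝓝 t, Γ t' = TotalSpace.mk' (Fin 2 → ℂ) (γ t') (P.flatSection α c (γ t'))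

variable {P}

lemma IsFlatLift.isParallelTransport {x y : C} {γ : Path x y}
    {Γ : unitInterval → TotalSpace (Fin 2 → ℂ) P.operCore.Fiber} (h : P.IsFlatLift γ Γ)
    {v : P.operCore.Fiber x} {w : P.operCore.Fiber y} (h0 : Γ 0 = TotalSpace.mk' (Fin 2 → ℂ) x v)
    (h1 : Γ 1 = TotalSpace.mk' (Fin 2 → ℂ) y w) :
    IsParallelTransport P.operConnection γ v w := by
  refine ⟨Γ, h0, h1, fun t ↦ ?_⟩
  obtain ⟨α, c, hα, hev⟩ := h t
  exact ⟨P.U α, P.flatSection α c, P.isOpen_U α, hα, P.isHolomorphicSection_flatSection α c,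
    fun u hu ↦ P.operConnection_flatSection hu c, hev⟩

lemma IsFlatLift.trans {x y z : C} {γ : Path x y} {γ' : Path y z}
    {Γ Γ' : unitInterval → TotalSpace (Fin 2 → ℂ) P.operCore.Fiber} (h : P.IsFlatLift γ Γ)
    (h' : P.IsFlatLift γ' Γ') (hΓ : Γ 1 = Γ' 0) :
    ∃ Γ'', P.IsFlatLift (γ.trans γ') Γ'' ∧ Γ'' 0 = Γ 0 ∧ Γ'' 1 = Γ' 1 := by
  let σ : unitInterval → unitInterval := fun t ↦ projIcc 0 1 zero_le_one (2 * (t : ℝ))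
  let σ' : unitInterval → unitInterval := fun t ↦ projIcc 0 1 zero_le_one (2 * (t : ℝ) - 1)
  have hσ : Continuous σ := continuous_projIcc.comp (by fun_prop)
  have hσ' : Continuous σ' := continuous_projIcc.comp (by fun_prop)
  let Γ'' : unitInterval → TotalSpace (Fin 2 → ℂ) P.operCore.Fiber := fun t ↦
    if (t : ℝ) ≤ 1 / 2 then Γ (σ t) else Γ' (σ' t)
  have hle : ∀ {t : unitInterval}, (t : ℝ) ≤ 1 / 2 →
      Γ'' t = Γ (σ t) ∧ (γ.trans γ') t = γ (σ t) := fun {t} ht ↦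
    ⟨if_pos ht, if_pos ht⟩
  have hgt : ∀ {t : unitInterval}, ¬ (t : ℝ) ≤ 1 / 2 →
      Γ'' t = Γ' (σ' t) ∧ (γ.trans γ') t = γ' (σ' t) := fun {t} ht ↦
    ⟨if_neg ht, if_neg ht⟩
  refine ⟨Γ'', fun t ↦ ?_, ?_, ?_⟩
  · rcases lt_trichotomy (t : ℝ) (1 / 2) with ht | ht | ht
    · obtain ⟨α, c, hα, hev⟩ := h (σ t)
      refine ⟨α, c, by rwa [(hle ht.le).2], ?_⟩
      filter_upwards [hσ.continuousAt.eventually hev,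
        continuous_subtype_val.continuousAt.eventually (eventually_lt_nhds ht)] with t' h1 h2
      rw [(hle (le_of_lt h2)).1, h1, (hle (le_of_lt h2)).2]
    · have hσt : σ t = 1 := by
        apply Subtype.ext
        simp [σ, ht, projIcc]
      have hσt' : σ' t = 0 := by
        apply Subtype.ext
        simp [σ', ht, projIcc]
      obtain ⟨α, c, hα, hev⟩ := h (σ t)
      obtain ⟨β, d, hβ, hev'⟩ := h' (σ' t)
      have hy : y ∈ P.U α := by rwa [hσt, γ.target] at hα
      have hy' : y ∈ P.U β := by rwa [hσt', γ'.source] at hβ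
      have e1 := hev.self_of_nhds
      have e2 := hev'.self_of_nhds
      rw [hσt, γ.target, hΓ] at e1
      rw [hσt', γ'.source, e1] at e2
      have e3 : P.flatSection α c y = P.flatSection β d y := by
        simpa using e2
      rw [P.flatSection_eq_iff hy hy'] at e3
      -- At the junction both flat sections pass through the same vector, hence agree on the
      -- overlap; the section over `U_α` describes the lift on both sides.
      refine ⟨α, c, by rwa [(hle ht.le).2], ?_⟩
      have hα' : ∀ᶠ t' in 𝓝 t, γ' (σ' t') ∈ P.U α := by
        refine (γ'.continuous.comp hσ').continuousAt.eventually ((P.isOpen_U α).mem_nhds ?_)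
        simpa [hσt'] using hy
      have hβ' : ∀ᶠ t' in 𝓝 t, γ' (σ' t') ∈ P.U β :=
        (γ'.continuous.comp hσ').continuousAt.eventually ((P.isOpen_U β).mem_nhds hβ)
      filter_upwards [hσ.continuousAt.eventually hev, hσ'.continuousAt.eventually hev', hα', hβ']
        with t' h1 h2 h3 h4
      by_cases ht' : (t' : ℝ) ≤ 1 / 2
      · rw [(hle ht').1, h1, (hle ht').2]
      · rw [(hgt ht').1, h2, (hgt ht').2, (P.flatSection_eq_iff h3 h4 c d).2 e3]
    · obtain ⟨α, c, hα, hev⟩ := h' (σ' t)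
      refine ⟨α, c, by rwa [(hgt ht.not_ge).2], ?_⟩
      filter_upwards [hσ'.continuousAt.eventually hev,
        continuous_subtype_val.continuousAt.eventually (eventually_gt_nhds ht)] with t' h1 h2
      rw [(hgt (not_le_of_gt h2)).1, h1, (hgt (not_le_of_gt h2)).2]
  · rw [(hle (t := 0) (by norm_num)).1]
    congr 1
    apply Subtype.ext
    simp [σ, projIcc]
  · rw [(hgt (t := 1) (by norm_num)).1]
    congr 1
    apply Subtype.ext
    simp [σ', projIcc]
    norm_num

/-- The combinatorial transport is realized along an actual path. One path must serve all vectors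
`c`, because an element of `holonomy` is a single loop acting on the whole fibre. -/
lemma Transport.exists_isFlatLift {α β : ι} {x y : C} {A : SL(2, ℂ)}
    (h : P.Transport x α y β A) : ∃ γ : Path x y, ∀ c, ∃ Γ, P.IsFlatLift γ Γ ∧
      Γ 0 = TotalSpace.mk' (Fin 2 → ℂ) x (P.flatSection α c x) ∧
      Γ 1 = TotalSpace.mk' (Fin 2 → ℂ) y
        (P.flatSection β ((A : Matrix (Fin 2) (Fin 2) ℂ) *ᵥ c) y) := by
  induction h with
  | @path α x y h =>
    refine ⟨h.somePath, fun c ↦ ⟨fun t ↦ TotalSpace.mk' (Fin 2 → ℂ) (h.somePath t)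
      (P.flatSection α c (h.somePath t)), fun t ↦ ⟨α, c, h.somePath_mem t,
        Filter.Eventually.of_forall fun _ ↦ rfl⟩, ?_, ?_⟩⟩
    · exact congrArg (fun y ↦ TotalSpace.mk' (Fin 2 → ℂ) y (P.flatSection α c y))
        h.somePath.source
    · rw [Matrix.SpecialLinearGroup.coe_one, Matrix.one_mulVec]
      exact congrArg (fun y ↦ TotalSpace.mk' (Fin 2 → ℂ) y (P.flatSection α c y))
        h.somePath.target
  | @change α β x hα hβ =>
    refine ⟨Path.refl x, fun c ↦ ⟨fun _ ↦ TotalSpace.mk' (Fin 2 → ℂ) x (P.flatSection α c x),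
      fun t ↦ ⟨α, c, hα, Filter.Eventually.of_forall fun _ ↦ rfl⟩, rfl, ?_⟩⟩
    rw [(P.flatSection_eq_iff hβ hα _ _).2 rfl]
  | trans _ _ ih₁ ih₂ =>
    obtain ⟨γ₁, h₁⟩ := ih₁
    obtain ⟨γ₂, h₂⟩ := ih₂
    refine ⟨γ₁.trans γ₂, fun c ↦ ?_⟩
    obtain ⟨Γ₁, hΓ₁, h10, h11⟩ := h₁ c
    obtain ⟨Γ₂, hΓ₂, h20, h21⟩ := h₂ _
    obtain ⟨Γ, hΓ, h0, h1⟩ := hΓ₁.trans hΓ₂ (h11.trans h20.symm)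
    refine ⟨Γ, hΓ, h0.trans h10, ?_⟩
    rw [h1, h21, Matrix.mulVec_mulVec, Matrix.SpecialLinearGroup.coe_mul]

variable (P)

/-- The basis of the fibre of `E` given by the flat frame over `U_α`. -/
def flatBasis {α : ι} {x : C} (hx : x ∈ P.U α) : Module.Basis (Fin 2) ℂ (P.operCore.Fiber x) :=
  Module.Basis.ofEquivFun
    ((P.flatIso x).symm.trans (coordsEquiv P.flatCore α hx)).toLinearEquiv

/-- Only this inclusion is needed: a set containing a Zariski dense set is Zariski dense. -/
lemma toLin_flatBasis_mem_holonomy {α : ι} {x : C} (hx : x ∈ P.U α) {A : SL(2, ℂ)}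
    (hA : A ∈ P.holonomyGroup hx) :
    Matrix.toLin (P.flatBasis hx) (P.flatBasis hx) (A : Matrix (Fin 2) (Fin 2) ℂ) ∈
      holonomy P.operConnection x := by
  have hA : P.Transport x α x α A := hA
  obtain ⟨γ, hγ⟩ := hA.exists_isFlatLift
  refine ⟨γ, fun v ↦ ?_⟩
  have hv : ∀ v : P.operCore.Fiber x, v = P.flatSection α ((P.flatBasis hx).repr v) x := by
    intro v
    rw [flatSection_of_mem hx]
    exact (((P.flatIso x).symm.trans (coordsEquiv P.flatCore α hx)).symm_apply_apply v).symm
  obtain ⟨Γ, hΓ, h0, h1⟩ := hγ ((P.flatBasis hx).repr v)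
  refine hΓ.isParallelTransport (h0.trans (by rw [← hv])) (h1.trans ?_)
  have h2 := LinearMap.toMatrix_mulVec_repr (P.flatBasis hx) (P.flatBasis hx)
    (Matrix.toLin (P.flatBasis hx) (P.flatBasis hx) (A : Matrix (Fin 2) (Fin 2) ℂ)) v
  rw [LinearMap.toMatrix_toLin] at h2
  rw [h2, ← hv]

/-! ### Holomorphic `1`-forms -/

section Forms

variable {σ : Π x, Canonical C x}

open Classical in
/-- The coefficients of a `1`-form in the coordinates `z_α`. -/
def formCoeff (σ : Π x, Canonical C x) (β : ι) (x : C) : ℂ :=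
  if hx : x ∈ P.U β then σ x (P.exists_dz_eq_one hx).choose else 0

lemma eq_formCoeff_smul (σ : Π x, Canonical C x) {β : ι} {x : C} (hx : x ∈ P.U β) :
    σ x = P.formCoeff σ β x • P.dz β x := by
  refine ContinuousLinearMap.ext fun v ↦ ?_
  obtain ⟨h1, h2⟩ := (P.exists_dz_eq_one hx).choose_spec
  have h3 : P.formCoeff σ β x = σ x (P.exists_dz_eq_one hx).choose := dif_pos hx
  conv_lhs => rw [h2 v, map_smul]
  rw [h3]
  exact mul_comm _ _

lemma formCoeff_eq_of_eq_smul {β : ι} {x : C} (hx : x ∈ P.U β) {c : ℂ}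
    (h : σ x = c • P.dz β x) : P.formCoeff σ β x = c := by
  obtain ⟨h1, h2⟩ := (P.exists_dz_eq_one hx).choose_spec
  have h3 : P.formCoeff σ β x = σ x (P.exists_dz_eq_one hx).choose := dif_pos hx
  rw [h3, h]
  change c * P.dz β x _ = c
  rw [h1, mul_one]

lemma contMDiffAt_formCoeff {β : ι} {x : C} (hx : x ∈ P.U β)
    (hσ : ContMDiffAt 𝓘(ℂ) (𝓘(ℂ).prod 𝓘(ℂ, ℂ →L[ℂ] ℂ)) ω
      (fun y ↦ TotalSpace.mk' (ℂ →L[ℂ] ℂ) (E := Canonical C) y (σ y)) x) :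
    ContMDiffAt 𝓘(ℂ) 𝓘(ℂ) ω (P.formCoeff σ β) x := by
  have hdz := P.contMDiffAt_dz hx
  rw [contMDiffAt_hom_bundle] at hσ hdz
  have h1 := hσ.2.clm_apply (contMDiffAt_const (c := (1 : ℂ)))
  have h2 := hdz.2.clm_apply (contMDiffAt_const (c := (1 : ℂ)))
  have hx' := mem_baseSet_trivializationAt ℂ (TangentSpace 𝓘(ℂ) (M := C)) x
  -- A holomorphic local frame of the tangent bundle. The coefficient is the quotient `σ u / dz_β
  -- u`, whose denominator does not vanish near `x`.
  let u : Π y, TangentSpace 𝓘(ℂ) y :=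
    fun y ↦ (trivializationAt ℂ (TangentSpace 𝓘(ℂ) (M := C)) x).symmL ℂ y 1
  have h1 : ContMDiffAt 𝓘(ℂ) 𝓘(ℂ) ω (fun y ↦ σ y (u y)) x := by
    refine h1.congr_of_eventuallyEq (Filter.Eventually.of_forall fun y ↦ ?_)
    simp [ContinuousLinearMap.inCoordinates, u]
  have h2 : ContMDiffAt 𝓘(ℂ) 𝓘(ℂ) ω (fun y ↦ P.dz β y (u y)) x := by
    refine h2.congr_of_eventuallyEq (Filter.Eventually.of_forall fun y ↦ ?_)
    simp [ContinuousLinearMap.inCoordinates, u]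
  have h0 : P.dz β x (u x) ≠ 0 := by
    intro h0
    obtain ⟨v₀, -, hv⟩ := P.exists_dz_eq_one hx
    have h3 : u x = 0 := by rw [hv (u x), h0, zero_smul]
    have h4 := Trivialization.continuousLinearMapAt_symmL (R := ℂ)
      (trivializationAt ℂ (TangentSpace 𝓘(ℂ) (M := C)) x) hx' 1
    change Trivialization.continuousLinearMapAt ℂ _ x (u x) = 1 at h4
    rw [h3, map_zero] at h4
    exact zero_ne_one h4
  refine (h1.div₀ h2 h0).congr_of_eventuallyEq ?_
  filter_upwards [(P.isOpen_U β).mem_nhds hx, h2.continuousAt.eventually_ne h0] with y hy hy0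
  have h5 : σ y (u y) = P.formCoeff σ β y * P.dz β y (u y) :=
    congrArg (fun l : Canonical C y ↦ l (u y)) (P.eq_formCoeff_smul σ hy)
  exact eq_div_of_mul_eq hy0 h5.symm

lemma isFormCoeff_formCoeff
    (hσ : ∀ x, ContMDiffAt 𝓘(ℂ) (𝓘(ℂ).prod 𝓘(ℂ, ℂ →L[ℂ] ℂ)) ω
      (fun y ↦ TotalSpace.mk' (ℂ →L[ℂ] ℂ) (E := Canonical C) y (σ y)) x) :
    P.IsFormCoeff (P.formCoeff σ) where
  differentiableOn β w hw := by
    have hx := (P.z β).map_target hw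
    have h := P.differentiableAt_comp_symm hx
      ((P.contMDiffAt_formCoeff hx (hσ _)).mdifferentiableAt (by simp))
    rw [(P.z β).right_inv hw] at h
    exact h.differentiableWithinAt
  transform α β x hx := by
    refine P.formCoeff_eq_of_eq_smul hx.1 ?_
    rw [P.eq_formCoeff_smul σ hx.2, P.dz_eq hx.1 hx.2, smul_smul, mul_comm]

end Forms

/-- On a surface of genus at least `2`, every point is a zero of some nonzero form. -/
lemma exists_form_zero (hgenus : 2 ≤ genus C) (p : C) : ∃ σ : Π x, Canonical C x,
    (∀ x, ContMDiffAt 𝓘(ℂ) (𝓘(ℂ).prod 𝓘(ℂ, ℂ →L[ℂ] ℂ)) ω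
      (fun y ↦ TotalSpace.mk' (ℂ →L[ℂ] ℂ) (E := Canonical C) y (σ y)) x) ∧
    (∃ y, σ y ≠ 0) ∧ P.formCoeff σ (P.index p) p = 0 := by
  have hp := P.mem_index p
  let v₀ := (P.exists_dz_eq_one hp).choose
  -- Vanishing at `p` is a single linear condition on a space of dimension at least two.
  let ev : ContMDiffSection 𝓘(ℂ) (ℂ →L[ℂ] ℂ) ω (Canonical C) →ₗ[ℂ] ℂ :=
    { toFun := fun σ ↦ σ p v₀
      map_add' := fun σ τ ↦ rfl
      map_smul' := fun c σ ↦ rfl }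
  -- `finrank` is zero in infinite dimension, so the genus hypothesis also provides finite
  -- dimensionality.
  have hfin : 0 < Module.finrank ℂ (ContMDiffSection 𝓘(ℂ) (ℂ →L[ℂ] ℂ) ω (Canonical C)) :=
    lt_of_lt_of_le two_pos hgenus
  have := Module.finite_of_finrank_pos hfin
  have hker : LinearMap.ker ev ≠ ⊥ := LinearMap.ker_ne_bot_of_finrank_lt (by
    rw [Module.finrank_self]
    exact lt_of_lt_of_le one_lt_two hgenus)
  obtain ⟨σ, hσ, hσ0⟩ := (Submodule.ne_bot_iff _).1 hker
  refine ⟨σ, fun x ↦ σ.contMDiff x, ?_, ?_⟩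
  · by_contra! h
    exact hσ0 (ContMDiffSection.ext h)
  · exact (dif_pos hp).trans hσ

theorem isIrreducible_operConnection [T2Space C] [CompactSpace C] [ConnectedSpace C]
    (hgenus : 2 ≤ genus C) : IsIrreducible P.operConnection := by
  intro x b
  have hx := P.mem_index x
  obtain ⟨σ, hσ, ⟨y, hy⟩, hp⟩ := P.exists_form_zero hgenus x
  have hy' : P.formCoeff σ (P.index y) y ≠ 0 := by
    intro h0
    apply hy
    rw [P.eq_formCoeff_smul σ (P.mem_index y), h0]
    exact zero_smul ℂ (P.dz (P.index y) y)
  have hH := isZariskiDense_of_not_hasSemiInvariant ((P.isFormCoeff_formCoeff hσ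
    ).not_hasSemiInvariant (P.mem_index y) hy' hx hp hx)
  -- Density is known in the flat basis; passing to the arbitrary basis `b` conjugates by the change
  -- of basis matrix, which need not have determinant one.
  refine hH.of_conj ((P.flatBasis hx).toMatrix_mul_toMatrix_flip b) fun A hA B hB ↦
    ⟨_, P.toLin_flatBasis_mem_holonomy hx hA, ?_⟩
  rw [hB]
  refine (basis_toMatrix_mul_linearMap_toMatrix_mul_basis_toMatrix b (P.flatBasis hx) b
    (P.flatBasis hx) _).symm.trans ?_
  exact congrArg (fun M ↦ b.toMatrix (P.flatBasis hx) * M * (P.flatBasis hx).toMatrix b)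
    (LinearMap.toMatrix_toLin (P.flatBasis hx) (P.flatBasis hx) _)

end ProjectiveCoordinateSystem

end Oper
end

/-! ### The oper of a projective coordinate system -/

theorem mainTheorem8 {C : Type*} [TopologicalSpace C] [T2Space C] [CompactSpace C]
    [ConnectedSpace C] [ChartedSpace ℂ C] [IsManifold 𝓘(ℂ) ω C] (hgenus : 2 ≤ Oper.genus C)
    {ι : Type*} (P : Oper.ProjectiveCoordinateSystem C ι) :
    -- the line bundle `K^{1/2}` defined by `ξ`, and its isomorphism `κ : K^{1/2} ⊗ K^{1/2} ≅ K`
    ∃ (S : VectorBundleCore ℂ C ℂ ι)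
      (κ : ∀ x, S.Fiber x →ₗ[ℂ] S.Fiber x →ₗ[ℂ] Oper.Canonical C x)
      -- the bundle `E` defined by `g`, and the maps of `0 → K^{1/2} → E → K^{-1/2} → 0`
      (E : VectorBundleCore ℂ C (Fin 2 → ℂ) ι)
      (i : ∀ x, S.Fiber x →ₗ[ℂ] E.Fiber x)
      (p : ∀ x, E.Fiber x →ₗ[ℂ] (S.Fiber x →L[ℂ] Bundle.Trivial C ℂ x))
      -- the connection on `E`, and the isomorphism `F ≅ (E/F) ⊗ K` for `F = i(K^{1/2})`
      (D : CovariantDerivative 𝓘(ℂ) (Fin 2 → ℂ) E.Fiber)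
      (φ : ∀ x, LinearMap.range (i x) →ₗ[ℂ]
        TangentSpace 𝓘(ℂ) x →ₗ[ℂ] E.Fiber x ⧸ LinearMap.range (i x))
      -- the flat bundle defined by `f`, with its connection `d`, and its identification with `E`
      (E₀ : VectorBundleCore ℂ C (Fin 2 → ℂ) ι)
      (D₀ : CovariantDerivative 𝓘(ℂ) (Fin 2 → ℂ) E₀.Fiber)
      (Φ : ∀ x, E₀.Fiber x ≃ₗ[ℂ] E.Fiber x),
      -- `S` is the theta characteristic given by the cocycle `ξ`
      P.IsDefinedBy S (fun α β x v ↦ P.xi α β x * v) ∧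
      Oper.IsThetaCharacteristic ℂ κ ∧
      (∀ α, ∀ x ∈ P.U α, ∀ v w : S.Fiber x,
        κ x v w = (Oper.coords S α v * Oper.coords S α w) • P.dz α x) ∧
      -- `E` is given by the cocycle `g` and is an extension of `K^{-1/2}` by `K^{1/2}`
      P.IsDefinedBy E (fun α β x v ↦ P.g α β x *ᵥ v) ∧
      Oper.IsHolomorphicHom ℂ (Fin 2 → ℂ) i ∧
      Oper.IsHolomorphicHom (E' := fun x ↦ S.Fiber x →L[ℂ] Bundle.Trivial C ℂ x)
        (Fin 2 → ℂ) (ℂ →L[ℂ] ℂ) p ∧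
      (∀ x, Function.Injective (i x) ∧ Function.Exact (i x) (p x) ∧
        Function.Surjective (p x)) ∧
      (∀ α, ∀ x ∈ P.U α,
        (∀ v : S.Fiber x, Oper.coords E α (i x v) = ![Oper.coords S α v, 0]) ∧
        (∀ (e : E.Fiber x) (v : S.Fiber x), p x e v = Oper.coords E α e 1 * Oper.coords S α v)) ∧
      -- the connection is `d - X₋ dz_α`, and it makes `E` an oper with `F = K^{1/2}`
      P.HasConnectionMatrix E D (fun α x v ↦ -(P.dz α x v • Oper.Xminus)) ∧
      Oper.IsSL2Oper D (fun x ↦ LinearMap.range (i x)) φ ∧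
      -- the isomorphism `F ≅ (E/F) ⊗ K` is given by the `(2,1)` entry of the connection matrix
      (∀ α, ∀ x ∈ P.U α, ∀ (w : LinearMap.range (i x)) (v : TangentSpace 𝓘(ℂ) x)
        (e : E.Fiber x),
        Oper.coords E α e =
          ![0, (-(P.dz α x v • Oper.Xminus)) 1 0 * Oper.coords E α (w : E.Fiber x) 0] →
        φ x w v = (LinearMap.range (i x)).mkQ e) ∧
      -- `(E, ∇)` is the flat bundle `(E₀, d)` defined by the constant cocycle `f`
      P.IsDefinedBy E₀ (fun α β _ v ↦ (P.f α β : Matrix (Fin 2) (Fin 2) ℂ) *ᵥ v) ∧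
      P.HasConnectionMatrix E₀ D₀ (fun _ _ _ ↦ 0) ∧
      Oper.IsHolomorphicHom (Fin 2 → ℂ) (Fin 2 → ℂ) (fun x ↦ (Φ x).toLinearMap) ∧
      (∀ α, ∀ x ∈ P.U α, ∀ v : E₀.Fiber x,
        Oper.coords E α (Φ x v) = !![0, 1; -1, P.z α x] *ᵥ Oper.coords E₀ α v) ∧
      (∀ (W : Set C) (s : Π x, E₀.Fiber x), IsOpen W →
        Oper.IsHolomorphicSection (Fin 2 → ℂ) W s →
        ∀ x ∈ W, ∀ v : TangentSpace 𝓘(ℂ) x,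
          D (fun y ↦ Φ y (s y)) x v = Φ x (D₀ s x v)) := by
  refine ⟨P.thetaCore, P.thetaMul, P.operCore, P.incl, P.proj, P.operConnection, P.secondForm,
    P.flatCore, P.flatConnection, fun x ↦ (P.flatIso x).toLinearEquiv, P.thetaCore_isDefinedBy,
    P.isThetaCharacteristic_thetaMul, fun α x hx v w ↦ P.thetaMul_apply hx v w,
    P.operCore_isDefinedBy, P.isHolomorphicHom_incl, P.isHolomorphicHom_proj,
    fun x ↦ ⟨P.incl_injective x, P.exact_incl_proj x, P.proj_surjective x⟩,
    fun α x hx ↦ ⟨P.coords_incl hx, P.proj_apply hx⟩, P.hasConnectionMatrix_operConnection,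
    ⟨P.contMDiffVectorBundle_operCore, P.isHolomorphicConnection_operConnection,
      P.isSL2Connection_operConnection, P.isIrreducible_operConnection hgenus,
      P.isLineSubbundle_incl, P.isInducedBy_secondForm, P.bijective_secondForm⟩,
    fun α x hx w v e he ↦ ?_, P.flatCore_isDefinedBy, P.hasConnectionMatrix_flatConnection,
    P.isHolomorphicHom_flatIso, fun α x hx v ↦ P.coords_flatIso hx v,
    fun W s _ _ x _ v ↦ P.operConnection_flatIso s x v⟩
  refine P.secondForm_apply hx w v e ?_
  rw [he]
  simp [Oper.Xminus]
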